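/- **Theorem 2 (Overfitted Model Selection).** For each sample size $n$ consider the linear regression model $Y = X\beta^\star + \sigma_\star\varepsilon$, $\varepsilon\sim\mathcal N(0,I_n)$, with a deterministic design $X\in\mathbb R^{n\times p}$ whose columns satisfy $\|X_j\|=\sqrt n$; here $p=p_n$, $X$ and $\beta^\star$ depend on $n$, and $\sigma_\star>0$ is fixed. Let $\xi_\star=\{j:\beta^\star_j\neq0\}$, $s=|\xi_\star|$, $\epsilon_n=\sqrt{s\log p/n}$. Call $\xi\subseteq\{1,\dots,p\}$ of full rank if the matrix $X_\xi$ of the columns indexed by $\xi$ has rank $|\xi|$, and let $\mathcal F$ be the set of these $\xi$. Assume that, for all large $n$, $\xi_\star\in\mathcal F$ and $p>n$, and that $\epsilon_n\to0$. The prior $\Pi$ on $(\sigma,\xi,\beta)$ is: $\sigma^2$ has density $g$ on $(0,\infty)$; independently, $\xi$ has probability proportional to $\pi(\xi)1\{\xi\in\mathcal F\}$, where $\pi$ is a probability distribution on the subsets of $\{1,\dots,p\}$; given $(\sigma,\xi)$ the $\beta_j$ are independent, $\beta_j/\sigma$ having the spike distribution $h_0$ if $j\notin\xi$ and the slab density $h_1$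 if $j\in\xi$ (with $\pi,h_0,h_1$ depending on $n$). Let $A_1,A_2,A_3,K>0$ be constants and assume: (a) $g$ is continuous and positive on $(0,\infty)$. (b) $\pi(\emptyset)\asymp1$, and for all large $n$: $\pi(\xi_\star)\ge p^{-A_1s}$ and $\sum_{|\xi|>t}\pi(\xi)\le p^{-A_2t}$ for all real $t\ge1$. (c) $z_{0n}\ge0$ satisfies $h_0(\{|z|>z_{0n}\})\le e^{-n}$ and $z_{0n}\big/\big(\tfrac1p\sqrt{\log p/n}\big)\to0$ (so $h_0$ may be the Dirac measure at $0$, with $z_{0n}=0$). (d) With $z_{1n}=\max_{j\in\xi_\star}|\beta^\star_j/\sigma_\star|+\epsilon_n$, there is $c>0$ such that $\inf_{|z|\le z_{1n}}h_1(z)\ge c\,p^{-A_3}$ for all large $n$. (e) For all large $n$, $Ks\ge1$ and $$\lambda:=\min_{\xi\in\mathcal F,\ |\xi\cup\xi_\star|\le(K+1)s}\lambda_{\min}\big(X_{\xi\cup\xi_\star}^{\mathrm T}X_{\xi\cup\xi_\star}/n\big)>0 .$$ (f) $A_1+A_3+1<A_2K$. (g) (Beta-min) For all large $n$, $\min_{j\in\xi_\star}|\beta^\star_j|\ge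 M_3\sigma_\star\epsilon_n/\sqrt\lambda$. Let $M_1,M_2,M_3>\sqrt{8\max\{A_2,1\}K}$, and let $\widetilde\Theta$ be the set of $(\sigma,\xi,\beta)$ such that $$\frac{\sigma^2}{\sigma_\star^2}\in\Big[\tfrac{1-M_1\epsilon_n}{1+M_1\epsilon_n},\tfrac{1+M_1\epsilon_n}{1-M_1\epsilon_n}\Big],\quad |\xi\setminus\xi_\star|\le Ks,\ \xi\in\mathcal F,\ \xi\supseteq\xi_\star,\quad \max_{j\notin\xi}|\beta_j|\le\sigma z_{0n},\quad \|\beta_\xi-\beta^\star_\xi\|\le \frac{M_2\sigma_\star\epsilon_n}{\sqrt\lambda}.$$ Then there are constants $C_3,C_4>0$, depending only on $A_1,A_2,A_3,K,M_1,M_2,M_3$, such that for all sufficiently large $n$ $$\mathbb P_\star\big(\Pi(\widetilde\Theta\mid X,Y)\ge1-e^{-C_3s\log p}\big)\ge1-e^{-C_4s\log p},$$ where $\mathbb P_\star$ is the law of $Y$ under the true parameters. -/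

import Mathlib

open MeasureTheory ProbabilityTheory Filter Asymptotics
open scoped ENNReal Topology

noncomputable section

namespace SpikeSlab

/-! ### The linear regression model `Y = X β + σ ε`, `ε ~ N(0, I_n)` -/

/-- The law of the response `Y` with parameters `(σ, β)`: independent coordinates,
`Y_i ~ N((X β)_i, σ²)`. -/
def responseLaw {n p : ℕ} (X : Matrix (Fin n) (Fin p) ℝ) (σ : ℝ) (β : Fin p → ℝ) :
    Measure (Fin n → ℝ) :=
  Measure.pi fun i => gaussianReal (X.mulVec β i) (σ ^ 2).toNNReal

/-- The likelihood `N(Y | X β, σ² I)`: the density of `Y` with respect to Lebesgue measure. -/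
def likelihood {n p : ℕ} (X : Matrix (Fin n) (Fin p) ℝ) (Y : Fin n → ℝ) (σ : ℝ)
    (β : Fin p → ℝ) : ℝ≥0∞ :=
  ∏ i, gaussianPDF (X.mulVec β i) (σ ^ 2).toNNReal (Y i)

/-- The true model: the index set of the nonzero coefficients. -/
def support {p : ℕ} (β : Fin p → ℝ) : Finset (Fin p) :=
  Finset.univ.filter fun j => β j ≠ 0

/-- The rate `√(s log p / n)`. -/
def rate (n p s : ℕ) : ℝ :=
  √((s : ℝ) * Real.log p / n)

/-! ### Submodels of the design matrix and the minimum united eigenvalue -/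

/-- The submatrix `X_ξ` of the columns indexed by `ξ`. -/
def subdesign {n p : ℕ} (X : Matrix (Fin n) (Fin p) ℝ) (ξ : Finset (Fin p)) :
    Matrix (Fin n) ξ ℝ :=
  X.submatrix id (fun j : ξ => (j : Fin p))

/-- The model `ξ` is of full rank. -/
def FullRank {n p : ℕ} (X : Matrix (Fin n) (Fin p) ℝ) (ξ : Finset (Fin p)) : Prop :=
  (subdesign X ξ).rank = ξ.card

/-- The smallest eigenvalue of a (symmetric) real matrix. -/
def minEigenvalue {ι : Type} [Fintype ι] [DecidableEq ι] (A : Matrix ι ι ℝ) : ℝ :=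
  sInf (spectrum ℝ A)

/-- The scaled Gram matrix `X_ξᵀ X_ξ / n`. -/
def gram {n p : ℕ} (X : Matrix (Fin n) (Fin p) ℝ) (ξ : Finset (Fin p)) : Matrix ξ ξ ℝ :=
  (n : ℝ)⁻¹ • ((subdesign X ξ).transpose * subdesign X ξ)

/-- The minimum united eigenvalue of order `t`: the minimum of the smallest eigenvalue of
`X_{ξ ∪ ξ₀}ᵀ X_{ξ ∪ ξ₀} / n` over the full-rank models `ξ` with `|ξ ∪ ξ₀| ≤ t`. -/
def muev {n p : ℕ} (X : Matrix (Fin n) (Fin p) ℝ) (ξ₀ : Finset (Fin p)) (t : ℝ) : ℝ :=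
  ⨅ ξ : {ξ : Finset (Fin p) // FullRank X ξ ∧ ((ξ ∪ ξ₀).card : ℝ) ≤ t},
    minEigenvalue (gram X (ξ.1 ∪ ξ₀))

/-! ### The spike-and-slab prior and its posterior -/

/-- The parameter space: triples `(σ, ξ, β)`. -/
abbrev Param (p : ℕ) : Type := ℝ × Finset (Fin p) × (Fin p → ℝ)

/-- `f` is a probability density on the set `S ⊆ ℝ`. -/
structure IsDensityOn (f : ℝ → ℝ) (S : Set ℝ) : Prop where
  measurable : AEMeasurable f (volume.restrict S)
  nonneg : ∀ x ∈ S, 0 ≤ f x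
  lintegral_eq_one : ∫⁻ x in S, ENNReal.ofReal (f x) = 1

/-- The distribution on `S ⊆ ℝ` with density `f`. -/
def densityLaw (f : ℝ → ℝ) (S : Set ℝ) : Measure ℝ :=
  (volume.restrict S).withDensity fun x => ENNReal.ofReal (f x)

open Classical in
/-- The prior probability of the model `ξ`: it is proportional to `w ξ` on the full-rank models
and zero on the others. -/
def modelProb {n p : ℕ} (X : Matrix (Fin n) (Fin p) ℝ) (w : Finset (Fin p) → ℝ)
    (ξ : Finset (Fin p)) : ℝ :=
  (if FullRank X ξ then w ξ else 0) / ∑ γ : Finset (Fin p), if FullRank X γ then w γ else 0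

/-- The spike-and-slab prior on `(σ, ξ, β)`: the variance `v = σ²` has density `g` on `(0, ∞)`,
the model `ξ` has probability `modelProb X w ξ` independently of `σ²`, and given these,
`β_j = σ z_j` where the `z_j` are independent with distribution `h₀` for `j ∉ ξ` and with
density `h₁` for `j ∈ ξ`, that is, `β_j` has the law `h₀(· / σ) / σ` or `h₁(· / σ) / σ`. -/
def prior {n p : ℕ} (X : Matrix (Fin n) (Fin p) ℝ) (g : ℝ → ℝ) (w : Finset (Fin p) → ℝ)
    (h₀ : Measure ℝ) (h₁ : ℝ → ℝ) : Measure (Param p) :=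
  ∑ ξ : Finset (Fin p), ENNReal.ofReal (modelProb X w ξ) •
    ((densityLaw g (Set.Ioi 0)).prod
      (Measure.pi fun j => if j ∈ ξ then densityLaw h₁ Set.univ else h₀)).map
        fun q : ℝ × (Fin p → ℝ) => ((√q.1, ξ, √q.1 • q.2) : Param p)

/-- The posterior probability of the set `B` of parameters given the response `Y`, for the prior
`Pr`, by the formula of Bayes. -/
def posteriorProb {n p : ℕ} (X : Matrix (Fin n) (Fin p) ℝ) (Pr : Measure (Param p))
    (Y : Fin n → ℝ) (B : Set (Param p)) : ℝ≥0∞ :=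
  (∫⁻ θ in B, likelihood X Y θ.1 θ.2.2 ∂Pr) / ∫⁻ θ, likelihood X Y θ.1 θ.2.2 ∂Pr

/-! ### The assumptions, along a sequence of problems indexed by the sample size `n` -/

/-- The standing assumptions on the sequence of regression problems. -/
structure Regime (p : ℕ → ℕ) (X : ∀ n, Matrix (Fin n) (Fin (p n)) ℝ) (σ₀ : ℝ)
    (β₀ : ∀ n, Fin (p n) → ℝ) : Prop where
  sigma_pos : 0 < σ₀
  standardized : ∀ n j, √(∑ i, X n i j ^ 2) = √(n : ℝ)
  fullRank : ∀ᶠ n in atTop, FullRank (X n) (support (β₀ n))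
  high_dim : ∀ᶠ n in atTop, n < p n
  rate_tendsto : Tendsto (fun n => rate n (p n) (support (β₀ n)).card) atTop (𝓝 0)

/-- The variance prior: a continuous and positive probability density on `(0, ∞)`. -/
structure VariancePrior (g : ℝ → ℝ) : Prop where
  density : IsDensityOn g (Set.Ioi 0)
  continuous : ContinuousOn g (Set.Ioi 0)
  pos : ∀ v ∈ Set.Ioi (0 : ℝ), 0 < g v

/-- The model selection prior with constants `A₁`, `A₂`. -/
structure ModelPrior (A₁ A₂ : ℝ) (p : ℕ → ℕ) (β₀ : ∀ n, Fin (p n) → ℝ)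
    (w : ∀ n, Finset (Fin (p n)) → ℝ) : Prop where
  nonneg : ∀ n ξ, 0 ≤ w n ξ
  sum_eq_one : ∀ n, ∑ ξ, w n ξ = 1
  empty : (fun n => w n ∅) =Θ[atTop] fun _ => (1 : ℝ)
  true_model : ∀ᶠ n in atTop,
    (p n : ℝ) ^ (-(A₁ * (support (β₀ n)).card)) ≤ w n (support (β₀ n))
  large_models : ∀ᶠ n in atTop, ∀ t : ℝ, 1 ≤ t →
    ∑ ξ with t < (Finset.card ξ : ℝ), w n ξ ≤ (p n : ℝ) ^ (-(A₂ * t))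

/-- The spike prior: the radius `z₀ n`, outside which the spike distribution has mass (at most)
`exp (-n)`, is `o(p⁻¹ √(log p / n))`. The Dirac measure at zero is covered, with `z₀ = 0`. -/
structure SpikePrior (p : ℕ → ℕ) (h₀ : ℕ → Measure ℝ) (z₀ : ℕ → ℝ) : Prop where
  prob : ∀ n, IsProbabilityMeasure (h₀ n)
  nonneg : ∀ n, 0 ≤ z₀ n
  tail : ∀ n, h₀ n {z | z₀ n < |z|} ≤ ENNReal.ofReal (Real.exp (-(n : ℝ)))
  small : Tendsto (fun n => z₀ n / (1 / (p n : ℝ) * √(Real.log (p n) / n))) atTop (𝓝 0)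

/-- The radius `max_{j ∈ ξ₀} |β₀_j / σ₀| + ε_n` within which the slab must not be too thin. -/
def slabRadius (n : ℕ) {p : ℕ} (σ₀ : ℝ) (β₀ : Fin p → ℝ) : ℝ :=
  (⨆ j : support β₀, |β₀ j / σ₀|) + rate n p (support β₀).card

/-- The slab prior with constant `A₃`. -/
structure SlabPrior (A₃ : ℝ) (p : ℕ → ℕ) (σ₀ : ℝ) (β₀ : ∀ n, Fin (p n) → ℝ)
    (h₁ : ℕ → ℝ → ℝ) : Prop where
  density : ∀ n, IsDensityOn (h₁ n) Set.univ
  thick : (fun n => (p n : ℝ) ^ (-A₃)) =O[atTop]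
    fun n => sInf (h₁ n '' {z | |z| ≤ slabRadius n σ₀ (β₀ n)})

/-- The value `λ(K) = MUEV((K + 1) s)`, with `s` the size of the true model. -/
def lam {n p : ℕ} (K : ℝ) (X : Matrix (Fin n) (Fin p) ℝ) (β₀ : Fin p → ℝ) : ℝ :=
  muev X (support β₀) ((K + 1) * (support β₀).card)

/-- The beta-min condition with constant `M₃`. -/
def BetaMin {n p : ℕ} (K M₃ : ℝ) (X : Matrix (Fin n) (Fin p) ℝ) (σ₀ : ℝ)
    (β₀ : Fin p → ℝ) : Prop :=
  ∀ j ∈ support β₀, M₃ * σ₀ * rate n p (support β₀).card / √(lam K X β₀) ≤ |β₀ j|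

/-! ### The set on which the posterior concentrates -/

/-- The set of the parameters `(σ, ξ, β)` with an accurate variance, a full-rank overfitted model
with at most `K s` false discoveries, negligible inactive coefficients, and accurate active
coefficients. -/
def concentrationSet {n p : ℕ} (K M₁ M₂ : ℝ) (X : Matrix (Fin n) (Fin p) ℝ) (σ₀ : ℝ)
    (β₀ : Fin p → ℝ) (z₀ : ℝ) : Set (Param p) :=
  let s := (support β₀).card
  let ε := rate n p s
  {θ | θ.1 ^ 2 / σ₀ ^ 2 ∈
          Set.Icc ((1 - M₁ * ε) / (1 + M₁ * ε)) ((1 + M₁ * ε) / (1 - M₁ * ε)) ∧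
      ((θ.2.1 \ support β₀).card : ℝ) ≤ K * s ∧
      FullRank X θ.2.1 ∧
      support β₀ ⊆ θ.2.1 ∧
      (∀ j, j ∉ θ.2.1 → |θ.2.2 j| ≤ θ.1 * z₀) ∧
      √(∑ j ∈ θ.2.1, (θ.2.2 j - β₀ j) ^ 2) ≤ M₂ * σ₀ * ε / √(lam K X β₀)}

end SpikeSlab

end

open SpikeSlab

/-!
The argument compares the posterior mass outside the concentration set with the evidence, writing
`L = s log p = n ε²` throughout.

*Evidence.* The prior charges the neighbourhood `nearTruth` of the true parameters with mass at
least `exp (-(A₁ + A₃ + 1 + d) L)` for every `d > 0` (`exp_neg_le_prior_nearTruth`): the true model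
costs `A₁`, the slab heights cost `A₃`, and the side lengths `√(log p / (n s))` of the
neighbourhood, together with the variance, cost `1`. On it the mean of the likelihood ratio
`f₀ / f_θ` under the truth, one plus a chi-square divergence, is at most the exponential of a small
multiple of `L` (`lintegral_likelihood_div_nearTruth_le`). By Markov's inequality, and since the
mean of `f_θ` over the neighbourhood is at least the inverse of that of `1 / f_θ`, the evidence is
with high probability not much smaller than `f₀` times the prior mass.

*Test.* The parameters outside the concentration set either have a model with more than `K s` false
discoveries or a large inactive coefficient, which has prior probability of order `exp (-A₂ K L)`,
or are rejected by a test with an error of that order (`responseLaw_acceptance_le`). The test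
accepts if the residual `Y - X β₀` has squared norm close to `n σ₀²` and if its projections to the
spans of the true columns and at most `K s` others are at most `T σ₀ √n ε`. Too
large a variance makes the residual too long; too small a variance makes its component orthogonal
to the span too short; and a coefficient vector away from the truth, in particular one that misses
an active coefficient, which the beta-min condition makes large, has a long projection by the
definition of the minimum united eigenvalue. The union bound over the column sets costs `exp (K L)`
under the truth; hence `T² / 2` must exceed `max A₂ 1 * K`. The projection separates truth and
alternative when `2 T < min M₂ M₃`, and so the constants `M₂`, `M₃` must exceed `√(8 max A₂ 1 K)`.
The same bound on `M₁` comes from the error `exp (-M₁² L / 8)` of the test for the variance.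

*Conclusion.* The mass outside the concentration set, restricted to the acceptance region, has
small mean with respect to Lebesgue measure, and Markov's inequality bounds its ratio to `f₀`
(`posterior_concentration`, `posteriorProb_concentrationSet`). The exponent `A₂ K` of this mass
beats the exponent `A₁ + A₃ + 1` of the evidence by assumption.
-/

namespace SpikeSlab

/-! ### Gaussian integrals and tails -/

lemma lintegral_exp_quadratic_gaussianReal {a : ℝ} (ha : a < 1 / 2) (b : ℝ) :
    ∫⁻ x, ENNReal.ofReal (Real.exp (a * x ^ 2 + b * x)) ∂gaussianReal 0 1 =
      ENNReal.ofReal ((√(1 - 2 * a))⁻¹ * Real.exp (b ^ 2 / (2 * (1 - 2 * a)))) := by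
  have hv : 0 < 1 - 2 * a := by linarith
  set w : ℝ := 1 - 2 * a with hw
  have hwi : (w⁻¹).toNNReal ≠ 0 := by simp [hv]
  rw [gaussianReal_of_var_ne_zero _ one_ne_zero,
    lintegral_withDensity_eq_lintegral_mul _ (measurable_gaussianPDF 0 1) (by fun_prop)]
  -- completing the square turns the integrand into a multiple of another Gaussian density
  have key : ∀ x : ℝ, (gaussianPDF 0 1 * fun x => ENNReal.ofReal (Real.exp (a * x ^ 2 + b * x))) x =
      ENNReal.ofReal ((√w)⁻¹ * Real.exp (b ^ 2 / (2 * w))) *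
        gaussianPDF (b / w) (w⁻¹).toNNReal x := by
    intro x
    simp only [Pi.mul_apply, gaussianPDF]
    rw [← ENNReal.ofReal_mul (gaussianPDFReal_nonneg _ _ _), ← ENNReal.ofReal_mul (by positivity)]
    congr 1
    simp only [gaussianPDFReal, NNReal.coe_one, Real.coe_toNNReal _ (inv_nonneg.2 hv.le), mul_one,
      sub_zero]
    have h1 : √(2 * Real.pi * w⁻¹) = √(2 * Real.pi) * (√w)⁻¹ := by
      rw [Real.sqrt_mul (by positivity), Real.sqrt_inv]
    rw [h1, mul_inv, inv_inv]
    have hsw : √w ≠ 0 := by positivity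
    have h2 : (√w)⁻¹ * Real.exp (b ^ 2 / (2 * w)) *
        ((√(2 * Real.pi))⁻¹ * √w * Real.exp (-(x - b / w) ^ 2 / (2 * w⁻¹))) =
        (√(2 * Real.pi))⁻¹ * (Real.exp (b ^ 2 / (2 * w)) *
          Real.exp (-(x - b / w) ^ 2 / (2 * w⁻¹))) := by
      field_simp
    rw [h2, mul_assoc, ← Real.exp_add, ← Real.exp_add]
    congr 2
    have : a = (1 - w) / 2 := by rw [hw]; ring
    rw [this]
    field_simp
    ring
  rw [lintegral_congr key, lintegral_const_mul _ (measurable_gaussianPDF _ _),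
    lintegral_gaussianPDF_eq_one _ hwi, mul_one]

lemma lintegral_prod_pi {ι : Type*} [Fintype ι] {μ : ι → Measure ℝ}
    [∀ i, IsProbabilityMeasure (μ i)] {f : ι → ℝ → ℝ≥0∞} (hf : ∀ i, Measurable (f i)) :
    ∫⁻ x, ∏ i, f i (x i) ∂Measure.pi μ = ∏ i, ∫⁻ x, f i x ∂μ i := by
  have h := lintegral_prod_eq_prod_lintegral_of_indepFun (μ := Measure.pi μ) Finset.univ
    (fun i (x : ι → ℝ) => f i (x i))
    (iIndepFun_pi (X := fun i => f i) (fun i => (hf i).aemeasurable))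
    (fun i => (hf i).comp (measurable_pi_apply i))
  rw [h]
  refine Finset.prod_congr rfl fun i _ => ?_
  exact (measurePreserving_eval μ i).lintegral_comp (hf i)

section StdGaussian

variable {E : Type*} [NormedAddCommGroup E] [InnerProductSpace ℝ E] [FiniteDimensional ℝ E]
  [MeasurableSpace E] [BorelSpace E]

/-- The noncentral chi-square moment generating function. -/
lemma lintegral_exp_norm_add_sq_stdGaussian {t : ℝ} (ht : t < 1 / 2) (m : E) :
    ∫⁻ e, ENNReal.ofReal (Real.exp (t * ‖e + m‖ ^ 2)) ∂stdGaussian E =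
      ENNReal.ofReal ((√(1 - 2 * t))⁻¹ ^ Module.finrank ℝ E *
        Real.exp (t / (1 - 2 * t) * ‖m‖ ^ 2)) := by
  have hv : 0 < 1 - 2 * t := by linarith
  set b := stdOrthonormalBasis ℝ E
  have hnorm : ∀ v : E, ‖v‖ ^ 2 = ∑ i, (inner ℝ (b i) v) ^ 2 := fun v => by
    rw [← b.sum_sq_norm_inner_right v]; simp
  rw [stdGaussian_eq_map_pi_orthonormalBasis b,
    lintegral_map (by fun_prop) (by fun_prop)]
  have key : ∀ x : Fin (Module.finrank ℝ E) → ℝ,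
      ENNReal.ofReal (Real.exp (t * ‖∑ i, x i • b i + m‖ ^ 2)) =
      ∏ i, ENNReal.ofReal (Real.exp (t * x i ^ 2 + 2 * t * inner ℝ (b i) m * x i) *
        Real.exp (t * (inner ℝ (b i) m) ^ 2)) := by
    intro x
    rw [← ENNReal.ofReal_prod_of_nonneg (fun _ _ => by positivity)]
    congr 1
    simp_rw [← Real.exp_add]
    rw [← Real.exp_sum, hnorm, Finset.mul_sum]
    congr 1
    refine Finset.sum_congr rfl fun i _ => ?_
    have : inner ℝ (b i) (∑ k, x k • b k + m) = x i + inner ℝ (b i) m := by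
      rw [inner_add_right, inner_sum]
      simp [inner_smul_right, b.inner_eq_ite]
    rw [this]; ring
  rw [lintegral_congr key, lintegral_prod_pi (f := fun i x =>
    ENNReal.ofReal (Real.exp (t * x ^ 2 + 2 * t * inner ℝ (b i) m * x) *
        Real.exp (t * (inner ℝ (b i) m) ^ 2))) (fun i => by fun_prop)]
  have each : ∀ i, ∫⁻ x, ENNReal.ofReal (Real.exp (t * x ^ 2 + 2 * t * inner ℝ (b i) m * x) *
        Real.exp (t * (inner ℝ (b i) m) ^ 2)) ∂gaussianReal 0 1 =
      ENNReal.ofReal ((√(1 - 2 * t))⁻¹ *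
        Real.exp (t / (1 - 2 * t) * (inner ℝ (b i) m) ^ 2)) := by
    intro i
    simp_rw [ENNReal.ofReal_mul (Real.exp_pos _).le]
    rw [lintegral_mul_const _ (by fun_prop), lintegral_exp_quadratic_gaussianReal ht,
      ← ENNReal.ofReal_mul (by positivity), mul_assoc, ← Real.exp_add]
    congr 3
    field_simp
    ring
  simp_rw [each]
  rw [← ENNReal.ofReal_prod_of_nonneg (fun _ _ => by positivity), Finset.prod_mul_distrib,
    Finset.prod_const, ← Real.exp_sum, ← Finset.mul_sum, ← hnorm]
  simp

/-- Chernoff's bound for `‖e + m‖²` under the standard Gaussian law. -/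
lemma stdGaussian_exp_le {t : ℝ} (ht : t < 1 / 2) (m : E) (x : ℝ) :
    stdGaussian E {e | x ≤ t * ‖e + m‖ ^ 2} ≤
      ENNReal.ofReal (Real.exp (-x) * ((√(1 - 2 * t))⁻¹ ^ Module.finrank ℝ E *
        Real.exp (t / (1 - 2 * t) * ‖m‖ ^ 2))) := by
  have h := mul_meas_ge_le_lintegral (μ := stdGaussian E)
    (f := fun e => ENNReal.ofReal (Real.exp (t * ‖e + m‖ ^ 2))) (by fun_prop)
    (ENNReal.ofReal (Real.exp x))
  rw [lintegral_exp_norm_add_sq_stdGaussian ht] at h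
  have hset : {e : E | x ≤ t * ‖e + m‖ ^ 2} ⊆ {e | ENNReal.ofReal (Real.exp x) ≤
      ENNReal.ofReal (Real.exp (t * ‖e + m‖ ^ 2))} := fun e he =>
    ENNReal.ofReal_le_ofReal (Real.exp_le_exp.2 he)
  refine (measure_mono hset).trans ?_
  rw [ENNReal.ofReal_mul (Real.exp_pos _).le, Real.exp_neg,
    ENNReal.ofReal_inv_of_pos (Real.exp_pos _), mul_comm, ← div_eq_mul_inv,
    ENNReal.le_div_iff_mul_le (Or.inl (by positivity)) (Or.inl ENNReal.ofReal_ne_top), mul_comm]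
  exact h

lemma inv_sqrt_pow_le {u : ℝ} (hu : 0 < u) {c : ℝ} (h : -Real.log u ≤ 2 * c) (d : ℕ) :
    (√u)⁻¹ ^ d ≤ Real.exp (d * c) := by
  have : (√u)⁻¹ ≤ Real.exp c := by
    rw [← Real.exp_log (inv_pos.2 (Real.sqrt_pos.2 hu)), Real.log_inv, Real.log_sqrt hu.le]
    exact Real.exp_le_exp.2 (by linarith)
  calc (√u)⁻¹ ^ d ≤ Real.exp c ^ d := by gcongr
    _ = _ := by rw [← Real.exp_nat_mul]

/-- Lower deviations of `‖e + m‖²`: the shift `m` only makes them less likely. -/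
lemma stdGaussian_norm_sq_le {x : ℝ} (hx : 0 ≤ x) (m : E) :
    stdGaussian E {e | ‖e + m‖ ^ 2 ≤ Module.finrank ℝ E * (1 - x)} ≤
      ENNReal.ofReal (Real.exp (-(Module.finrank ℝ E * x ^ 2 / 4))) := by
  set d := Module.finrank ℝ E
  have h := stdGaussian_exp_le (t := -(x / 2)) (by linarith) m (-(x / 2) * (d * (1 - x)))
  refine (measure_mono ?_).trans (h.trans ?_)
  · intro e he
    simp only [Set.mem_ofPred_eq] at he ⊢
    nlinarith
  · refine ENNReal.ofReal_le_ofReal ?_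
    have h1 : (√(1 - 2 * -(x / 2)))⁻¹ ^ d ≤ Real.exp (d * (-(x / 2) + x ^ 2 / 4)) := by
      refine inv_sqrt_pow_le (by linarith) ?_ d
      have : 1 - 2 * -(x / 2) = 1 + x := by ring
      rw [this]
      -- `log (1 + x) ≥ 2 x / (x + 2) ≥ x - x² / 2`
      have h2 := Real.le_log_one_add_of_nonneg hx
      have h3 : x - x ^ 2 / 2 ≤ 2 * x / (x + 2) := by
        rw [le_div_iff₀ (by linarith)]
        nlinarith [pow_nonneg hx 3]
      linarith
    have h2 : Real.exp (-(x / 2) / (1 - 2 * -(x / 2)) * ‖m‖ ^ 2) ≤ 1 := by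
      rw [Real.exp_le_one_iff]
      refine mul_nonpos_of_nonpos_of_nonneg ?_ (by positivity)
      exact div_nonpos_of_nonpos_of_nonneg (by linarith) (by linarith)
    calc _ ≤ Real.exp (-(-(x / 2) * (d * (1 - x)))) *
          (Real.exp (d * (-(x / 2) + x ^ 2 / 4)) * 1) := by gcongr
      _ = _ := by
        rw [mul_one, ← Real.exp_add]
        congr 1; ring

/-- Upper deviations of `‖e + m‖²`. -/
lemma stdGaussian_le_norm_sq {x : ℝ} (hx : 0 ≤ x) (hx1 : x ≤ 1 / 2) (m : E) :
    stdGaussian E {e | Module.finrank ℝ E * (1 + x) ≤ ‖e + m‖ ^ 2} ≤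
      ENNReal.ofReal (Real.exp (-(Module.finrank ℝ E * x ^ 2 / 8) + ‖m‖ ^ 2)) := by
  set d := Module.finrank ℝ E
  have h := stdGaussian_exp_le (t := x / 4) (by linarith) m (x / 4 * (d * (1 + x)))
  refine (measure_mono ?_).trans (h.trans ?_)
  · intro e he
    simp only [Set.mem_ofPred_eq] at he ⊢
    gcongr
  · refine ENNReal.ofReal_le_ofReal ?_
    have h1 : (√(1 - 2 * (x / 4)))⁻¹ ^ d ≤ Real.exp (d * (x / 4 + x ^ 2 / 8)) := by
      refine inv_sqrt_pow_le (by linarith) ?_ d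
      have : 1 - 2 * (x / 4) = 1 - x / 2 := by ring
      rw [this]
      have h2 := Real.abs_log_sub_add_sum_range_le (x := x / 2)
        (by rw [abs_of_nonneg (by linarith)]; linarith) 2
      have h3 : |x / 2| ^ (2 + 1) / (1 - |x / 2|) ≤ x ^ 2 / 8 := by
        rw [abs_of_nonneg (by linarith), div_le_iff₀ (by linarith)]
        nlinarith [mul_nonneg (mul_nonneg hx hx) (sub_nonneg.2 hx1)]
      have h4 := (abs_le.1 (h2.trans h3)).1
      norm_num [Finset.sum_range_succ] at h4
      linarith
    have h2 : Real.exp (x / 4 / (1 - 2 * (x / 4)) * ‖m‖ ^ 2) ≤ Real.exp (‖m‖ ^ 2) := by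
      refine Real.exp_le_exp.2 (mul_le_of_le_one_left (by positivity) ?_)
      rw [div_le_one (by linarith)]
      linarith
    calc _ ≤ Real.exp (-(x / 4 * (d * (1 + x)))) *
          (Real.exp (d * (x / 4 + x ^ 2 / 8)) * Real.exp (‖m‖ ^ 2)) := by gcongr
      _ = _ := by
        rw [← Real.exp_add, ← Real.exp_add]
        congr 1; ring

/-- The orthogonal projection of a standard Gaussian vector is standard Gaussian. -/
lemma map_orthogonalProjection_stdGaussian (V : Submodule ℝ E) :
    (stdGaussian E).map V.orthogonalProjectionOnto = stdGaussian V := by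
  refine Measure.ext_of_charFun ?_
  ext v
  have h := charFun_stdGaussian (E := E) (v : E)
  rw [charFun_apply] at h
  rw [charFun_stdGaussian, charFun_apply, integral_map (by fun_prop) (by fun_prop)]
  simp_rw [Submodule.inner_orthogonalProjectionOnto_eq_of_mem_right]
  exact h

/-- The chi-square tail bound for the projection of a standard Gaussian vector to a subspace. -/
lemma stdGaussian_projection_tail (V : Submodule ℝ E) {t : ℝ} (ht : t < 1 / 2) (ht0 : 0 ≤ t)
    {x : ℝ} (hx : 0 ≤ x) :
    stdGaussian E {e | x < ‖V.starProjection e‖} ≤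
      ENNReal.ofReal ((√(1 - 2 * t))⁻¹ ^ Module.finrank ℝ V * Real.exp (-(t * x ^ 2))) := by
  have h := stdGaussian_exp_le (E := V) ht 0 (t * x ^ 2)
  rw [← map_orthogonalProjection_stdGaussian V, Measure.map_apply (by fun_prop)
    (measurableSet_le (by fun_prop) (by fun_prop))] at h
  refine (measure_mono ?_).trans (h.trans ?_)
  · intro e he
    simp only [Set.mem_ofPred_eq, Set.mem_preimage, add_zero] at he ⊢
    rw [Submodule.starProjection_apply] at he
    have : x ^ 2 ≤ ‖V.orthogonalProjectionOnto e‖ ^ 2 := by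
      have : x < ‖V.orthogonalProjectionOnto e‖ := he
      gcongr
    gcongr
  · refine ENNReal.ofReal_le_ofReal (le_of_eq ?_)
    simp
    ring

end StdGaussian

section Response

variable {n p : ℕ}

/-- The law of the response is that of `X β + σ ε` for a standard Gaussian vector `ε`. -/
lemma responseLaw_eq_map (X : Matrix (Fin n) (Fin p) ℝ) (σ : ℝ) (β : Fin p → ℝ) :
    responseLaw X σ β = (stdGaussian (EuclideanSpace ℝ (Fin n))).map
      fun e i => X.mulVec β i + σ * e i := by
  rw [← map_pi_eq_stdGaussian, Measure.map_map (by fun_prop) (by fun_prop)]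
  have h := Measure.pi_map_pi (μ := fun _ : Fin n => gaussianReal 0 1)
    (f := fun i x => X.mulVec β i + σ * x)
    (hμ := fun i => by
      have := Measure.isProbabilityMeasure_map (μ := gaussianReal 0 1)
        (f := fun x => X.mulVec β i + σ * x) (by fun_prop)
      infer_instance) (fun i => by fun_prop)
  have hcomp : (fun (e : EuclideanSpace ℝ (Fin n)) i => X.mulVec β i + σ * e i) ∘ WithLp.toLp 2 =
      fun (x : Fin n → ℝ) i => X.mulVec β i + σ * x i := rfl
  rw [hcomp, h, responseLaw]
  congr 1
  ext1 i
  have : (fun x => X.mulVec β i + σ * x) = (fun x => X.mulVec β i + x) ∘ (fun x => σ * x) := rfl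
  rw [this, ← Measure.map_map (by fun_prop) (by fun_prop), gaussianReal_map_const_mul,
    gaussianReal_map_const_add]
  congr 1
  · simp
  · ext; simp [sq_nonneg]

instance (X : Matrix (Fin n) (Fin p) ℝ) (σ : ℝ) (β : Fin p → ℝ) :
    IsProbabilityMeasure (responseLaw X σ β) := by
  unfold responseLaw; infer_instance

lemma measurable_likelihood (X : Matrix (Fin n) (Fin p) ℝ) :
    Measurable fun q : Param p × (Fin n → ℝ) => likelihood X q.2 q.1.1 q.1.2.2 := by
  unfold likelihood
  refine Finset.measurable_prod _ fun i _ => ?_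
  have h : Measurable fun q : Param p × (Fin n → ℝ) =>
      (X.mulVec q.1.2.2 i, (q.1.1 ^ 2).toNNReal, q.2 i) := by
    unfold Matrix.mulVec dotProduct
    fun_prop
  exact measurable_uncurry_gaussianPDF.comp h

lemma measurable_likelihood_right (X : Matrix (Fin n) (Fin p) ℝ) (σ : ℝ) (β : Fin p → ℝ) :
    Measurable fun Y => likelihood X Y σ β :=
  Finset.measurable_prod _ fun i _ =>
    (measurable_gaussianPDF _ _).comp (measurable_pi_apply i)

lemma likelihood_pos (X : Matrix (Fin n) (Fin p) ℝ) {σ : ℝ} (hσ : 0 < σ) (β : Fin p → ℝ)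
    (Y : Fin n → ℝ) : 0 < likelihood X Y σ β :=
  CanonicallyOrderedAdd.prod_pos.2 fun _ _ => gaussianPDF_pos _ (by simp [hσ.ne']) _

lemma likelihood_ne_top (X : Matrix (Fin n) (Fin p) ℝ) (σ : ℝ) (β : Fin p → ℝ)
    (Y : Fin n → ℝ) : likelihood X Y σ β ≠ ∞ :=
  ENNReal.prod_ne_top fun _ _ => gaussianPDF_ne_top

lemma responseLaw_eq_withDensity (X : Matrix (Fin n) (Fin p) ℝ) {σ : ℝ} (hσ : 0 < σ)
    (β : Fin p → ℝ) :
    responseLaw X σ β = volume.withDensity fun Y => likelihood X Y σ β := by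
  have hv : (σ ^ 2).toNNReal ≠ 0 := by simp [hσ.ne']
  refine (Measure.pi_eq fun s hs => ?_)
  rw [withDensity_apply _ (MeasurableSet.univ_pi hs), volume_pi, Measure.restrict_pi_pi]
  have := fun i => integrable_gaussianPDFReal (X.mulVec β i) (σ ^ 2).toNNReal
  have hint : Integrable (fun Y : Fin n → ℝ => ∏ i, gaussianPDFReal (X.mulVec β i)
      (σ ^ 2).toNNReal (Y i)) (Measure.pi fun i => volume.restrict (s i)) :=
    Integrable.fintype_prod_dep fun i => (this i).restrict
  have h1 : ∀ Y : Fin n → ℝ, likelihood X Y σ β =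
      ENNReal.ofReal (∏ i, gaussianPDFReal (X.mulVec β i) (σ ^ 2).toNNReal (Y i)) := fun Y =>
    (ENNReal.ofReal_prod_of_nonneg fun i _ => gaussianPDFReal_nonneg _ _ _).symm
  simp_rw [h1]
  rw [← ofReal_integral_eq_lintegral_ofReal hint (Eventually.of_forall fun Y =>
    Finset.prod_nonneg fun i _ => gaussianPDFReal_nonneg _ _ _),
    integral_fintype_prod_eq_prod (f := fun i => gaussianPDFReal (X.mulVec β i) (σ ^ 2).toNNReal),
    ENNReal.ofReal_prod_of_nonneg fun i _ => setIntegral_nonneg (hs i)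
      fun x _ => gaussianPDFReal_nonneg _ _ _]
  refine Finset.prod_congr rfl fun i _ => ?_
  rw [gaussianReal_apply_eq_integral _ hv]

/-- One plus the chi-square divergence of `N(m, σ²)` from `N(m₀, σ₀²)`, for `σ ≥ σ₀`: with a smaller
variance in the denominator the integral could diverge. -/
lemma lintegral_gaussianPDF_div {σ₀ σ : ℝ} (h₀ : 0 < σ₀) (hσ : σ₀ ≤ σ)
    (hu : (1 - σ₀ ^ 2 / σ ^ 2) ^ 2 ≤ 1 / 2) (m₀ m : ℝ) :
    ∫⁻ y, gaussianPDF m₀ (σ₀ ^ 2).toNNReal y / gaussianPDF m (σ ^ 2).toNNReal y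
        ∂gaussianReal m₀ (σ₀ ^ 2).toNNReal ≤
      ENNReal.ofReal (Real.exp ((1 - σ₀ ^ 2 / σ ^ 2) ^ 2 + (m - m₀) ^ 2 / σ₀ ^ 2)) := by
  have hs : 0 < σ := h₀.trans_le hσ
  set d := m - m₀ with hd
  set ρ := σ₀ ^ 2 / σ ^ 2 with hρ
  have hρ0 : 0 < ρ := by positivity
  have hρ1 : ρ ≤ 1 := (div_le_one (by positivity)).2 (by gcongr)
  have hlaw : gaussianReal m₀ (σ₀ ^ 2).toNNReal =
      (gaussianReal 0 1).map (fun x => m₀ + σ₀ * x) := by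
    have : (fun x => m₀ + σ₀ * x) = (fun x => m₀ + x) ∘ (fun x => σ₀ * x) := rfl
    rw [this, ← Measure.map_map (by fun_prop) (by fun_prop), gaussianReal_map_const_mul,
      gaussianReal_map_const_add]
    congr 1
    · simp
    · ext; simp [sq_nonneg]
  rw [hlaw, lintegral_map (f := fun y => gaussianPDF m₀ (σ₀ ^ 2).toNNReal y /
    gaussianPDF m (σ ^ 2).toNNReal y)
    ((measurable_gaussianPDF _ _).div (measurable_gaussianPDF _ _))
    (by fun_prop)]
  have key : ∀ x : ℝ, gaussianPDF m₀ (σ₀ ^ 2).toNNReal (m₀ + σ₀ * x) /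
      gaussianPDF m (σ ^ 2).toNNReal (m₀ + σ₀ * x) =
      ENNReal.ofReal (σ / σ₀ * Real.exp (d ^ 2 / (2 * σ ^ 2))) *
        ENNReal.ofReal (Real.exp ((ρ - 1) / 2 * x ^ 2 + -(σ₀ * d / σ ^ 2) * x)) := by
    intro x
    have hpos : 0 < gaussianPDFReal m (σ ^ 2).toNNReal (m₀ + σ₀ * x) :=
      gaussianPDFReal_pos _ _ _ (by simp [hs.ne'])
    rw [gaussianPDF, gaussianPDF, ← ENNReal.ofReal_div_of_pos hpos,
      ← ENNReal.ofReal_mul (by positivity)]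
    congr 1
    simp only [gaussianPDFReal, Real.coe_toNNReal _ (sq_nonneg _)]
    rw [Real.sqrt_mul (by positivity) (σ₀ ^ 2), Real.sqrt_mul (by positivity) (σ ^ 2),
      Real.sqrt_sq h₀.le, Real.sqrt_sq hs.le, mul_div_mul_comm, ← Real.exp_sub, mul_assoc,
      ← Real.exp_add]
    congr 1
    · have : √(2 * Real.pi) ≠ 0 := by positivity
      field_simp
    · congr 1
      rw [hρ, hd]
      field_simp
      ring
  rw [lintegral_congr key, lintegral_const_mul _ (by fun_prop),
    lintegral_exp_quadratic_gaussianReal (by linarith), ← ENNReal.ofReal_mul (by positivity)]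
  refine ENNReal.ofReal_le_ofReal ?_
  have e1 : 1 - 2 * ((ρ - 1) / 2) = 2 - ρ := by ring
  rw [e1]
  have hfac : σ / σ₀ * (√(2 - ρ))⁻¹ ≤ Real.exp ((1 - ρ) ^ 2) := by
    have h1 : σ / σ₀ * (√(2 - ρ))⁻¹ = (√(1 - (1 - ρ) ^ 2))⁻¹ := by
      have : 1 - (1 - ρ) ^ 2 = ρ * (2 - ρ) := by ring
      rw [this, Real.sqrt_mul hρ0.le, hρ, Real.sqrt_div (by positivity), Real.sqrt_sq h₀.le,
        Real.sqrt_sq hs.le, mul_inv, inv_div]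
    have h2 := inv_sqrt_pow_le (u := 1 - (1 - ρ) ^ 2) (by linarith) (c := (1 - ρ) ^ 2) (by
      have h3 := Real.one_sub_inv_le_log_of_pos (x := 1 - (1 - ρ) ^ 2) (by linarith)
      have h4 : (1 - (1 - ρ) ^ 2)⁻¹ ≤ 1 + 2 * (1 - ρ) ^ 2 := by
        rw [inv_le_iff_one_le_mul₀ (by linarith)]
        nlinarith [sq_nonneg (1 - ρ)]
      linarith) 1
    rw [h1]
    simpa using h2
  have hexp : d ^ 2 / (2 * σ ^ 2) + (-(σ₀ * d / σ ^ 2)) ^ 2 / (2 * (2 - ρ)) ≤ d ^ 2 / σ₀ ^ 2 := by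
    have h1 : (-(σ₀ * d / σ ^ 2)) ^ 2 / (2 * (2 - ρ)) ≤ d ^ 2 / (2 * σ ^ 2) := by
      have : (-(σ₀ * d / σ ^ 2)) ^ 2 / (2 * (2 - ρ)) = d ^ 2 / (2 * σ ^ 2) * (ρ / (2 - ρ)) := by
        rw [hρ]; field_simp
      rw [this]
      exact mul_le_of_le_one_right (by positivity) ((div_le_one (by linarith)).2 (by linarith))
    have h2 : d ^ 2 / (2 * σ ^ 2) + d ^ 2 / (2 * σ ^ 2) = d ^ 2 / σ ^ 2 := by field_simp; ring
    have h3 : d ^ 2 / σ ^ 2 ≤ d ^ 2 / σ₀ ^ 2 := by gcongr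
    linarith
  calc _ = (σ / σ₀ * (√(2 - ρ))⁻¹) * Real.exp (d ^ 2 / (2 * σ ^ 2) +
        (-(σ₀ * d / σ ^ 2)) ^ 2 / (2 * (2 - ρ))) := by rw [Real.exp_add]; ring
    _ ≤ Real.exp ((1 - ρ) ^ 2) * Real.exp (d ^ 2 / σ₀ ^ 2) := by gcongr
    _ = _ := by rw [← Real.exp_add]

/-- `lintegral_gaussianPDF_div` for response vectors. -/
lemma lintegral_likelihood_div (X : Matrix (Fin n) (Fin p) ℝ) {σ₀ σ : ℝ} (h₀ : 0 < σ₀)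
    (hσ : σ₀ ≤ σ) (hu : (1 - σ₀ ^ 2 / σ ^ 2) ^ 2 ≤ 1 / 2) (β₀ β : Fin p → ℝ) :
    ∫⁻ Y, likelihood X Y σ₀ β₀ / likelihood X Y σ β ∂responseLaw X σ₀ β₀ ≤
      ENNReal.ofReal (Real.exp (n * (1 - σ₀ ^ 2 / σ ^ 2) ^ 2 +
        (∑ i, (X.mulVec β i - X.mulVec β₀ i) ^ 2) / σ₀ ^ 2)) := by
  have hdiv : ∀ Y : Fin n → ℝ, likelihood X Y σ₀ β₀ / likelihood X Y σ β =
      ∏ i, gaussianPDF (X.mulVec β₀ i) (σ₀ ^ 2).toNNReal (Y i) /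
        gaussianPDF (X.mulVec β i) (σ ^ 2).toNNReal (Y i) := fun Y =>
    (ENNReal.prod_div_distrib_of_ne_top fun i _ => gaussianPDF_ne_top).symm
  simp_rw [hdiv]
  rw [responseLaw, lintegral_prod_pi (f := fun i y =>
    gaussianPDF (X.mulVec β₀ i) (σ₀ ^ 2).toNNReal y /
        gaussianPDF (X.mulVec β i) (σ ^ 2).toNNReal y)
    fun i => (measurable_gaussianPDF _ _).div (measurable_gaussianPDF _ _)]
  refine (Finset.prod_le_prod' fun i _ => lintegral_gaussianPDF_div h₀ hσ hu _ _).trans ?_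
  rw [← ENNReal.ofReal_prod_of_nonneg (fun _ _ => by positivity), ← Real.exp_sum,
    Finset.sum_add_distrib, Finset.sum_div]
  simp

end Response

/-! ### Posterior probabilities from a lower bound on the evidence and a test -/

/-- The inequality of arithmetic and geometric means; `0` and `∞` are covered by `0⁻¹ = ∞`. -/
lemma two_le_add_inv (z : ℝ≥0∞) : 2 ≤ z + z⁻¹ := by
  rcases eq_or_ne z 0 with rfl | h0
  · simp
  rcases eq_or_ne z ∞ with rfl | h1
  · simp
  have hz : 0 < z.toReal := ENNReal.toReal_pos h0 h1
  rw [← ENNReal.ofReal_toReal h1, ← ENNReal.ofReal_inv_of_pos hz,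
    ← ENNReal.ofReal_add hz.le (by positivity)]
  have : (2 : ℝ≥0∞) = ENNReal.ofReal 2 := by norm_num
  rw [this]
  refine ENNReal.ofReal_le_ofReal ?_
  have := mul_inv_cancel₀ hz.ne'
  nlinarith [sq_nonneg (z.toReal - 1), inv_pos.2 hz, sq_nonneg (z.toReal - z.toReal⁻¹)]

section Posterior

variable {Θ 𝒴 : Type*} [MeasurableSpace Θ] [MeasurableSpace 𝒴] {μ : Measure 𝒴} [SFinite μ]
  (Pr : Measure Θ) {f : Θ → 𝒴 → ℝ≥0∞} {f₀ : 𝒴 → ℝ≥0∞}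

/-- Under the law with density `f₀`, the mass `∫_N f_θ dΠ(θ)` can exceed `c f₀` inside `A` only
with small probability: its integral over `A` is the mean over `N` of the probability of `A`
under `θ`. -/
lemma withDensity_mul_le_setLIntegral [SFinite Pr] (hf : Measurable (Function.uncurry f))
    (hf₀ : Measurable f₀) {A : Set 𝒴} (hA : MeasurableSet A) (N : Set Θ) (c : ℝ≥0∞) :
    c * μ.withDensity f₀ {Y | Y ∈ A ∧ c * f₀ Y ≤ ∫⁻ θ in N, f θ Y ∂Pr} ≤
      ∫⁻ θ in N, (∫⁻ Y in A, f θ Y ∂μ) ∂Pr := by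
  have hint : Measurable fun Y => ∫⁻ θ in N, f θ Y ∂Pr := hf.lintegral_prod_left'
  set S := {Y | Y ∈ A ∧ c * f₀ Y ≤ ∫⁻ θ in N, f θ Y ∂Pr}
  have hS : MeasurableSet S := hA.inter (measurableSet_le (hf₀.const_mul c) hint)
  rw [withDensity_apply _ hS, ← lintegral_const_mul _ hf₀]
  calc ∫⁻ Y in S, c * f₀ Y ∂μ
      ≤ ∫⁻ Y in S, ∫⁻ θ in N, f θ Y ∂Pr ∂μ := setLIntegral_mono hint fun Y hY => hY.2
    _ ≤ ∫⁻ Y in A, ∫⁻ θ in N, f θ Y ∂Pr ∂μ := lintegral_mono_set fun Y hY => hY.1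
    _ = ∫⁻ θ in N, (∫⁻ Y in A, f θ Y ∂μ) ∂Pr :=
        lintegral_lintegral_swap (hf.comp measurable_swap).aemeasurable

/-- The evidence is almost surely finite, so that Bayes' formula does not divide by `∞`. -/
lemma ae_evidence_lt_top [IsFiniteMeasure Pr] (hf : Measurable (Function.uncurry f))
    (h1 : ∀ᵐ θ ∂Pr, ∫⁻ Y, f θ Y ∂μ = 1) :
    ∀ᵐ Y ∂μ.withDensity f₀, ∫⁻ θ, f θ Y ∂Pr < ∞ := by
  refine (withDensity_absolutelyContinuous _ _).ae_le ?_
  refine ae_lt_top hf.lintegral_prod_left' ?_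
  rw [lintegral_lintegral_swap (f := fun Y θ => f θ Y) (hf.comp measurable_swap).aemeasurable,
    lintegral_congr_ae h1]
  simp

/-- If the mean of `f₀ / f_θ` over `G` is at most `b`, then the mean of `f_θ` over `G` is at least
`f₀ / b`. -/
lemma evidence_ge_of_lintegral_div_le [IsFiniteMeasure Pr] (hf : Measurable (Function.uncurry f))
    {G : Set Θ} {b : ℝ≥0∞} (hb0 : b ≠ 0) (hb : b ≠ ∞) {Y : 𝒴} (hL0 : f₀ Y ≠ 0) (hLt : f₀ Y ≠ ∞)
    (hY : ∫⁻ θ in G, f₀ Y / f θ Y ∂Pr ≤ b * Pr G) :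
    f₀ Y * Pr G ≤ b * ∫⁻ θ in G, f θ Y ∂Pr := by
  set L₀ := f₀ Y
  have hm : Measurable fun θ => f θ Y := hf.comp measurable_prodMk_right
  have h1 : 2 * Pr G ≤ b * L₀⁻¹ * (∫⁻ θ in G, f θ Y ∂Pr) +
      b⁻¹ * ∫⁻ θ in G, L₀ / f θ Y ∂Pr := by
    rw [← lintegral_const_mul _ hm, ← lintegral_const_mul _ (by fun_prop),
      ← lintegral_add_left (by fun_prop), ← setLIntegral_const]
    refine lintegral_mono fun θ => ?_
    have hinv : b⁻¹ * (L₀ / f θ Y) =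
        (b * L₀⁻¹ * f θ Y)⁻¹ := by
      have hne : b * L₀⁻¹ ≠ 0 := mul_ne_zero hb0 (ENNReal.inv_ne_zero.2 hLt)
      have hnt : b * L₀⁻¹ ≠ ∞ := ENNReal.mul_ne_top hb (ENNReal.inv_ne_top.2 hL0)
      rw [ENNReal.mul_inv (Or.inl hne) (Or.inl hnt), ENNReal.mul_inv (Or.inl hb0) (Or.inl hb),
        inv_inv, div_eq_mul_inv, mul_assoc]
    rw [hinv]
    exact two_le_add_inv _
  have h2 : b⁻¹ * ∫⁻ θ in G, L₀ / f θ Y ∂Pr ≤ Pr G := by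
    calc _ ≤ b⁻¹ * (b * Pr G) := by gcongr
      _ = Pr G := by rw [← mul_assoc, ENNReal.inv_mul_cancel hb0 hb, one_mul]
  have h3 : Pr G ≤ b * L₀⁻¹ * (∫⁻ θ in G, f θ Y ∂Pr) := by
    refine (ENNReal.add_le_add_iff_right (measure_ne_top Pr G)).1 ?_
    calc Pr G + Pr G = 2 * Pr G := (two_mul _).symm
      _ ≤ _ := h1
      _ ≤ _ := by gcongr
  calc L₀ * Pr G ≤ L₀ * (b * L₀⁻¹ * (∫⁻ θ in G, f θ Y ∂Pr)) := by gcongr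
    _ = (L₀ * L₀⁻¹) * (b * (∫⁻ θ in G, f θ Y ∂Pr)) := by ring
    _ = _ := by rw [ENNReal.mul_inv_cancel hL0 hLt, one_mul]

/-- Markov's inequality for the mean of the likelihood ratio `f₀ / f_θ` over `G`. -/
lemma withDensity_lintegral_div_gt [IsFiniteMeasure Pr] (hf : Measurable (Function.uncurry f))
    (hf₀ : Measurable f₀) {G : Set Θ} (hG0 : Pr G ≠ 0) {k : ℝ≥0∞}
    (hk : ∀ θ ∈ G, ∫⁻ Y, f₀ Y / f θ Y ∂μ.withDensity f₀ ≤ k) {b : ℝ≥0∞} (hb0 : b ≠ 0)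
    (hb : b ≠ ∞) :
    μ.withDensity f₀ {Y | b * Pr G < ∫⁻ θ in G, f₀ Y / f θ Y ∂Pr} ≤ k / b := by
  have hm : Measurable fun q : Θ × 𝒴 => f₀ q.2 / f q.1 q.2 := (hf₀.comp measurable_snd).div hf
  have h := mul_meas_ge_le_lintegral (μ := μ.withDensity f₀)
    (f := fun Y => ∫⁻ θ in G, f₀ Y / f θ Y ∂Pr)
    hm.lintegral_prod_left' (b * Pr G)
  rw [lintegral_lintegral_swap (f := fun Y θ => f₀ Y / f θ Y)
    (hm.comp measurable_swap).aemeasurable] at h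
  have h2 : ∫⁻ θ in G, ∫⁻ Y, f₀ Y / f θ Y
      ∂μ.withDensity f₀ ∂Pr ≤ k * Pr G := by
    rw [← setLIntegral_const]
    exact setLIntegral_mono measurable_const hk
  have h3 : b * μ.withDensity f₀ {Y | b * Pr G ≤
      ∫⁻ θ in G, f₀ Y / f θ Y ∂Pr} ≤ k := by
    refine (ENNReal.mul_le_mul_iff_left hG0 (measure_ne_top Pr G)).1 ?_
    calc _ = b * Pr G * _ := by rw [mul_right_comm]
      _ ≤ _ := h.trans h2
  rw [ENNReal.le_div_iff_mul_le (Or.inl hb0) (Or.inl hb), mul_comm]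
  refine le_trans ?_ h3
  exact mul_le_mul' le_rfl (measure_mono fun Y hY => by
    simp only [Set.mem_ofPred_eq] at hY ⊢
    exact hY.le)

/-- The posterior mass of a set `B` is at least `1 - x` with high probability if the prior charges
a set `G` of parameters close to the truth, and the parameters outside `B` have little prior mass
or rarely produce data in `A`, an event that is likely under the truth. -/
theorem posterior_concentration [IsFiniteMeasure Pr] (hf : Measurable (Function.uncurry f))
    (hf₀ : Measurable f₀) (h1 : ∀ᵐ θ ∂Pr, ∫⁻ Y, f θ Y ∂μ = 1)
    [IsProbabilityMeasure (μ.withDensity f₀)] (hpos : ∀ Y, 0 < f₀ Y) (hfin : ∀ Y, f₀ Y ≠ ∞)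
    {G : Set Θ} {γ k a τ x y : ℝ} (hγ : 0 < γ) (hx : 0 < x) (hy : 0 < y) (ha0 : 0 ≤ a)
    (hτ0 : 0 ≤ τ) (hGγ : ENNReal.ofReal γ ≤ Pr G)
    (hk : ∀ θ ∈ G, ∫⁻ Y, f₀ Y / f θ Y ∂μ.withDensity f₀ ≤ ENNReal.ofReal (Real.exp k))
    {A : Set 𝒴} (hA : MeasurableSet A) (ha : μ.withDensity f₀ Aᶜ ≤ ENNReal.ofReal a) {B : Set Θ}
    (hτ : ∫⁻ θ in Bᶜ, (∫⁻ Y in A, f θ Y ∂μ) ∂Pr ≤ ENNReal.ofReal τ) :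
    ENNReal.ofReal (1 - (a + y + τ * Real.exp k / (x * γ * y))) ≤
      μ.withDensity f₀
        {Y | ENNReal.ofReal (1 - x) ≤ (∫⁻ θ in B, f θ Y ∂Pr) / ∫⁻ θ, f θ Y ∂Pr} := by
  set P₀ := μ.withDensity f₀
  set b : ℝ := Real.exp k / y with hb
  have hbpos : 0 < b := by positivity
  set c : ℝ := x * γ / b with hc
  have hcpos : 0 < c := by positivity
  set S₁ := {Y | Y ∈ A ∧ ENNReal.ofReal c * f₀ Y ≤
    ∫⁻ θ in Bᶜ, f θ Y ∂Pr}
  set S₂ := {Y | ENNReal.ofReal b * Pr G <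
      ∫⁻ θ in G, f₀ Y / f θ Y ∂Pr}
  set S₃ := {Y | ¬ ∫⁻ θ, f θ Y ∂Pr < ∞}
  have hS₁ : P₀ S₁ ≤ ENNReal.ofReal (τ * Real.exp k / (x * γ * y)) := by
    have h := (withDensity_mul_le_setLIntegral Pr hf hf₀ hA Bᶜ (ENNReal.ofReal c)).trans hτ
    have e : τ * Real.exp k / (x * γ * y) = τ / c := by rw [hc, hb]; field_simp
    rw [e, ENNReal.ofReal_div_of_pos hcpos,
      ENNReal.le_div_iff_mul_le (Or.inl (by simpa using hcpos)) (Or.inl ENNReal.ofReal_ne_top),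
      mul_comm]
    exact h
  have hS₂ : P₀ S₂ ≤ ENNReal.ofReal y := by
    have hG0 : Pr G ≠ 0 := ((ENNReal.ofReal_pos.2 hγ).trans_le hGγ).ne'
    refine (withDensity_lintegral_div_gt Pr hf hf₀ hG0 hk (by simpa using hbpos)
      ENNReal.ofReal_ne_top).trans (le_of_eq ?_)
    rw [← ENNReal.ofReal_div_of_pos hbpos, hb]
    congr 1
    field_simp
  have hS₃ : P₀ S₃ = 0 := ae_evidence_lt_top Pr hf h1
  set S := {Y | ENNReal.ofReal (1 - x) ≤ (∫⁻ θ in B, f θ Y ∂Pr) / ∫⁻ θ, f θ Y ∂Pr}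
  -- The event is not assumed measurable: it is bounded below by covering the whole space.
  have hcover : (Set.univ : Set (𝒴)) ⊆ S ∪ (Aᶜ ∪ S₂ ∪ S₁ ∪ S₃) := by
    intro Y _
    by_contra hcon
    simp only [Set.mem_union, not_or, Set.mem_compl_iff, not_not] at hcon
    obtain ⟨hS, ⟨⟨hYA, hY2⟩, hY1⟩, hY3⟩ := hcon
    refine hS ?_
    have hY1' : ∫⁻ θ in Bᶜ, f θ Y ∂Pr ≤
        ENNReal.ofReal c * f₀ Y := by
      by_contra h
      exact hY1 ⟨hYA, (not_le.1 h).le⟩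
    have hY2' : ∫⁻ θ in G, f₀ Y / f θ Y ∂Pr ≤
        ENNReal.ofReal b * Pr G := not_lt.1 hY2
    have hY3' : ∫⁻ θ, f θ Y ∂Pr < ∞ := not_not.1 hY3
    have hev := evidence_ge_of_lintegral_div_le Pr hf (by simpa using hbpos)
      ENNReal.ofReal_ne_top (hpos Y).ne' (hfin Y) hY2'
    set D := ∫⁻ θ, f θ Y ∂Pr
    set NB := ∫⁻ θ in B, f θ Y ∂Pr
    set NC := ∫⁻ θ in Bᶜ, f θ Y ∂Pr
    have hD : D ≤ NB + NC := by
      have := lintegral_union_le (μ := Pr) (fun θ => f θ Y) B Bᶜ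
      rwa [Set.union_compl_self, Measure.restrict_univ] at this
    have hL0 := hpos Y
    have hDlow : f₀ Y * ENNReal.ofReal γ ≤ ENNReal.ofReal b * D := by
      calc _ ≤ f₀ Y * Pr G := by gcongr
        _ ≤ _ := hev
        _ ≤ _ := by gcongr; exact setLIntegral_le_lintegral _ _
    have hDpos : D ≠ 0 := by
      intro h0
      rw [h0, mul_zero, nonpos_iff_eq_zero, mul_eq_zero] at hDlow
      rcases hDlow with h | h
      · exact hL0.ne' h
      · exact (ENNReal.ofReal_pos.2 hγ).ne' h
    have hNC : NC ≤ ENNReal.ofReal x * D := by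
      have e : ENNReal.ofReal c = ENNReal.ofReal x * ENNReal.ofReal γ * (ENNReal.ofReal b)⁻¹ := by
        rw [hc, ENNReal.ofReal_div_of_pos hbpos, ENNReal.ofReal_mul hx.le, div_eq_mul_inv]
      calc NC ≤ _ := hY1'
        _ = ENNReal.ofReal x * (ENNReal.ofReal b)⁻¹ *
            (f₀ Y * ENNReal.ofReal γ) := by rw [e]; ring
        _ ≤ ENNReal.ofReal x * (ENNReal.ofReal b)⁻¹ * (ENNReal.ofReal b * D) := by gcongr
        _ = ENNReal.ofReal x * ((ENNReal.ofReal b)⁻¹ * ENNReal.ofReal b) * D := by ring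
        _ = _ := by
          rw [ENNReal.inv_mul_cancel (by simpa using hbpos) ENNReal.ofReal_ne_top, mul_one]
    change ENNReal.ofReal (1 - x) ≤ NB / D
    rw [ENNReal.le_div_iff_mul_le (Or.inl hDpos) (Or.inl hY3'.ne), ENNReal.ofReal_sub _ hx.le,
      ENNReal.ofReal_one, ENNReal.sub_mul (fun _ _ => hY3'.ne), one_mul]
    exact tsub_le_iff_right.2 (hD.trans (by gcongr))
  have hsum : 1 ≤ P₀ S + ENNReal.ofReal (a + y + τ * Real.exp k / (x * γ * y)) := by
    calc 1 = P₀ Set.univ := measure_univ.symm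
      _ ≤ P₀ S + (P₀ Aᶜ + P₀ S₂ + P₀ S₁ + P₀ S₃) := by
        refine (measure_mono hcover).trans ((measure_union_le _ _).trans ?_)
        gcongr
        refine (measure_union_le _ _).trans ?_
        gcongr
        refine (measure_union_le _ _).trans ?_
        gcongr
        exact measure_union_le _ _
      _ ≤ _ := by
        rw [hS₃, add_zero, ENNReal.ofReal_add (by positivity) (by positivity),
          ENNReal.ofReal_add ha0 hy.le]
        gcongr
  rw [ENNReal.ofReal_sub _ (by positivity), ENNReal.ofReal_one]
  exact tsub_le_iff_right.2 hsum

end Posterior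

/-- `posterior_concentration` in the regression model. -/
theorem posteriorProb_concentration {n p : ℕ} (X : Matrix (Fin n) (Fin p) ℝ)
    (Pr : Measure (Param p)) {σ₀ : ℝ} (β₀ : Fin p → ℝ) [IsFiniteMeasure Pr] (h₀ : 0 < σ₀)
    (hPr : ∀ᵐ θ ∂Pr, 0 < θ.1) {G : Set (Param p)}
    {γ k a τ x y : ℝ} (hγ : 0 < γ) (hx : 0 < x) (hy : 0 < y) (ha0 : 0 ≤ a) (hτ0 : 0 ≤ τ)
    (hGγ : ENNReal.ofReal γ ≤ Pr G)
    (hk : ∀ θ ∈ G, ∫⁻ Y, likelihood X Y σ₀ β₀ / likelihood X Y θ.1 θ.2.2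
      ∂responseLaw X σ₀ β₀ ≤ ENNReal.ofReal (Real.exp k))
    {A : Set (Fin n → ℝ)} (hA : MeasurableSet A)
    (ha : responseLaw X σ₀ β₀ Aᶜ ≤ ENNReal.ofReal a) {B : Set (Param p)}
    (hτ : ∫⁻ θ in Bᶜ, responseLaw X θ.1 θ.2.2 A ∂Pr ≤ ENNReal.ofReal τ) :
    ENNReal.ofReal (1 - (a + y + τ * Real.exp k / (x * γ * y))) ≤
      responseLaw X σ₀ β₀ {Y | ENNReal.ofReal (1 - x) ≤ posteriorProb X Pr Y B} := by
  have hprob : IsProbabilityMeasure (responseLaw X σ₀ β₀) := inferInstance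
  rw [responseLaw_eq_withDensity X h₀] at hk ha hprob ⊢
  have hint : ∀ᵐ θ ∂Pr, ∫⁻ Y, likelihood X Y θ.1 θ.2.2 = 1 := by
    filter_upwards [hPr] with θ hθ
    have h := measure_univ (μ := responseLaw X θ.1 θ.2.2)
    rwa [responseLaw_eq_withDensity X hθ, withDensity_apply _ MeasurableSet.univ,
      Measure.restrict_univ] at h
  have hτ' : ∫⁻ θ in Bᶜ, (∫⁻ Y in A, likelihood X Y θ.1 θ.2.2) ∂Pr ≤ ENNReal.ofReal τ := by
    refine le_trans (le_of_eq (lintegral_congr_ae (ae_restrict_of_ae ?_))) hτ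
    filter_upwards [hPr] with θ hθ
    rw [responseLaw_eq_withDensity X hθ, withDensity_apply _ hA]
  exact posterior_concentration (f := fun θ Y => likelihood X Y θ.1 θ.2.2) Pr
    (measurable_likelihood X) (measurable_likelihood_right X σ₀ β₀) hint
    (likelihood_pos X h₀ β₀) (likelihood_ne_top X σ₀ β₀) hγ hx hy ha0 hτ0 hGγ hk hA ha hτ'

/-! ### The minimum united eigenvalue -/

/-- The Rayleigh quotient bound. -/
lemma minEigenvalue_mul_le {ι : Type} [Fintype ι] [DecidableEq ι] {A : Matrix ι ι ℝ}
    (hA : A.IsHermitian) (v : ι → ℝ) :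
    minEigenvalue A * ∑ i, v i ^ 2 ≤ v ⬝ᵥ A.mulVec v := by
  set c := minEigenvalue A with hc
  have hB : (A - c • (1 : Matrix ι ι ℝ)).PosSemidef := by
    have hH : (A - c • (1 : Matrix ι ι ℝ)).IsHermitian := by
      refine hA.sub ?_
      simp [Matrix.IsHermitian]
    refine hH.posSemidef_iff_eigenvalues_nonneg.2 fun i => ?_
    have hmem : hH.eigenvalues i ∈ spectrum ℝ (A - c • (1 : Matrix ι ι ℝ)) :=
      hH.spectrum_real_eq_range_eigenvalues ▸ Set.mem_range_self i
    have hmem' : hH.eigenvalues i + c ∈ spectrum ℝ A := by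
      rw [spectrum.add_mem_iff, Algebra.algebraMap_eq_smul_one, neg_add_eq_sub]
      exact hmem
    have hbdd : BddBelow (spectrum ℝ A) := by
      rw [hA.spectrum_real_eq_range_eigenvalues]
      exact (Set.finite_range _).bddBelow
    have := csInf_le hbdd hmem'
    simp only [minEigenvalue] at hc
    simp only [Pi.zero_apply]
    linarith
  have h := hB.dotProduct_mulVec_nonneg v
  simp only [Matrix.sub_mulVec, Matrix.smul_mulVec, Matrix.one_mulVec, dotProduct_sub,
    dotProduct_smul, star_trivial, smul_eq_mul] at h
  have : v ⬝ᵥ v = ∑ i, v i ^ 2 := by simp [dotProduct, sq]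
  rw [this] at h
  linarith

section Design

variable {n p : ℕ} (X : Matrix (Fin n) (Fin p) ℝ)

lemma gram_isHermitian (ζ : Finset (Fin p)) : (gram X ζ).IsHermitian := by
  simp [Matrix.IsHermitian, gram, Matrix.conjTranspose_eq_transpose_of_trivial]

lemma dotProduct_gram_mulVec (ζ : Finset (Fin p)) {δ : Fin p → ℝ} (hδ : ∀ j ∉ ζ, δ j = 0) :
    (fun j : ζ => δ j) ⬝ᵥ (gram X ζ).mulVec (fun j : ζ => δ j) =
      (n : ℝ)⁻¹ * ∑ i, (X.mulVec δ i) ^ 2 := by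
  have h : (subdesign X ζ).mulVec (fun j : ζ => δ j) = X.mulVec δ := by
    ext i
    simp only [Matrix.mulVec, dotProduct, subdesign, Matrix.submatrix_apply, id]
    rw [Finset.sum_coe_sort ζ (fun j => X i j * δ j)]
    exact Finset.sum_subset (Finset.subset_univ _) fun j _ hj => by rw [hδ j hj, mul_zero]
  rw [gram, Matrix.smul_mulVec, dotProduct_smul, ← Matrix.mulVec_mulVec,
    Matrix.dotProduct_mulVec, Matrix.vecMul_transpose, h]
  simp [dotProduct, sq]

/-- The defining property of the minimum united eigenvalue: `n λ ‖δ‖² ≤ ‖X δ‖²` for vectors `δ`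
supported in `ξ ∪ ξ₀`. -/
lemma muev_mul_le {ξ ξ₀ : Finset (Fin p)} {t : ℝ} (hξ : FullRank X ξ)
    (ht : ((ξ ∪ ξ₀).card : ℝ) ≤ t) (hn : 0 < n) {δ : Fin p → ℝ} (hδ : ∀ j ∉ ξ ∪ ξ₀, δ j = 0) :
    n * muev X ξ₀ t * ∑ j, δ j ^ 2 ≤ ∑ i, (X.mulVec δ i) ^ 2 := by
  have h1 : muev X ξ₀ t ≤ minEigenvalue (gram X (ξ ∪ ξ₀)) :=
    ciInf_le (Set.finite_range _).bddBelow
      (⟨ξ, hξ, ht⟩ : {ξ : Finset (Fin p) // FullRank X ξ ∧ ((ξ ∪ ξ₀).card : ℝ) ≤ t})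
  have h2 := minEigenvalue_mul_le (gram_isHermitian X (ξ ∪ ξ₀)) fun j => δ j
  rw [dotProduct_gram_mulVec X _ hδ] at h2
  have h3 : ∑ j : (ξ ∪ ξ₀ : Finset (Fin p)), δ j ^ 2 = ∑ j, δ j ^ 2 := by
    rw [Finset.sum_coe_sort (ξ ∪ ξ₀) (fun j => δ j ^ 2)]
    exact Finset.sum_subset (Finset.subset_univ _) fun j _ hj => by rw [hδ j hj]; ring
  rw [h3] at h2
  have h4 : 0 ≤ ∑ j, δ j ^ 2 := Finset.sum_nonneg fun _ _ => sq_nonneg _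
  have hn' : (0 : ℝ) < n := by exact_mod_cast hn
  calc _ = n * (muev X ξ₀ t * ∑ j, δ j ^ 2) := by ring
    _ ≤ n * ((n : ℝ)⁻¹ * ∑ i, (X.mulVec δ i) ^ 2) := by
        refine mul_le_mul_of_nonneg_left (le_trans ?_ h2) hn'.le
        exact mul_le_mul_of_nonneg_right h1 h4
    _ = _ := by rw [← mul_assoc, mul_inv_cancel₀ hn'.ne', one_mul]

lemma fullRank_empty : FullRank X ∅ := by
  have h := (subdesign X ∅).rank_le_card_width
  simp only [FullRank, Finset.card_empty]
  simpa using h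

variable {X}

/-- Since the columns have norm `√n`, the minimum united eigenvalue is at most one. -/
lemma muev_le_one (hX : ∀ j, √(∑ i, X i j ^ 2) = √(n : ℝ)) (hn : 0 < n) {ξ₀ : Finset (Fin p)}
    (hξ₀ : ξ₀.Nonempty) {t : ℝ} (ht : (ξ₀.card : ℝ) ≤ t) : muev X ξ₀ t ≤ 1 := by
  obtain ⟨j, hj⟩ := hξ₀
  have h := muev_mul_le X (ξ := ∅) (ξ₀ := ξ₀) (t := t) (fullRank_empty X) (by simpa using ht) hn
    (δ := Pi.single j 1) fun k hk => by
      rw [Pi.single_eq_of_ne]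
      rintro rfl
      exact hk (by simpa using hj)
  have h1 : ∑ k, (Pi.single j (1 : ℝ) : Fin p → ℝ) k ^ 2 = 1 := by
    rw [Finset.sum_eq_single j] <;> simp +contextual
  have h2 : ∑ i, (X.mulVec (Pi.single j 1) i) ^ 2 = n := by
    simp only [Matrix.mulVec_single_one, Matrix.col_apply]
    exact (Real.sqrt_inj (Finset.sum_nonneg fun _ _ => sq_nonneg _) (by positivity)).1 (hX j)
  rw [h1, h2, mul_one] at h
  have hn' : (0 : ℝ) < n := by exact_mod_cast hn
  nlinarith

/-- `‖X β‖ ≤ √n ‖β‖₁`. -/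
lemma sqrt_sum_mulVec_sq_le (hX : ∀ j, √(∑ i, X i j ^ 2) = √(n : ℝ)) (β : Fin p → ℝ) :
    ‖WithLp.toLp 2 (X.mulVec β)‖ ≤ √(n : ℝ) * ∑ j, |β j| := by
  have h : WithLp.toLp 2 (X.mulVec β) = ∑ j, β j • WithLp.toLp 2 (X.col j) := by
    ext i
    simp [Matrix.mulVec, dotProduct, mul_comm]
  have hc : ∀ j, ‖WithLp.toLp 2 (X.col j)‖ = √(n : ℝ) := fun j => by
    rw [EuclideanSpace.norm_eq, ← hX j]
    simp
  rw [h, Finset.mul_sum]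
  refine (norm_sum_le _ _).trans (Finset.sum_le_sum fun j _ => ?_)
  rw [norm_smul, hc, mul_comm, Real.norm_eq_abs]

/-- The span of the columns of `X` indexed by `ζ`. -/
def columnSpan (X : Matrix (Fin n) (Fin p) ℝ) (ζ : Finset (Fin p)) :
    Submodule ℝ (EuclideanSpace ℝ (Fin n)) :=
  Submodule.span ℝ (ζ.image fun j => WithLp.toLp 2 (X.col j))

lemma finrank_columnSpan_le (ζ : Finset (Fin p)) :
    Module.finrank ℝ (columnSpan X ζ) ≤ ζ.card :=
  (finrank_span_finset_le_card _).trans Finset.card_image_le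

lemma toLp_mulVec_mem_columnSpan {ζ : Finset (Fin p)} {δ : Fin p → ℝ} (hδ : ∀ j ∉ ζ, δ j = 0) :
    WithLp.toLp 2 (X.mulVec δ) ∈ columnSpan X ζ := by
  have h : WithLp.toLp 2 (X.mulVec δ) = ∑ j, δ j • WithLp.toLp 2 (X.col j) := by
    ext i
    simp [Matrix.mulVec, dotProduct, mul_comm]
  rw [h]
  refine Submodule.sum_mem _ fun j _ => ?_
  by_cases hj : j ∈ ζ
  · exact Submodule.smul_mem _ _ (Submodule.subset_span (by
      simp only [Finset.coe_image]
      exact ⟨j, hj, rfl⟩))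
  · simp [hδ j hj]

end Design

/-! ### Prior probabilities -/

lemma isProbabilityMeasure_densityLaw {f : ℝ → ℝ} {S : Set ℝ} (hf : IsDensityOn f S) :
    IsProbabilityMeasure (densityLaw f S) :=
  ⟨by rw [densityLaw, withDensity_apply _ MeasurableSet.univ, Measure.restrict_univ,
    hf.lintegral_eq_one]⟩

lemma ofReal_mul_le_densityLaw_Icc {f : ℝ → ℝ} {S : Set ℝ} {l u q : ℝ} (hq : 0 ≤ q)
    (hS : Set.Icc l u ⊆ S) (hf : ∀ x ∈ Set.Icc l u, q ≤ f x) :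
    ENNReal.ofReal (q * (u - l)) ≤ densityLaw f S (Set.Icc l u) := by
  rw [densityLaw, withDensity_apply _ measurableSet_Icc,
    Measure.restrict_restrict measurableSet_Icc, Set.inter_eq_left.2 hS, ENNReal.ofReal_mul hq,
    ← Real.volume_Icc, ← setLIntegral_const]
  exact setLIntegral_mono' measurableSet_Icc fun x hx => ENNReal.ofReal_le_ofReal (hf x hx)

section ModelProb

variable {n p : ℕ} {X : Matrix (Fin n) (Fin p) ℝ} {w : Finset (Fin p) → ℝ}

lemma modelProb_nonneg (hw : ∀ ξ, 0 ≤ w ξ) (ξ : Finset (Fin p)) : 0 ≤ modelProb X w ξ := by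
  classical
  unfold modelProb
  refine div_nonneg ?_ (Finset.sum_nonneg fun γ _ => ?_) <;> split_ifs <;> simp [hw]

lemma modelProb_of_not_fullRank {ξ : Finset (Fin p)} (h : ¬ FullRank X ξ) :
    modelProb X w ξ = 0 := by
  simp [modelProb, h]

open Classical in
lemma le_sum_fullRank (hw : ∀ ξ, 0 ≤ w ξ) :
    w ∅ ≤ ∑ γ : Finset (Fin p), if FullRank X γ then w γ else 0 := by
  have h := Finset.single_le_sum (f := fun γ => if FullRank X γ then w γ else 0)
    (fun γ _ => by split_ifs <;> simp [hw]) (Finset.mem_univ ∅)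
  simpa [fullRank_empty X] using h

open Classical in
lemma modelProb_le (hw : ∀ ξ, 0 ≤ w ξ) (h0 : 0 < w ∅) (ξ : Finset (Fin p)) :
    modelProb X w ξ ≤ w ξ / w ∅ := by
  unfold modelProb
  refine div_le_div₀ (hw ξ) ?_ h0 (le_sum_fullRank hw)
  split_ifs <;> simp [hw]

open Classical in
lemma le_modelProb (hw : ∀ ξ, 0 ≤ w ξ) (h1 : ∑ ξ, w ξ = 1) (h0 : 0 < w ∅) {ξ : Finset (Fin p)}
    (hξ : FullRank X ξ) : w ξ ≤ modelProb X w ξ := by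
  have hle : (∑ γ : Finset (Fin p), if FullRank X γ then w γ else 0) ≤ 1 := by
    rw [← h1]
    refine Finset.sum_le_sum fun γ _ => ?_
    split_ifs <;> simp [hw]
  unfold modelProb
  rw [if_pos hξ]
  exact le_div_self (hw ξ) (h0.trans_le (le_sum_fullRank hw)) hle

lemma sum_modelProb_le_one (hw : ∀ ξ, 0 ≤ w ξ) :
    ∑ ξ, ENNReal.ofReal (modelProb X w ξ) ≤ 1 := by
  classical
  rw [← ENNReal.ofReal_sum_of_nonneg fun ξ _ => modelProb_nonneg hw ξ, ← ENNReal.ofReal_one]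
  refine ENNReal.ofReal_le_ofReal ?_
  unfold modelProb
  rw [← Finset.sum_div]
  exact div_self_le_one _

end ModelProb

section Prior

variable {n p : ℕ} {X : Matrix (Fin n) (Fin p) ℝ} {w : Finset (Fin p) → ℝ} {g : ℝ → ℝ}
  {h₀ : Measure ℝ} {h₁ : ℝ → ℝ}

/-- The law of the standardized coefficients `z_j = β_j / σ` in the model `ξ`. -/
noncomputable def standardizedLaw {p : ℕ} (h₀ : Measure ℝ) (h₁ : ℝ → ℝ) (ξ : Finset (Fin p)) :
    Measure (Fin p → ℝ) :=
  Measure.pi fun j => if j ∈ ξ then densityLaw h₁ Set.univ else h₀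

lemma prior_apply {S : Set (Param p)} (hS : MeasurableSet S) :
    prior X g w h₀ h₁ S = ∑ ξ, ENNReal.ofReal (modelProb X w ξ) *
      ((densityLaw g (Set.Ioi 0)).prod (standardizedLaw h₀ h₁ ξ))
        {q | ((√q.1, ξ, √q.1 • q.2) : Param p) ∈ S} := by
  rw [prior, Measure.finsetSum_apply]
  refine Finset.sum_congr rfl fun ξ _ => ?_
  rw [Measure.smul_apply, smul_eq_mul, Measure.map_apply (by fun_prop) hS]
  rfl

lemma isProbabilityMeasure_slab_or_spike [IsProbabilityMeasure h₀] (hh : IsDensityOn h₁ Set.univ)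
    (ξ : Finset (Fin p)) (j : Fin p) :
    IsProbabilityMeasure (if j ∈ ξ then densityLaw h₁ Set.univ else h₀) := by
  have := isProbabilityMeasure_densityLaw hh
  split_ifs <;> infer_instance

lemma isProbabilityMeasure_standardizedLaw [IsProbabilityMeasure h₀]
    (hh : IsDensityOn h₁ Set.univ) (ξ : Finset (Fin p)) :
    IsProbabilityMeasure (standardizedLaw h₀ h₁ ξ) := by
  have := isProbabilityMeasure_slab_or_spike (h₀ := h₀) hh ξ
  unfold standardizedLaw
  infer_instance

lemma prior_univ_le_one [IsProbabilityMeasure h₀]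
    (hg : IsDensityOn g (Set.Ioi 0)) (hh : IsDensityOn h₁ Set.univ) (hw : ∀ ξ, 0 ≤ w ξ) :
    prior X g w h₀ h₁ Set.univ ≤ 1 := by
  have := isProbabilityMeasure_densityLaw hg
  have := fun ξ : Finset (Fin p) => isProbabilityMeasure_standardizedLaw (h₀ := h₀) hh ξ
  rw [prior_apply MeasurableSet.univ]
  simpa using sum_modelProb_le_one hw

/-- Almost surely under the prior, the standard deviation is positive and the model has full
rank. -/
lemma ae_prior_pos_and_fullRank :
    ∀ᵐ θ ∂prior X g w h₀ h₁, 0 < θ.1 ∧ FullRank X θ.2.1 := by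
  have hm1 : MeasurableSet {θ : Param p | 0 < θ.1} := measurableSet_lt (by fun_prop) (by fun_prop)
  have hm2 : MeasurableSet {θ : Param p | FullRank X θ.2.1} := by
    have h : MeasurableSet {ξ | FullRank X ξ} := (Set.toFinite _).measurableSet
    exact (show Measurable fun θ : Param p => θ.2.1 by fun_prop) h
  have hm : MeasurableSet {θ : Param p | ¬ (0 < θ.1 ∧ FullRank X θ.2.1)} := (hm1.inter hm2).compl
  rw [ae_iff, prior_apply hm]
  refine Finset.sum_eq_zero fun ξ _ => ?_
  by_cases hξ : FullRank X ξ
  · refine mul_eq_zero_of_right _ ?_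
    have hsub : {q : ℝ × (Fin p → ℝ) | ((√q.1, ξ, √q.1 • q.2) : Param p) ∈
        {θ : Param p | ¬ (0 < θ.1 ∧ FullRank X θ.2.1)}} ⊆ (Set.Ioi 0)ᶜ ×ˢ Set.univ := by
      rintro ⟨v, z⟩ hq
      simp only [Set.mem_ofPred_eq, hξ, and_true, Real.sqrt_pos] at hq
      simpa using hq
    refine measure_mono_null hsub ?_
    have h0 : densityLaw g (Set.Ioi 0) (Set.Ioi 0)ᶜ = 0 := by
      rw [densityLaw, withDensity_apply _ measurableSet_Ioi.compl,
        Measure.restrict_restrict measurableSet_Ioi.compl, Set.compl_inter_self]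
      simp
    refine le_antisymm ((Measure.prod_prod_le _ _).trans ?_) zero_le
    rw [h0, zero_mul]
  · simp [modelProb_of_not_fullRank hξ]

lemma measurableSet_large_models (ξ₀ : Finset (Fin p)) (t : ℝ) :
    MeasurableSet {θ : Param p | t < ((θ.2.1 \ ξ₀).card : ℝ)} := by
  have h : MeasurableSet {ξ : Finset (Fin p) | t < ((ξ \ ξ₀).card : ℝ)} :=
    (Set.toFinite _).measurableSet
  exact (show Measurable fun θ : Param p => θ.2.1 by fun_prop) h

/-- The normalizing constant of the model prior is at least `w ∅`, as the empty model has full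
rank. -/
lemma prior_large_models_le [IsProbabilityMeasure h₀] (hg : IsDensityOn g (Set.Ioi 0))
    (hh : IsDensityOn h₁ Set.univ) (hw : ∀ ξ, 0 ≤ w ξ) (h0 : 0 < w ∅) (ξ₀ : Finset (Fin p))
    (t : ℝ) :
    prior X g w h₀ h₁ {θ | t < ((θ.2.1 \ ξ₀).card : ℝ)} ≤
      ENNReal.ofReal ((∑ ξ with t < (Finset.card ξ : ℝ), w ξ) / w ∅) := by
  have := isProbabilityMeasure_densityLaw hg
  have := fun ξ : Finset (Fin p) => isProbabilityMeasure_standardizedLaw (h₀ := h₀) hh ξ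
  rw [prior_apply (measurableSet_large_models ξ₀ t), Finset.sum_div, Finset.sum_filter,
    ENNReal.ofReal_sum_of_nonneg fun ξ _ => by
      split_ifs
      · exact div_nonneg (hw ξ) h0.le
      · exact le_rfl]
  refine Finset.sum_le_sum fun ξ _ => ?_
  simp only [Set.mem_ofPred_eq]
  split_ifs with hξ
  · refine (mul_le_of_le_one_right' prob_le_one).trans ?_
    exact ENNReal.ofReal_le_ofReal (modelProb_le hw h0 ξ)
  · have : ¬ t < ((ξ \ ξ₀).card : ℝ) := fun h => hξ (h.trans_le (by
      exact_mod_cast Finset.card_le_card Finset.sdiff_subset))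
    simp [this]

lemma measurableSet_large_inactive (z₀ : ℝ) :
    MeasurableSet {θ : Param p | ∃ j, j ∉ θ.2.1 ∧ θ.1 * z₀ < |θ.2.2 j|} := by
  have : {θ : Param p | ∃ j, j ∉ θ.2.1 ∧ θ.1 * z₀ < |θ.2.2 j|} =
      ⋃ j, {θ : Param p | j ∉ θ.2.1} ∩ {θ : Param p | θ.1 * z₀ < |θ.2.2 j|} := by
    ext θ; simp
  rw [this]
  refine MeasurableSet.iUnion fun j => MeasurableSet.inter ?_ ?_
  · have h : MeasurableSet {ξ : Finset (Fin p) | j ∉ ξ} := (Set.toFinite _).measurableSet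
    exact (show Measurable fun θ : Param p => θ.2.1 by fun_prop) h
  · exact measurableSet_lt (by fun_prop) (by fun_prop)

lemma prior_large_inactive_le [IsProbabilityMeasure h₀] (hg : IsDensityOn g (Set.Ioi 0))
    (hh : IsDensityOn h₁ Set.univ) (hw : ∀ ξ, 0 ≤ w ξ) (z₀ : ℝ) :
    prior X g w h₀ h₁ {θ | ∃ j, j ∉ θ.2.1 ∧ θ.1 * z₀ < |θ.2.2 j|} ≤ p * h₀ {z | z₀ < |z|} := by
  have := isProbabilityMeasure_densityLaw hg
  have := fun ξ : Finset (Fin p) => isProbabilityMeasure_standardizedLaw (h₀ := h₀) hh ξ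
  rw [prior_apply (measurableSet_large_inactive z₀)]
  have hz : MeasurableSet {z : ℝ | z₀ < |z|} := measurableSet_lt (by fun_prop) (by fun_prop)
  have key : ∀ ξ : Finset (Fin p),
      ((densityLaw g (Set.Ioi 0)).prod (standardizedLaw h₀ h₁ ξ)) {q | ((√q.1, ξ, √q.1 • q.2) :
        Param p) ∈ {θ : Param p | ∃ j, j ∉ θ.2.1 ∧ θ.1 * z₀ < |θ.2.2 j|}} ≤
      p * h₀ {z | z₀ < |z|} := by
    intro ξ
    have hsub : {q : ℝ × (Fin p → ℝ) | ((√q.1, ξ, √q.1 • q.2) :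
        Param p) ∈ {θ : Param p | ∃ j, j ∉ θ.2.1 ∧ θ.1 * z₀ < |θ.2.2 j|}} ⊆
        ⋃ j ∈ ξᶜ, Set.univ ×ˢ ((fun z : Fin p → ℝ => z j) ⁻¹' {z : ℝ | z₀ < |z|}) := by
      rintro ⟨v, z⟩ ⟨j, hj, hlt⟩
      simp only [Set.mem_iUnion]
      refine ⟨j, by simpa using hj, Set.mem_univ _, ?_⟩
      simp only [Pi.smul_apply, smul_eq_mul, abs_mul, abs_of_nonneg (Real.sqrt_nonneg _)] at hlt
      exact lt_of_mul_lt_mul_left hlt (Real.sqrt_nonneg _)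
    refine (measure_mono hsub).trans ((measure_biUnion_finset_le _ _).trans ?_)
    calc _ ≤ ∑ j ∈ ξᶜ, h₀ {z | z₀ < |z|} := by
          refine Finset.sum_le_sum fun j hj => ?_
          have := isProbabilityMeasure_slab_or_spike (h₀ := h₀) hh ξ
          rw [Measure.prod_prod, measure_univ, one_mul, standardizedLaw,
            (measurePreserving_eval _ j).measure_preimage hz.nullMeasurableSet,
            if_neg (by simpa using hj)]
      _ = (ξᶜ.card : ℝ≥0∞) * h₀ {z | z₀ < |z|} := by rw [Finset.sum_const, nsmul_eq_mul]
      _ ≤ _ := by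
          gcongr
          simpa using Finset.card_le_univ ξᶜ
  calc _ ≤ ∑ ξ, ENNReal.ofReal (modelProb X w ξ) * (p * h₀ {z | z₀ < |z|}) :=
        Finset.sum_le_sum fun ξ _ => by gcongr; exact key ξ
    _ ≤ _ := by
        rw [← Finset.sum_mul]
        exact mul_le_of_le_one_left' (sum_modelProb_le_one hw)

/-- The parameters close to the true ones `(σ₀, ξ₀, β₀)`: the model is `ξ₀`, the variance exceeds
`σ₀²` by a factor of at most `1 + a`, active coefficients are within `r` of `β₀`, and inactive
ones are at most `σ z₀`. -/
def nearTruth {p : ℕ} (σ₀ : ℝ) (ξ₀ : Finset (Fin p)) (β₀ : Fin p → ℝ) (a r z₀ : ℝ) :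
    Set (Param p) :=
  {θ | θ.2.1 = ξ₀ ∧ σ₀ ≤ θ.1 ∧ θ.1 ^ 2 ≤ σ₀ ^ 2 * (1 + a) ∧ (∀ j ∈ ξ₀, |θ.2.2 j - β₀ j| ≤ r) ∧
    ∀ j, j ∉ ξ₀ → |θ.2.2 j| ≤ θ.1 * z₀}

lemma measurableSet_nearTruth (σ₀ : ℝ) (ξ₀ : Finset (Fin p)) (β₀ : Fin p → ℝ) (a r z₀ : ℝ) :
    MeasurableSet (nearTruth σ₀ ξ₀ β₀ a r z₀) := by
  have h : MeasurableSet {θ : Param p | θ.2.1 = ξ₀} :=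
    (show Measurable fun θ : Param p => θ.2.1 by fun_prop) (measurableSet_singleton ξ₀)
  have hl : MeasurableSet {θ : Param p | σ₀ ≤ θ.1} := measurableSet_le (by fun_prop) (by fun_prop)
  have hu : MeasurableSet {θ : Param p | θ.1 ^ 2 ≤ σ₀ ^ 2 * (1 + a)} :=
    measurableSet_le (by fun_prop) (by fun_prop)
  refine h.inter (hl.inter (hu.inter (MeasurableSet.inter ?_ ?_)))
  · have : {θ : Param p | ∀ j ∈ ξ₀, |θ.2.2 j - β₀ j| ≤ r} =
        ⋂ j ∈ ξ₀, {θ : Param p | |θ.2.2 j - β₀ j| ≤ r} := by ext θ; simp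
    have h2 : MeasurableSet (⋂ j ∈ ξ₀, {θ : Param p | |θ.2.2 j - β₀ j| ≤ r}) :=
      Finset.measurableSet_biInter _ fun j _ => measurableSet_le (by fun_prop) (by fun_prop)
    rw [← this] at h2
    exact h2
  · have : {θ : Param p | ∀ j, j ∉ ξ₀ → |θ.2.2 j| ≤ θ.1 * z₀} =
        ⋂ j ∈ ξ₀ᶜ, {θ : Param p | |θ.2.2 j| ≤ θ.1 * z₀} := by ext θ; simp
    have h2 : MeasurableSet (⋂ j ∈ ξ₀ᶜ, {θ : Param p | |θ.2.2 j| ≤ θ.1 * z₀}) :=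
      Finset.measurableSet_biInter _ fun j _ => measurableSet_le (by fun_prop) (by fun_prop)
    rw [← this] at h2
    exact h2

/-- The prior mass near the truth. The slab density is at least `q` on the range of the
standardized coefficients; each active coefficient then contributes the factor `q r / σ₀`, as the
interval for `β_j / σ` has length `2 r / σ ≥ r / σ₀`. -/
lemma le_prior_nearTruth [IsProbabilityMeasure h₀] (hg : IsDensityOn g (Set.Ioi 0))
    (hh : IsDensityOn h₁ Set.univ) (hw : ∀ ξ, 0 ≤ w ξ) (h1 : ∑ ξ, w ξ = 1) (h0 : 0 < w ∅)
    {σ₀ a r z₀ q : ℝ} {ξ₀ : Finset (Fin p)} {β₀ : Fin p → ℝ} (hξ₀ : FullRank X ξ₀) (hσ₀ : 0 < σ₀)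
    (ha1 : a ≤ 3) (hr : 0 ≤ r) (hq : 0 ≤ q)
    (hslab : ∀ z, ∀ j ∈ ξ₀, |z| ≤ |β₀ j / σ₀| + r / σ₀ → q ≤ h₁ z) :
    ENNReal.ofReal (w ξ₀) * (densityLaw g (Set.Ioi 0) (Set.Icc (σ₀ ^ 2) (σ₀ ^ 2 * (1 + a))) *
      (ENNReal.ofReal (q * (r / σ₀)) ^ ξ₀.card * h₀ {z | |z| ≤ z₀} ^ p)) ≤
      prior X g w h₀ h₁ (nearTruth σ₀ ξ₀ β₀ a r z₀) := by
  have := isProbabilityMeasure_densityLaw hg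
  have := fun ξ : Finset (Fin p) => isProbabilityMeasure_standardizedLaw (h₀ := h₀) hh ξ
  have hm := measurableSet_nearTruth σ₀ ξ₀ β₀ a r z₀
  rw [prior_apply hm]
  refine le_trans ?_ (Finset.single_le_sum (fun _ _ => zero_le) (Finset.mem_univ ξ₀))
  gcongr ?_ * ?_
  · exact ENNReal.ofReal_le_ofReal (le_modelProb hw h1 h0 hξ₀)
  have hm' : MeasurableSet {q : ℝ × (Fin p → ℝ) | ((√q.1, ξ₀, √q.1 • q.2) : Param p) ∈
      nearTruth σ₀ ξ₀ β₀ a r z₀} :=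
    (show Measurable fun q : ℝ × (Fin p → ℝ) => ((√q.1, ξ₀, √q.1 • q.2) : Param p) by fun_prop) hm
  rw [Measure.prod_apply hm', mul_comm, ← setLIntegral_const]
  refine (setLIntegral_mono' measurableSet_Icc fun v hv => ?_).trans (setLIntegral_le_lintegral _ _)
  have hv0 : 0 < v := (by positivity : 0 < σ₀ ^ 2).trans_le hv.1
  set s := √v with hs
  have hss : s ^ 2 = v := Real.sq_sqrt hv0.le
  have hs0 : σ₀ ≤ s := Real.le_sqrt_of_sq_le hv.1
  have hspos : 0 < s := hσ₀.trans_le hs0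
  have hs2 : s ≤ 2 * σ₀ := by
    have : s ^ 2 ≤ (2 * σ₀) ^ 2 := by
      rw [hss]
      refine hv.2.trans ?_
      nlinarith [sq_nonneg σ₀]
    exact (sq_le_sq₀ hspos.le (by positivity)).1 this
  set I : Fin p → Set ℝ := fun j =>
    if j ∈ ξ₀ then Set.Icc ((β₀ j - r) / s) ((β₀ j + r) / s) else {z | |z| ≤ z₀} with hI
  have hsub : Set.univ.pi I ⊆ Prod.mk v ⁻¹' {q : ℝ × (Fin p → ℝ) |
      ((√q.1, ξ₀, √q.1 • q.2) : Param p) ∈ nearTruth σ₀ ξ₀ β₀ a r z₀} := by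
    intro z hz
    refine ⟨rfl, hs0, by rw [← hs, hss]; exact hv.2, fun j hj => ?_, fun j hj => ?_⟩
    · have := hz j (Set.mem_univ _)
      simp only [hI, if_pos hj, Set.mem_Icc, div_le_iff₀ hspos, le_div_iff₀ hspos] at this
      simp only [Pi.smul_apply, smul_eq_mul, ← hs]
      rw [abs_le]
      constructor <;> nlinarith
    · have := hz j (Set.mem_univ _)
      simp only [hI, if_neg hj, Set.mem_ofPred_eq] at this
      simp only [Pi.smul_apply, smul_eq_mul, ← hs, abs_mul, abs_of_pos hspos]
      gcongr
  refine le_trans ?_ (measure_mono hsub)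
  have := isProbabilityMeasure_slab_or_spike (h₀ := h₀) hh ξ₀
  rw [standardizedLaw, Measure.pi_pi,
    ← Finset.prod_mul_prod_compl ξ₀ (fun j =>
      (if j ∈ ξ₀ then densityLaw h₁ Set.univ else h₀) (I j))]
  refine mul_le_mul' ?_ ?_
  · refine Finset.pow_card_le_prod _ _ _ fun j hj => ?_
    simp only [hI, if_pos hj]
    have hr' : r / s ≤ r / σ₀ := by gcongr
    refine le_trans (ENNReal.ofReal_le_ofReal ?_) (ofReal_mul_le_densityLaw_Icc (q := q) hq
      (Set.subset_univ _) fun z hz => hslab z j hj ?_)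
    · refine mul_le_mul_of_nonneg_left ?_ hq
      rw [← sub_div, div_le_div_iff₀ hσ₀ hspos]
      nlinarith
    · have h2 : |z - β₀ j / s| ≤ r / s := by
        rw [abs_le]
        have h3 := hz.1
        have h4 := hz.2
        rw [sub_div] at h3
        rw [add_div] at h4
        constructor <;> linarith
      have h3 : |β₀ j / s| ≤ |β₀ j / σ₀| := by
        rw [abs_div, abs_div, abs_of_pos hspos, abs_of_pos hσ₀]
        gcongr
      have h4 : |z| ≤ |z - β₀ j / s| + |β₀ j / s| := by
        simpa using abs_add_le (z - β₀ j / s) (β₀ j / s)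
      linarith
  · calc h₀ {z | |z| ≤ z₀} ^ p ≤ h₀ {z | |z| ≤ z₀} ^ ξ₀ᶜ.card :=
          pow_le_pow_of_le_one zero_le prob_le_one (by simpa using Finset.card_le_univ ξ₀ᶜ)
      _ ≤ _ := by
          refine Finset.pow_card_le_prod _ _ _ fun j hj => ?_
          have hj' : j ∉ ξ₀ := by simpa using hj
          simp only [hI, if_neg hj', le_refl]

end Prior

/-! ### The test -/

section Test

variable {n p : ℕ}

/-- The residual `Y - X β₀` as a vector of Euclidean space. -/
def residual (X : Matrix (Fin n) (Fin p) ℝ) (β₀ : Fin p → ℝ) (Y : Fin n → ℝ) :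
    EuclideanSpace ℝ (Fin n) :=
  WithLp.toLp 2 fun i => Y i - X.mulVec β₀ i

lemma measurable_residual (X : Matrix (Fin n) (Fin p) ℝ) (β₀ : Fin p → ℝ) :
    Measurable (residual X β₀) := by
  unfold residual
  fun_prop

/-- The acceptance region of the test: the squared norm of the residual lies between `lo` and `hi`,
and its projections to the spans of the columns in `ξ₀` and at most `k` other ones are bounded
by `u`. -/
def acceptance (X : Matrix (Fin n) (Fin p) ℝ) (β₀ : Fin p → ℝ) (ξ₀ : Finset (Fin p))
    (k lo hi u : ℝ) : Set (Fin n → ℝ) :=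
  {Y | lo ≤ ‖residual X β₀ Y‖ ^ 2 ∧ ‖residual X β₀ Y‖ ^ 2 ≤ hi ∧
    ∀ η : Finset (Fin p), (η.card : ℝ) ≤ k →
      ‖(columnSpan X (η ∪ ξ₀)).starProjection (residual X β₀ Y)‖ ≤ u}

lemma measurableSet_acceptance (X : Matrix (Fin n) (Fin p) ℝ) (β₀ : Fin p → ℝ)
    (ξ₀ : Finset (Fin p)) (k lo hi u : ℝ) : MeasurableSet (acceptance X β₀ ξ₀ k lo hi u) := by
  have hr := measurable_residual X β₀
  have h1 : MeasurableSet {Y | lo ≤ ‖residual X β₀ Y‖ ^ 2} :=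
    measurableSet_le (by fun_prop) (by fun_prop)
  have h2 : MeasurableSet {Y | ‖residual X β₀ Y‖ ^ 2 ≤ hi} :=
    measurableSet_le (by fun_prop) (by fun_prop)
  have h3 : MeasurableSet (⋂ η : Finset (Fin p), ⋂ _ : (η.card : ℝ) ≤ k,
      {Y | ‖(columnSpan X (η ∪ ξ₀)).starProjection (residual X β₀ Y)‖ ≤ u}) :=
    MeasurableSet.iInter fun η => MeasurableSet.iInter fun _ =>
      measurableSet_le (by fun_prop) (by fun_prop)
  convert h1.inter (h2.inter h3) using 1
  ext Y
  simp [acceptance]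

lemma residual_add_noise (X : Matrix (Fin n) (Fin p) ℝ) (β₀ β : Fin p → ℝ) (σ : ℝ)
    (e : EuclideanSpace ℝ (Fin n)) :
    residual X β₀ (fun i => X.mulVec β i + σ * e i) =
      σ • e + WithLp.toLp 2 (X.mulVec (β - β₀)) := by
  ext i
  simp [residual, Matrix.mulVec_sub]
  ring

lemma responseLaw_apply_eq (X : Matrix (Fin n) (Fin p) ℝ) (σ : ℝ) (β : Fin p → ℝ)
    {A : Set (Fin n → ℝ)} (hA : MeasurableSet A) :
    responseLaw X σ β A = stdGaussian (EuclideanSpace ℝ (Fin n))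
      {e | (fun i => X.mulVec β i + σ * e i) ∈ A} := by
  rw [responseLaw_eq_map, Measure.map_apply (by fun_prop) hA]
  rfl

lemma one_le_inv_sqrt {t : ℝ} (ht : t < 1 / 2) (ht0 : 0 ≤ t) : 1 ≤ (√(1 - 2 * t))⁻¹ := by
  rw [one_le_inv₀ (Real.sqrt_pos.2 (by linarith)), Real.sqrt_le_one]
  linarith

/-- The projection of the noise to the span of at most `d` columns. -/
lemma stdGaussian_columnSpan_tail (X : Matrix (Fin n) (Fin p) ℝ) (ζ : Finset (Fin p)) {d : ℝ}
    (hd : (ζ.card : ℝ) ≤ d) {t : ℝ} (ht : t < 1 / 2) (ht0 : 0 ≤ t) {x : ℝ} (hx : 0 ≤ x) :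
    stdGaussian (EuclideanSpace ℝ (Fin n)) {e | x < ‖(columnSpan X ζ).starProjection e‖} ≤
      ENNReal.ofReal ((√(1 - 2 * t))⁻¹ ^ d * Real.exp (-(t * x ^ 2))) := by
  refine (stdGaussian_projection_tail _ ht ht0 hx).trans (ENNReal.ofReal_le_ofReal ?_)
  gcongr
  rw [← Real.rpow_natCast]
  refine Real.rpow_le_rpow_of_exponent_le (one_le_inv_sqrt ht ht0) (le_trans ?_ hd)
  exact_mod_cast finrank_columnSpan_le (X := X) ζ

/-- There are at most `e p ^ k` models of size at most `k`: weigh each model `η` by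
`p ^ (k - |η|)`, and use `(1 + 1 / p) ^ p ≤ e`. -/
lemma card_filter_card_le (hp : 0 < p) (k : ℝ) :
    ((Finset.univ.filter fun η : Finset (Fin p) => (η.card : ℝ) ≤ k).card : ℝ) ≤
      Real.exp 1 * (p : ℝ) ^ k := by
  have hp' : (1 : ℝ) ≤ p := by exact_mod_cast hp
  have hp0 : (0 : ℝ) < p := by linarith
  have h1 : ∀ η : Finset (Fin p), (if (η.card : ℝ) ≤ k then (1 : ℝ) else 0) ≤
      (p : ℝ) ^ k * ((p : ℝ)⁻¹ ^ η.card * 1 ^ (p - η.card)) := by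
    intro η
    rw [one_pow, mul_one, inv_pow, ← Real.rpow_natCast, ← Real.rpow_neg hp0.le,
      ← Real.rpow_add hp0]
    split_ifs with h
    · exact Real.one_le_rpow hp' (by linarith)
    · positivity
  have h2 : ∑ η : Finset (Fin p), (p : ℝ)⁻¹ ^ η.card * 1 ^ (p - η.card) ≤ Real.exp 1 := by
    have h := Finset.sum_pow_mul_eq_add_pow ((p : ℝ)⁻¹) 1 (Finset.univ : Finset (Fin p))
    rw [Finset.powerset_univ, Finset.card_univ, Fintype.card_fin] at h
    rw [h]
    calc ((p : ℝ)⁻¹ + 1) ^ p ≤ Real.exp ((p : ℝ)⁻¹) ^ p := by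
          gcongr
          exact Real.add_one_le_exp _
      _ = Real.exp 1 := by rw [← Real.exp_nat_mul, mul_inv_cancel₀ hp0.ne']
  rw [Finset.card_filter]
  push_cast
  refine (Finset.sum_le_sum fun η _ => h1 η).trans ?_
  rw [← Finset.mul_sum, mul_comm]
  gcongr

/-- The test accepts the truth with high probability; the last term is the union bound over the
models. -/
lemma responseLaw_acceptance_compl_le (X : Matrix (Fin n) (Fin p) ℝ) (β₀ : Fin p → ℝ)
    (ξ₀ : Finset (Fin p)) (hp : 0 < p) {σ₀ k x T t ε : ℝ} (hσ₀ : 0 < σ₀) (hx0 : 0 ≤ x)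
    (hx : x ≤ 1 / 2) (hT : 0 ≤ T) (hε : 0 ≤ ε) (ht : t < 1 / 2) (ht0 : 0 ≤ t) :
    responseLaw X σ₀ β₀ (acceptance X β₀ ξ₀ k (n * σ₀ ^ 2 * (1 - x / 2)) (n * σ₀ ^ 2 * (1 + x))
        (T * σ₀ * (√(n : ℝ) * ε)))ᶜ ≤
      ENNReal.ofReal (Real.exp (-(n * x ^ 2 / 16)) + Real.exp (-(n * x ^ 2 / 8)) +
        Real.exp 1 * (p : ℝ) ^ k * ((√(1 - 2 * t))⁻¹ ^ (k + ξ₀.card) *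
          Real.exp (-(t * T ^ 2 * (n * ε ^ 2))))) := by
  have hA := measurableSet_acceptance X β₀ ξ₀ k (n * σ₀ ^ 2 * (1 - x / 2)) (n * σ₀ ^ 2 * (1 + x))
        (T * σ₀ * (√(n : ℝ) * ε))
  rw [responseLaw_apply_eq _ _ _ hA.compl]
  set E := EuclideanSpace ℝ (Fin n)
  have hfin : Module.finrank ℝ E = n := by simp [E]
  set F := Finset.univ.filter fun η : Finset (Fin p) => (η.card : ℝ) ≤ k with hF
  have hsub : {e : E | (fun i => X.mulVec β₀ i + σ₀ * e i) ∈ (acceptance X β₀ ξ₀ k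
      (n * σ₀ ^ 2 * (1 - x / 2)) (n * σ₀ ^ 2 * (1 + x)) (T * σ₀ * (√(n : ℝ) * ε)))ᶜ} ⊆
      ({e | ‖e + 0‖ ^ 2 ≤ Module.finrank ℝ E * (1 - x / 2)} ∪
        {e | Module.finrank ℝ E * (1 + x) ≤ ‖e + 0‖ ^ 2}) ∪
      ⋃ η ∈ F, {e | T * (√(n : ℝ) * ε) < ‖(columnSpan X (η ∪ ξ₀)).starProjection e‖} := by
    intro e he
    by_contra hcon
    refine he ?_
    simp only [Set.mem_union, Set.mem_iUnion, Set.mem_ofPred_eq, not_or, not_le, add_zero, hfin,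
      not_exists, not_lt] at hcon
    obtain ⟨⟨h1, h2⟩, h3⟩ := hcon
    simp only [acceptance, Set.mem_ofPred_eq, residual_add_noise, sub_self, Matrix.mulVec_zero,
      WithLp.toLp_zero, add_zero, map_smul, norm_smul, Real.norm_eq_abs, abs_of_pos hσ₀, mul_pow]
    have hs2 : 0 < σ₀ ^ 2 := by positivity
    refine ⟨by nlinarith, by nlinarith, fun η hη => ?_⟩
    have := h3 η (by simpa [hF] using hη)
    calc σ₀ * _ ≤ σ₀ * (T * (√(n : ℝ) * ε)) := by gcongr
      _ = _ := by ring
  refine (measure_mono hsub).trans ((measure_union_le _ _).trans ?_)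
  rw [ENNReal.ofReal_add (by positivity) (by positivity),
    ENNReal.ofReal_add (by positivity) (by positivity)]
  refine add_le_add ((measure_union_le _ _).trans (add_le_add ?_ ?_)) ?_
  · refine (stdGaussian_norm_sq_le (by linarith) 0).trans (ENNReal.ofReal_le_ofReal ?_)
    rw [hfin]
    refine Real.exp_le_exp.2 (le_of_eq ?_)
    ring
  · refine (stdGaussian_le_norm_sq hx0 hx 0).trans (ENNReal.ofReal_le_ofReal ?_)
    rw [hfin]
    simp
  · refine (measure_biUnion_finset_le _ _).trans ?_
    calc _ ≤ ∑ η ∈ F, ENNReal.ofReal ((√(1 - 2 * t))⁻¹ ^ (k + ξ₀.card) *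
          Real.exp (-(t * T ^ 2 * (n * ε ^ 2)))) := by
          refine Finset.sum_le_sum fun η hη => ?_
          have hη' : (η.card : ℝ) ≤ k := by simpa [hF] using hη
          have hc : ((η ∪ ξ₀).card : ℝ) ≤ k + ξ₀.card := by
            have : ((η ∪ ξ₀).card : ℝ) ≤ η.card + ξ₀.card := by
              exact_mod_cast Finset.card_union_le η ξ₀
            linarith
          refine (stdGaussian_columnSpan_tail X _ hc ht ht0 (by positivity)).trans (le_of_eq ?_)
          congr 4
          rw [mul_pow, mul_pow, Real.sq_sqrt (by positivity)]
          ring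
      _ ≤ _ := by
          rw [Finset.sum_const, nsmul_eq_mul, ← ENNReal.ofReal_natCast,
            ← ENNReal.ofReal_mul (by positivity)]
          refine ENNReal.ofReal_le_ofReal ?_
          gcongr
          exact card_filter_card_le hp k

end Test

section Power

variable {n p : ℕ}

/-- The component of `y` orthogonal to `V` is no longer than `y - v`, for `v ∈ V`. -/
lemma norm_sq_sub_norm_sq_starProjection_le {E : Type*} [NormedAddCommGroup E]
    [InnerProductSpace ℝ E] [FiniteDimensional ℝ E] (V : Submodule ℝ E) (y : E) {v : E}
    (hv : v ∈ V) : ‖y‖ ^ 2 - ‖V.starProjection y‖ ^ 2 ≤ ‖y - v‖ ^ 2 := by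
  have h1 := V.norm_sq_eq_add_norm_sq_starProjection y
  have h2 := V.norm_sq_eq_add_norm_sq_starProjection (y - v)
  have h3 : Vᗮ.starProjection v = 0 :=
    (Submodule.starProjection_apply_eq_zero_iff _).2 (Submodule.le_orthogonal_orthogonal V hv)
  rw [map_sub, map_sub, h3, sub_zero] at h2
  have := sq_nonneg ‖V.starProjection y - V.starProjection v‖
  linarith

/-- `X (β - β₀)` splits into the part of the coefficients in `ζ` and the inactive part. -/
lemma mulVec_sub_eq_add (X : Matrix (Fin n) (Fin p) ℝ) {β₀ : Fin p → ℝ} {ζ : Finset (Fin p)}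
    (hζ : support β₀ ⊆ ζ) (β : Fin p → ℝ) :
    WithLp.toLp 2 (X.mulVec (β - β₀)) =
      WithLp.toLp 2 (X.mulVec fun j => if j ∈ ζ then β j - β₀ j else 0) +
      WithLp.toLp 2 (X.mulVec fun j => if j ∈ ζ then 0 else β j) := by
  rw [← WithLp.toLp_add, ← Matrix.mulVec_add]
  congr 2
  ext j
  by_cases hj : j ∈ ζ
  · simp [hj]
  · have : β₀ j = 0 := by
      by_contra h
      exact hj (hζ (by simp [support, h]))
    simp [hj, this]

lemma norm_mulVec_inactive_le {X : Matrix (Fin n) (Fin p) ℝ}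
    (hX : ∀ j, √(∑ i, X i j ^ 2) = √(n : ℝ)) {ξ ζ : Finset (Fin p)} (hζ : ξ ⊆ ζ)
    {β : Fin p → ℝ} {σ z₀ : ℝ} (hσz : 0 ≤ σ * z₀) (hβ : ∀ j, j ∉ ξ → |β j| ≤ σ * z₀) :
    ‖WithLp.toLp 2 (X.mulVec fun j => if j ∈ ζ then 0 else β j)‖ ≤ σ * (√(n : ℝ) * p * z₀) := by
  refine (sqrt_sum_mulVec_sq_le hX _).trans ?_
  have : ∑ j, |if j ∈ ζ then 0 else β j| ≤ ∑ _j : Fin p, σ * z₀ := by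
    refine Finset.sum_le_sum fun j _ => ?_
    split_ifs with h
    · simpa using hσz
    · exact hβ j fun h' => h (hζ h')
  rw [Finset.sum_const, Finset.card_univ, Fintype.card_fin, nsmul_eq_mul] at this
  calc _ ≤ √(n : ℝ) * (p * (σ * z₀)) := by gcongr
    _ = _ := by ring

variable {X : Matrix (Fin n) (Fin p) ℝ} {β₀ β : Fin p → ℝ} {ξ₀ : Finset (Fin p)}
  {k lo hi u σ₀ σ x : ℝ}

/-- Parameters with too large a variance are rejected: the residual is too long. -/
lemma responseLaw_acceptance_le_of_large_variance (hσ₀ : 0 < σ₀) (hσ : 0 < σ) (hx0 : 0 ≤ x)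
    (hx1 : x < 1) (h : (1 + x) / (1 - x) < σ ^ 2 / σ₀ ^ 2) :
    responseLaw X σ β (acceptance X β₀ ξ₀ k lo (n * σ₀ ^ 2 * (1 + x)) u) ≤
      ENNReal.ofReal (Real.exp (-(n * x ^ 2 / 4))) := by
  rw [responseLaw_apply_eq _ _ _ (measurableSet_acceptance _ _ _ _ _ _ _)]
  set m := WithLp.toLp 2 (X.mulVec (β - β₀))
  have htail := stdGaussian_norm_sq_le (E := EuclideanSpace ℝ (Fin n)) hx0 (σ⁻¹ • m)
  simp only [finrank_euclideanSpace, Fintype.card_fin] at htail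
  refine (measure_mono fun e he => ?_).trans htail
  have h2 : ‖σ • e + m‖ ^ 2 ≤ n * σ₀ ^ 2 * (1 + x) := by
    have := he.2.1
    rwa [residual_add_noise] at this
  have h3 : σ • e + m = σ • (e + σ⁻¹ • m) := by
    rw [smul_add, smul_smul, mul_inv_cancel₀ hσ.ne', one_smul]
  rw [h3, norm_smul, Real.norm_eq_abs, abs_of_pos hσ, mul_pow] at h2
  rw [div_lt_div_iff₀ (by linarith) (by positivity)] at h
  simp only [Set.mem_ofPred_eq]
  have hn : (0 : ℝ) ≤ n := by positivity
  have h4 : σ ^ 2 * ‖e + σ⁻¹ • m‖ ^ 2 ≤ σ ^ 2 * (n * (1 - x)) := by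
    calc _ ≤ n * (σ₀ ^ 2 * (1 + x)) := by linarith
      _ ≤ n * (σ ^ 2 * (1 - x)) := by
          refine mul_le_mul_of_nonneg_left ?_ hn
          linarith
      _ = _ := by ring
  exact le_of_mul_le_mul_left h4 (by positivity)

/-- Parameters with too small a variance are rejected: the residual is too short after removal of
its component in the column span of the model, since that component is itself bounded. -/
lemma responseLaw_acceptance_le_of_small_variance {ξ : Finset (Fin p)} {z₀ : ℝ}
    (hX : ∀ j, √(∑ i, X i j ^ 2) = √(n : ℝ)) (hσ₀ : 0 < σ₀) (hσ : 0 < σ) (hx0 : 0 ≤ x)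
    (hx1 : x ≤ 1 / 2) (hu : u ^ 2 ≤ n * σ₀ ^ 2 * (x / 2))
    (hξ : ((ξ \ support β₀).card : ℝ) ≤ k) (hz : 0 ≤ z₀)
    (hβ : ∀ j, j ∉ ξ → |β j| ≤ σ * z₀) (h : σ ^ 2 / σ₀ ^ 2 < (1 - x) / (1 + x)) :
    responseLaw X σ β (acceptance X β₀ (support β₀) k (n * σ₀ ^ 2 * (1 - x / 2)) hi u) ≤
      ENNReal.ofReal (Real.exp (-(n * x ^ 2 / 8) + (√(n : ℝ) * p * z₀) ^ 2)) := by
  rw [responseLaw_apply_eq _ _ _ (measurableSet_acceptance _ _ _ _ _ _ _)]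
  set ζ := (ξ \ support β₀) ∪ support β₀ with hζ
  have hζ0 : support β₀ ⊆ ζ := Finset.subset_union_right
  have hξζ : ξ ⊆ ζ := by rw [hζ, Finset.sdiff_union_self_eq_union]; exact Finset.subset_union_left
  set v : EuclideanSpace ℝ (Fin n) :=
    WithLp.toLp 2 (X.mulVec fun j => if j ∈ ζ then β j - β₀ j else 0)
  set ν : EuclideanSpace ℝ (Fin n) := WithLp.toLp 2 (X.mulVec fun j => if j ∈ ζ then 0 else β j)
  have hv : v ∈ columnSpan X ζ := toLp_mulVec_mem_columnSpan fun j hj => by simp [hj]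
  have hν : ‖ν‖ ≤ σ * (√(n : ℝ) * p * z₀) :=
    norm_mulVec_inactive_le hX hξζ (by positivity) hβ
  have htail := stdGaussian_le_norm_sq (E := EuclideanSpace ℝ (Fin n)) hx0 hx1 (σ⁻¹ • ν)
  simp only [finrank_euclideanSpace, Fintype.card_fin] at htail
  have hν' : ‖σ⁻¹ • ν‖ ^ 2 ≤ (√(n : ℝ) * p * z₀) ^ 2 := by
    rw [norm_smul, Real.norm_eq_abs, abs_of_pos (inv_pos.2 hσ)]
    refine pow_le_pow_left₀ (by positivity) ?_ 2
    rwa [inv_mul_le_iff₀ hσ]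
  refine (measure_mono fun e he => ?_).trans (htail.trans (ENNReal.ofReal_le_ofReal
    (Real.exp_le_exp.2 (by gcongr))))
  set y := σ • e + (v + ν) with hy
  have hres : residual X β₀ (fun i => X.mulVec β i + σ * e i) = y := by
    rw [residual_add_noise, mulVec_sub_eq_add X hζ0]
  obtain ⟨hlo, -, hproj⟩ := he
  rw [hres] at hlo
  have hP := hproj _ hξ
  rw [hres] at hP
  have h1 := norm_sq_sub_norm_sq_starProjection_le (columnSpan X ζ) y hv
  have h2 : y - v = σ • (e + σ⁻¹ • ν) := by
    rw [smul_add, smul_smul, mul_inv_cancel₀ hσ.ne', one_smul, hy]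
    abel
  have hP2 : ‖(columnSpan X ζ).starProjection y‖ ^ 2 ≤ u ^ 2 := by gcongr
  rw [h2, norm_smul, Real.norm_eq_abs, abs_of_pos hσ, mul_pow] at h1
  rw [div_lt_div_iff₀ (by positivity) (by linarith)] at h
  simp only [Set.mem_ofPred_eq]
  have hn : (0 : ℝ) ≤ n := by positivity
  have h4 : σ ^ 2 * (n * (1 + x)) ≤ σ ^ 2 * ‖e + σ⁻¹ • ν‖ ^ 2 := by
    calc _ = n * (σ ^ 2 * (1 + x)) := by ring
      _ ≤ n * (σ₀ ^ 2 * (1 - x)) := by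
          refine mul_le_mul_of_nonneg_left ?_ hn
          linarith
      _ ≤ _ := by nlinarith
  exact le_of_mul_le_mul_left h4 (by positivity)

/-- Parameters with `‖X (β - β₀)‖` too large on the active columns are rejected: the projection of
the residual is too long. -/
lemma responseLaw_acceptance_le_of_far {ξ : Finset (Fin p)} {z₀ D y t : ℝ}
    (hX : ∀ j, √(∑ i, X i j ^ 2) = √(n : ℝ)) (hσ : 0 < σ)
    (hξ : ((ξ \ support β₀).card : ℝ) ≤ k) (hz : 0 ≤ z₀)
    (hβ : ∀ j, j ∉ ξ → |β j| ≤ σ * z₀) (ht : t < 1 / 2) (ht0 : 0 ≤ t) (hy : 0 ≤ y)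
    (hD : D ≤ ‖WithLp.toLp 2
      (X.mulVec fun j => if j ∈ ξ ∪ support β₀ then β j - β₀ j else 0)‖)
    (hDy : σ * (y + √(n : ℝ) * p * z₀) + u < D) :
    responseLaw X σ β (acceptance X β₀ (support β₀) k lo hi u) ≤
      ENNReal.ofReal ((√(1 - 2 * t))⁻¹ ^ (k + (support β₀).card) * Real.exp (-(t * y ^ 2))) := by
  rw [responseLaw_apply_eq _ _ _ (measurableSet_acceptance _ _ _ _ _ _ _)]
  set ζ := ξ ∪ support β₀ with hζ
  have hζ0 : support β₀ ⊆ ζ := Finset.subset_union_right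
  have hξζ : ξ ⊆ ζ := Finset.subset_union_left
  have hζ' : (ξ \ support β₀) ∪ support β₀ = ζ := Finset.sdiff_union_self_eq_union
  have hcard : (ζ.card : ℝ) ≤ k + (support β₀).card := by
    have : (ζ.card : ℝ) ≤ (ξ \ support β₀).card + (support β₀).card := by
      rw [← hζ']
      exact_mod_cast Finset.card_union_le _ _
    linarith
  set v : EuclideanSpace ℝ (Fin n) :=
    WithLp.toLp 2 (X.mulVec fun j => if j ∈ ζ then β j - β₀ j else 0)
  set ν : EuclideanSpace ℝ (Fin n) := WithLp.toLp 2 (X.mulVec fun j => if j ∈ ζ then 0 else β j)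
  have hv : v ∈ columnSpan X ζ := toLp_mulVec_mem_columnSpan fun j hj => by simp [hj]
  have hν : ‖ν‖ ≤ σ * (√(n : ℝ) * p * z₀) :=
    norm_mulVec_inactive_le hX hξζ (by positivity) hβ
  refine (measure_mono fun e he => ?_).trans (stdGaussian_columnSpan_tail X ζ hcard ht ht0 hy)
  have hP := he.2.2 _ hξ
  simp only [hζ'] at hP
  rw [residual_add_noise, mulVec_sub_eq_add X hζ0, map_add, map_smul, map_add,
    Submodule.starProjection_eq_self_iff.2 hv] at hP
  set P := (columnSpan X ζ).starProjection
  have h1 : ‖P ν‖ ≤ ‖ν‖ := Submodule.norm_starProjection_apply_le _ _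
  have h2 : ‖v‖ ≤ ‖σ • P e + (v + P ν)‖ + (‖σ • P e‖ + ‖P ν‖) := by
    have : v = (σ • P e + (v + P ν)) - (σ • P e + P ν) := by abel
    calc ‖v‖ = ‖(σ • P e + (v + P ν)) - (σ • P e + P ν)‖ := by rw [← this]
      _ ≤ _ := (norm_sub_le _ _).trans (by gcongr; exact norm_add_le _ _)
  have h3 : ‖σ • P e‖ = σ * ‖P e‖ := by rw [norm_smul, Real.norm_eq_abs, abs_of_pos hσ]
  rw [h3] at h2
  have h4 : σ * y < σ * ‖P e‖ := by nlinarith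
  exact lt_of_mul_lt_mul_left h4 hσ.le

end Power

section ConcentrationSet

variable {n p : ℕ} {X : Matrix (Fin n) (Fin p) ℝ} {β₀ : Fin p → ℝ}

/-- Outside the concentration set, a model that misses an active coefficient or estimates one badly
is far from the truth in the norm of the coefficients: a missed coefficient is large by the
beta-min condition, but is at most `σ z₀` in the model. -/
lemma le_sqrt_sum_sq_of_missed_or_inaccurate {ξ : Finset (Fin p)} {β : Fin p → ℝ}
    {σ z₀ a : ℝ} (hσz : 0 ≤ σ * z₀) (hβ : ∀ j, j ∉ ξ → |β j| ≤ σ * z₀)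
    (hmin : ∀ j ∈ support β₀, a ≤ |β₀ j|)
    (h : support β₀ ⊆ ξ → a ≤ √(∑ j ∈ ξ, (β j - β₀ j) ^ 2)) :
    a - σ * z₀ ≤ √(∑ j, (if j ∈ ξ ∪ support β₀ then β j - β₀ j else 0) ^ 2) := by
  by_cases hξ : support β₀ ⊆ ξ
  · refine (sub_le_self _ hσz).trans ((h hξ).trans (Real.sqrt_le_sqrt ?_))
    rw [Finset.union_eq_left.2 hξ, ← Finset.sum_filter_add_sum_filter_not Finset.univ (· ∈ ξ)]
    refine le_add_of_le_of_nonneg (le_of_eq ?_) (Finset.sum_nonneg fun _ _ => sq_nonneg _)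
    rw [Finset.filter_mem_eq_inter, Finset.univ_inter]
    exact Finset.sum_congr rfl fun j hj => by rw [if_pos hj]
  · obtain ⟨j, hj0, hj⟩ := Finset.not_subset.1 hξ
    have h1 : a - σ * z₀ ≤ |β j - β₀ j| := by
      have h2 := abs_sub_abs_le_abs_sub (β₀ j) (β j)
      rw [abs_sub_comm (β₀ j)] at h2
      linarith [hmin j hj0, hβ j hj]
    rw [← Real.sqrt_sq_eq_abs] at h1
    refine h1.trans (Real.sqrt_le_sqrt ?_)
    have h2 := Finset.single_le_sum
      (f := fun j => (if j ∈ ξ ∪ support β₀ then β j - β₀ j else 0) ^ 2)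
      (fun _ _ => sq_nonneg _) (Finset.mem_univ j)
    simpa [Finset.mem_union, hj0] using h2

/-- The power of the test outside the concentration set. The constant `κ < 1` bounds `σ₀ / σ` from
below, and `hsep` says that the threshold `T` is less than half of the separation `M`, up to the
inactive coefficients. -/
theorem responseLaw_acceptance_le {K M M₁ M₂ M₃ σ₀ z₀ T κ t ε : ℝ} (hn : 0 < n) (hp : 0 < p)
    (hX : ∀ j, √(∑ i, X i j ^ 2) = √(n : ℝ)) (hσ₀ : 0 < σ₀) (hz : 0 ≤ z₀)
    (hs : (support β₀).Nonempty) (hlam : 0 < lam K X β₀)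
    (hmin : BetaMin K M₃ X σ₀ β₀) (hM2 : M ≤ M₂) (hM3 : M ≤ M₃)
    (hε : ε = rate n p (support β₀).card) (hx0 : 0 ≤ M₁ * ε) (hx1 : M₁ * ε ≤ 1 / 2)
    (hT : 0 ≤ T) (hTx : T ^ 2 * ε ^ 2 ≤ M₁ * ε / 2) (ht : t < 1 / 2) (ht0 : 0 ≤ t)
    (hκ : 0 < κ) (hκx : κ ^ 2 * (1 + M₁ * ε) ≤ 1 - M₁ * ε)
    (hsep : T * (√(n : ℝ) * ε) + 2 * (√(n : ℝ) * p * z₀) < κ * ((M - T) * (√(n : ℝ) * ε)))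
    {θ : Param p} (hθ : 0 < θ.1) (hfull : FullRank X θ.2.1)
    (hcard : ((θ.2.1 \ support β₀).card : ℝ) ≤ K * (support β₀).card)
    (hβ : ∀ j, j ∉ θ.2.1 → |θ.2.2 j| ≤ θ.1 * z₀)
    (hout : θ ∉ concentrationSet K M₁ M₂ X σ₀ β₀ z₀) :
    responseLaw X θ.1 θ.2.2 (acceptance X β₀ (support β₀) (K * (support β₀).card)
        (n * σ₀ ^ 2 * (1 - M₁ * ε / 2)) (n * σ₀ ^ 2 * (1 + M₁ * ε)) (T * σ₀ * (√(n : ℝ) * ε))) ≤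
      ENNReal.ofReal (Real.exp (-(n * (M₁ * ε) ^ 2 / 8) + (√(n : ℝ) * p * z₀) ^ 2) +
        (√(1 - 2 * t))⁻¹ ^ (K * (support β₀).card + (support β₀).card) *
          Real.exp (-(t * T ^ 2 * (n * ε ^ 2)))) := by
  obtain ⟨σ, ξ, β⟩ := θ
  simp only at hθ hfull hcard hβ ⊢
  have hε0 : 0 ≤ ε := hε ▸ Real.sqrt_nonneg _
  rw [ENNReal.ofReal_add (by positivity) (by positivity)]
  by_cases hbig : (1 + M₁ * ε) / (1 - M₁ * ε) < σ ^ 2 / σ₀ ^ 2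
  · refine le_add_right ((responseLaw_acceptance_le_of_large_variance hσ₀ hθ hx0 (by linarith)
      hbig).trans (ENNReal.ofReal_le_ofReal (Real.exp_le_exp.2 ?_)))
    have h1 : (0 : ℝ) ≤ n * (M₁ * ε) ^ 2 := by positivity
    have h2 := sq_nonneg (√(n : ℝ) * p * z₀)
    linarith
  by_cases hsmall : σ ^ 2 / σ₀ ^ 2 < (1 - M₁ * ε) / (1 + M₁ * ε)
  · refine le_add_right (responseLaw_acceptance_le_of_small_variance hX hσ₀ hθ hx0 hx1 ?_ hcard hz
      hβ hsmall)
    rw [mul_pow, mul_pow, mul_pow, Real.sq_sqrt (by positivity)]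
    have : 0 ≤ σ₀ ^ 2 * (n : ℝ) := by positivity
    nlinarith
  refine le_add_left ?_
  set lm := lam K X β₀ with hlm
  have hcard' : ((ξ ∪ support β₀).card : ℝ) ≤ (K + 1) * (support β₀).card := by
    have : ((ξ ∪ support β₀).card : ℝ) ≤ (ξ \ support β₀).card + (support β₀).card := by
      rw [← Finset.sdiff_union_self_eq_union]
      exact_mod_cast Finset.card_union_le _ _
    linarith
  have hlam1 : lm ≤ 1 := muev_le_one hX hn hs (by
    linarith [(Nat.cast_nonneg (α := ℝ) _).trans hcard])
  have hsl : 0 < √lm := Real.sqrt_pos.2 hlam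
  set δ : Fin p → ℝ := fun j => if j ∈ ξ ∪ support β₀ then β j - β₀ j else 0 with hδ
  have hfar : M * σ₀ * ε / √lm - σ * z₀ ≤ √(∑ j, δ j ^ 2) := by
    refine le_sqrt_sum_sq_of_missed_or_inaccurate (by positivity) hβ (fun j hj => ?_) fun hsub => ?_
    · refine le_trans ?_ (hmin j hj)
      rw [← hε]
      gcongr
    · by_contra hcon
      refine hout ⟨⟨not_lt.1 hsmall |>.trans_eq' ?_, not_lt.1 hbig |>.trans_eq ?_⟩, hcard, hfull,
        hsub, hβ, ?_⟩
      · rw [hε]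
      · rw [hε]
      · refine (not_le.1 hcon).le.trans ?_
        rw [← hε]
        gcongr
  have hXδ : √(n : ℝ) * √lm * √(∑ j, δ j ^ 2) ≤ ‖WithLp.toLp 2 (X.mulVec δ)‖ := by
    rw [EuclideanSpace.norm_eq, ← Real.sqrt_mul (by positivity), ← Real.sqrt_mul (by positivity)]
    refine Real.sqrt_le_sqrt ?_
    have h := muev_mul_le X hfull hcard' hn (δ := δ) fun j hj => by simp only [hδ, if_neg hj]
    simpa [hlm, lam] using h
  have hD : M * σ₀ * (√(n : ℝ) * ε) - σ * (√(n : ℝ) * p * z₀) ≤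
      ‖WithLp.toLp 2 (X.mulVec δ)‖ := by
    refine le_trans ?_ ((mul_le_mul_of_nonneg_left hfar (by positivity)).trans hXδ)
    have h1 : √(n : ℝ) * √lm * (M * σ₀ * ε / √lm - σ * z₀) =
        M * σ₀ * (√(n : ℝ) * ε) - √lm * (σ * (√(n : ℝ) * z₀)) := by
      field_simp
    rw [h1]
    have h2 : √lm ≤ 1 := Real.sqrt_le_one.2 hlam1
    have h3 : (1 : ℝ) ≤ p := by exact_mod_cast hp
    have h4 : 0 ≤ σ * (√(n : ℝ) * z₀) := by positivity
    have h5 : √lm * (σ * (√(n : ℝ) * z₀)) ≤ p * (σ * (√(n : ℝ) * z₀)) :=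
      mul_le_mul_of_nonneg_right (h2.trans h3) h4
    linarith
  have hσκ : κ * σ ≤ σ₀ := by
    have h1 := not_lt.1 hbig
    rw [div_le_div_iff₀ (by positivity) (by linarith)] at h1
    have h2 : (κ * σ) ^ 2 ≤ σ₀ ^ 2 := by
      have h3 : κ ^ 2 * (1 + M₁ * ε) * σ ^ 2 ≤ (1 + M₁ * ε) * σ₀ ^ 2 := by
        calc _ ≤ (1 - M₁ * ε) * σ ^ 2 := by gcongr
          _ ≤ _ := by linarith
      refine le_of_mul_le_mul_left ?_ (by linarith : 0 < 1 + M₁ * ε)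
      linarith
    exact (sq_le_sq₀ (by positivity) hσ₀.le).1 h2
  have hfinal := responseLaw_acceptance_le_of_far (lo := n * σ₀ ^ 2 * (1 - M₁ * ε / 2))
    (hi := n * σ₀ ^ 2 * (1 + M₁ * ε)) (u := T * σ₀ * (√(n : ℝ) * ε)) hX hθ hcard hz hβ ht ht0
    (y := T * (√(n : ℝ) * ε)) (by positivity) hD (by
      have h1 : 0 ≤ T * (√(n : ℝ) * ε) + 2 * (√(n : ℝ) * p * z₀) := by positivity
      have h2 : κ * σ * (T * (√(n : ℝ) * ε) + 2 * (√(n : ℝ) * p * z₀)) ≤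
          σ₀ * (T * (√(n : ℝ) * ε) + 2 * (√(n : ℝ) * p * z₀)) := by gcongr
      have h3 := mul_lt_mul_of_pos_left hsep hσ₀
      have h4 : κ * (σ * (T * (√(n : ℝ) * ε) + 2 * (√(n : ℝ) * p * z₀))) <
          κ * (σ₀ * ((M - T) * (√(n : ℝ) * ε))) := by linarith
      have h5 := lt_of_mul_lt_mul_left h4 hκ.le
      linarith)
  refine hfinal.trans (ENNReal.ofReal_le_ofReal (le_of_eq ?_))
  congr 3
  rw [mul_pow, mul_pow, Real.sq_sqrt (by positivity)]
  ring

end ConcentrationSet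

/-! ### The posterior at a fixed sample size -/

section Fixed

variable {n p : ℕ} {X : Matrix (Fin n) (Fin p) ℝ} {β₀ : Fin p → ℝ}

/-- Near the truth, the mean of the likelihood ratio is controlled by the radii. -/
lemma lintegral_likelihood_div_nearTruth_le (hX : ∀ j, √(∑ i, X i j ^ 2) = √(n : ℝ))
    {σ₀ a r z₀ : ℝ} (hσ₀ : 0 < σ₀) (ha : 0 ≤ a) (ha1 : a ≤ 1 / 2) (hz : 0 ≤ z₀)
    {θ : Param p} (hθ : θ ∈ nearTruth σ₀ (support β₀) β₀ a r z₀) :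
    ∫⁻ Y, likelihood X Y σ₀ β₀ / likelihood X Y θ.1 θ.2.2 ∂responseLaw X σ₀ β₀ ≤
      ENNReal.ofReal (Real.exp (n * a ^ 2 +
        (√(n : ℝ) * ((support β₀).card * (r / σ₀)) + 2 * (√(n : ℝ) * p * z₀)) ^ 2)) := by
  obtain ⟨σ, ξ, β⟩ := θ
  obtain ⟨-, hσ, hσ2, hact, hina⟩ := hθ
  simp only at hσ hσ2 hact hina ⊢
  have hσpos : 0 < σ := hσ₀.trans_le hσ
  have hu0 : 0 ≤ 1 - σ₀ ^ 2 / σ ^ 2 := by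
    rw [sub_nonneg, div_le_one (by positivity)]
    gcongr
  have hu : 1 - σ₀ ^ 2 / σ ^ 2 ≤ a := by
    rw [sub_le_comm, le_div_iff₀ (by positivity)]
    nlinarith [sq_nonneg σ₀, mul_nonneg ha (sq_nonneg a), sq_nonneg a,
      mul_nonneg (mul_nonneg ha ha) (sq_nonneg σ₀)]
  have hσ' : σ ≤ 2 * σ₀ := by
    refine (sq_le_sq₀ hσpos.le (by positivity)).1 ?_
    nlinarith [sq_nonneg σ₀]
  have hnorm : ‖WithLp.toLp 2 (X.mulVec (β - β₀))‖ ≤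
      σ₀ * (√(n : ℝ) * ((support β₀).card * (r / σ₀)) + 2 * (√(n : ℝ) * p * z₀)) := by
    refine (sqrt_sum_mulVec_sq_le hX _).trans ?_
    have h1 : ∑ j, |(β - β₀) j| ≤ (support β₀).card * r + p * (2 * σ₀ * z₀) := by
      rw [← Finset.sum_add_sum_compl (support β₀)]
      refine add_le_add ?_ ?_
      · rw [← nsmul_eq_mul]
        exact Finset.sum_le_card_nsmul _ _ _ fun j hj => hact j hj
      · have h2 : ∑ j ∈ (support β₀)ᶜ, |(β - β₀) j| ≤
            ((support β₀)ᶜ.card : ℝ) * (2 * σ₀ * z₀) := by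
          rw [← nsmul_eq_mul]
          refine Finset.sum_le_card_nsmul _ _ _ fun j hj => ?_
          have hj' : j ∉ support β₀ := by simpa using hj
          have h0 : β₀ j = 0 := by simpa [support] using hj'
          rw [Pi.sub_apply, h0, sub_zero]
          exact (hina j hj').trans (by gcongr)
        refine h2.trans ?_
        gcongr
        simpa using Finset.card_le_univ (support β₀)ᶜ
    calc _ ≤ √(n : ℝ) * ((support β₀).card * r + p * (2 * σ₀ * z₀)) := by gcongr
      _ = _ := by field_simp
  refine (lintegral_likelihood_div X hσ₀ hσ ?_ β₀ β).trans (ENNReal.ofReal_le_ofReal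
    (Real.exp_le_exp.2 ?_))
  · nlinarith
  · have h1 : ∑ i, (X.mulVec β i - X.mulVec β₀ i) ^ 2 =
        ‖WithLp.toLp 2 (X.mulVec (β - β₀))‖ ^ 2 := by
      rw [EuclideanSpace.norm_sq_eq]
      simp [Matrix.mulVec_sub]
    rw [h1]
    gcongr
    rw [div_le_iff₀ (by positivity)]
    calc _ ≤ (σ₀ * (√(n : ℝ) * ((support β₀).card * (r / σ₀)) + 2 * (√(n : ℝ) * p * z₀))) ^ 2 := by
          gcongr
      _ = _ := by ring

/-- The posterior probability of the concentration set at a fixed sample size: `α` bounds the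
probability that the test rejects the truth, `τ` the prior mass of the remaining parameters weighted
by their probability of acceptance, and `γ` the prior mass near the truth. -/
theorem posteriorProb_concentrationSet {g : ℝ → ℝ} {w : Finset (Fin p) → ℝ} {h₀ : Measure ℝ}
    {h₁ : ℝ → ℝ} [IsProbabilityMeasure h₀] {K M M₁ M₂ M₃ σ₀ z₀ T κ t ε a r α τ γ x y W : ℝ}
    (hn : 0 < n) (hp : 0 < p) (hX : ∀ j, √(∑ i, X i j ^ 2) = √(n : ℝ)) (hσ₀ : 0 < σ₀)
    (hz : 0 ≤ z₀) (hs : (support β₀).Nonempty) (hlam : 0 < lam K X β₀)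
    (hmin : BetaMin K M₃ X σ₀ β₀) (hM2 : M ≤ M₂) (hM3 : M ≤ M₃)
    (hε : ε = rate n p (support β₀).card) (hx0 : 0 ≤ M₁ * ε) (hx1 : M₁ * ε ≤ 1 / 2)
    (hT : 0 ≤ T) (hTx : T ^ 2 * ε ^ 2 ≤ M₁ * ε / 2) (ht : t < 1 / 2) (ht0 : 0 ≤ t)
    (hκ : 0 < κ) (hκx : κ ^ 2 * (1 + M₁ * ε) ≤ 1 - M₁ * ε)
    (hsep : T * (√(n : ℝ) * ε) + 2 * (√(n : ℝ) * p * z₀) < κ * ((M - T) * (√(n : ℝ) * ε)))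
    (hg : IsDensityOn g (Set.Ioi 0)) (hh : IsDensityOn h₁ Set.univ) (hw : ∀ ξ, 0 ≤ w ξ)
    (hw0 : 0 < w ∅)
    (htail : h₀ {z | z₀ < |z|} ≤ ENNReal.ofReal (Real.exp (-(n : ℝ))))
    (hlarge : ∑ ξ with K * (support β₀).card < (Finset.card ξ : ℝ), w ξ ≤ W)
    (ha : 0 ≤ a) (ha1 : a ≤ 1 / 2) (hγ : 0 < γ) (hx : 0 < x) (hy : 0 < y)
    (hGγ : ENNReal.ofReal γ ≤ prior X g w h₀ h₁ (nearTruth σ₀ (support β₀) β₀ a r z₀))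
    (hα : Real.exp (-(n * (M₁ * ε) ^ 2 / 16)) + Real.exp (-(n * (M₁ * ε) ^ 2 / 8)) +
        Real.exp 1 * (p : ℝ) ^ (K * (support β₀).card) *
          ((√(1 - 2 * t))⁻¹ ^ (K * (support β₀).card + (support β₀).card) *
          Real.exp (-(t * T ^ 2 * (n * ε ^ 2)))) ≤ α)
    (hτ : W / w ∅ + p * Real.exp (-(n : ℝ)) +
      (Real.exp (-(n * (M₁ * ε) ^ 2 / 8) + (√(n : ℝ) * p * z₀) ^ 2) +
        (√(1 - 2 * t))⁻¹ ^ (K * (support β₀).card + (support β₀).card) *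
          Real.exp (-(t * T ^ 2 * (n * ε ^ 2)))) ≤ τ) :
    ENNReal.ofReal (1 - (α + y + τ * Real.exp (n * a ^ 2 +
        (√(n : ℝ) * ((support β₀).card * (r / σ₀)) + 2 * (√(n : ℝ) * p * z₀)) ^ 2) /
          (x * γ * y))) ≤
      responseLaw X σ₀ β₀ {Y | ENNReal.ofReal (1 - x) ≤
        posteriorProb X (prior X g w h₀ h₁) Y (concentrationSet K M₁ M₂ X σ₀ β₀ z₀)} := by
  have hPr1 : prior X g w h₀ h₁ Set.univ ≤ 1 := prior_univ_le_one hg hh hw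
  have : IsFiniteMeasure (prior X g w h₀ h₁) := ⟨hPr1.trans_lt ENNReal.one_lt_top⟩
  have hae := ae_prior_pos_and_fullRank (X := X) (w := w) (g := g) (h₀ := h₀) (h₁ := h₁)
  set Pr := prior X g w h₀ h₁ with hPr
  set B := concentrationSet K M₁ M₂ X σ₀ β₀ z₀ with hB
  set A := acceptance X β₀ (support β₀) (K * (support β₀).card)
    (n * σ₀ ^ 2 * (1 - M₁ * ε / 2)) (n * σ₀ ^ 2 * (1 + M₁ * ε)) (T * σ₀ * (√(n : ℝ) * ε)) with hA
  set b := Real.exp (-(n * (M₁ * ε) ^ 2 / 8) + (√(n : ℝ) * p * z₀) ^ 2) +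
        (√(1 - 2 * t))⁻¹ ^ (K * (support β₀).card + (support β₀).card) *
          Real.exp (-(t * T ^ 2 * (n * ε ^ 2))) with hb
  have hε0 : 0 ≤ ε := hε ▸ Real.sqrt_nonneg _
  have hb0 : 0 ≤ b := by positivity
  have hW0 : 0 ≤ W := (Finset.sum_nonneg fun ξ _ => hw ξ).trans hlarge
  set N₁ := {θ : Param p | K * (support β₀).card < ((θ.2.1 \ support β₀).card : ℝ)} with hN₁
  set N₂ := {θ : Param p | ∃ j, j ∉ θ.2.1 ∧ θ.1 * z₀ < |θ.2.2 j|} with hN₂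
  have hmN₁ : MeasurableSet N₁ := measurableSet_large_models _ _
  have hmN₂ : MeasurableSet N₂ := measurableSet_large_inactive _
  have hpower : ∫⁻ θ in Bᶜ, responseLaw X θ.1 θ.2.2 A ∂Pr ≤ ENNReal.ofReal τ := by
    calc ∫⁻ θ in Bᶜ, responseLaw X θ.1 θ.2.2 A ∂Pr
        ≤ ∫⁻ θ in Bᶜ, (N₁.indicator 1 θ + N₂.indicator 1 θ + ENNReal.ofReal b) ∂Pr := by
          refine setLIntegral_mono_ae (by fun_prop (disch := assumption)) ?_
          filter_upwards [hae] with θ hθ hθB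
          by_cases h1 : θ ∈ N₁
          · rw [Set.indicator_of_mem h1]
            exact prob_le_one.trans (le_add_right (le_add_right le_rfl))
          by_cases h2 : θ ∈ N₂
          · rw [Set.indicator_of_mem h2]
            exact prob_le_one.trans (le_add_right (le_add_left le_rfl))
          refine le_add_left (responseLaw_acceptance_le hn hp hX hσ₀ hz hs hlam hmin hM2 hM3 hε
            hx0 hx1 hT hTx ht ht0 hκ hκx hsep hθ.1 hθ.2 (not_lt.1 h1) (fun j hj => ?_) hθB)
          by_contra hcon
          exact h2 ⟨j, hj, not_le.1 hcon⟩
      _ ≤ ∫⁻ θ, (N₁.indicator 1 θ + N₂.indicator 1 θ + ENNReal.ofReal b) ∂Pr :=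
          setLIntegral_le_lintegral _ _
      _ = Pr N₁ + Pr N₂ + ENNReal.ofReal b * Pr Set.univ := by
          rw [lintegral_add_right _ measurable_const,
            lintegral_add_right _ (measurable_one.indicator hmN₂), lintegral_indicator_one hmN₁,
            lintegral_indicator_one hmN₂, lintegral_const]
      _ ≤ ENNReal.ofReal (W / w ∅) + ENNReal.ofReal (p * Real.exp (-(n : ℝ))) +
          ENNReal.ofReal b := by
          refine add_le_add (add_le_add ?_ ?_) (mul_le_of_le_one_right' hPr1)
          · refine (prior_large_models_le hg hh hw hw0 _ _).trans (ENNReal.ofReal_le_ofReal ?_)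
            gcongr
          · refine (prior_large_inactive_le hg hh hw z₀).trans ?_
            rw [ENNReal.ofReal_mul (by positivity), ENNReal.ofReal_natCast]
            gcongr
      _ ≤ ENNReal.ofReal τ := by
          rw [← ENNReal.ofReal_add (by positivity) (by positivity),
            ← ENNReal.ofReal_add (by positivity) (by positivity)]
          exact ENNReal.ofReal_le_ofReal hτ
  have hlevel : responseLaw X σ₀ β₀ Aᶜ ≤ ENNReal.ofReal α :=
    (responseLaw_acceptance_compl_le X β₀ (support β₀) hp hσ₀ hx0 hx1 hT hε0 ht ht0).trans
      (ENNReal.ofReal_le_ofReal hα)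
  exact posteriorProb_concentration X Pr β₀ hσ₀ (hae.mono fun θ h => h.1) hγ hx hy
    (le_trans (by positivity) hα) (le_trans (by positivity) hτ) hGγ
    (fun θ hθ => lintegral_likelihood_div_nearTruth_le hX hσ₀ ha ha1 hz hθ)
    (measurableSet_acceptance _ _ _ _ _ _ _) hlevel hpower

end Fixed

/-! ### Rates -/

/-- Constants, and constants to the power `s`, are negligible against `exp (c s log p)`. -/
lemma exists_forall_exp_neg_le {b c d : ℝ} (hb : 0 < b) (hc : 0 < c) (hd : 0 < d) :
    ∃ B : ℝ, ∀ ℓ : ℝ, B ≤ ℓ → ∀ s : ℝ, 1 ≤ s → Real.exp (-(d * (s * ℓ))) ≤ b * c ^ s := by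
  refine ⟨(|Real.log b| + |Real.log c|) / d, fun ℓ hℓ s hs => ?_⟩
  rw [div_le_iff₀ hd] at hℓ
  rw [Real.rpow_def_of_pos hc]
  nth_rw 1 [← Real.exp_log hb]
  rw [← Real.exp_add]
  refine Real.exp_le_exp.2 ?_
  have h1 := neg_abs_le (Real.log b)
  have h2 := neg_abs_le (Real.log c)
  have h3 := abs_nonneg (Real.log b)
  have h4 : s * (|Real.log b| + |Real.log c|) ≤ s * (ℓ * d) := by gcongr
  nlinarith

/-- The rate times the `s`-th power of the radius `√(log p / (n s))` is at least `p ^ (-s)`. -/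
lemma inv_pow_le_rate_mul {n p s : ℕ} (hs : 1 ≤ s) (hsn : s ≤ n) (hnp : n < p)
    (hlog : 1 ≤ Real.log p) :
    ((p : ℝ)⁻¹) ^ s ≤ rate n p s * √(Real.log p / (n * s)) ^ s := by
  have hs0 : (0 : ℝ) < s := by exact_mod_cast hs
  have hn0 : (0 : ℝ) < n := by exact_mod_cast (by omega : 0 < n)
  have hp0 : (0 : ℝ) < p := by exact_mod_cast (by omega : 0 < p)
  have hsn' : (s : ℝ) ≤ n := by exact_mod_cast hsn
  have hnp' : (n : ℝ) ≤ p := by exact_mod_cast hnp.le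
  have hr : 0 ≤ rate n p s := Real.sqrt_nonneg _
  refine (sq_le_sq₀ (by positivity) (by positivity)).1 ?_
  obtain ⟨m, rfl⟩ : ∃ m, s = m + 1 := ⟨s - 1, by omega⟩
  set s : ℝ := ((m + 1 : ℕ) : ℝ) with hs_def
  have hR : rate n p (m + 1) ^ 2 = s * Real.log p / n := by
    rw [rate, Real.sq_sqrt (by positivity)]
  have hQ : √(Real.log p / (n * s)) ^ 2 = Real.log p / (n * s) := Real.sq_sqrt (by positivity)
  have h1 : ((p : ℝ)⁻¹) ^ 2 ≤ Real.log p / (n * s) := by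
    rw [inv_pow, inv_eq_one_div, div_le_div_iff₀ (by positivity) (by positivity)]
    have : (n : ℝ) * s ≤ p * p := by gcongr; exact hsn'.trans hnp'
    nlinarith
  have h2 : ((p : ℝ)⁻¹) ^ 2 ≤ s * Real.log p / n * (Real.log p / (n * s)) := by
    have e : s * Real.log p / n * (Real.log p / (n * s)) = Real.log p ^ 2 / (n * n) := by
      field_simp
    rw [e, inv_pow, inv_eq_one_div, div_le_div_iff₀ (by positivity) (by positivity)]
    have h3 : (n : ℝ) * n ≤ p * p := by gcongr
    nlinarith [one_le_pow₀ hlog (n := 2)]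
  calc _ = (((p : ℝ)⁻¹) ^ 2) ^ m * ((p : ℝ)⁻¹) ^ 2 := by ring
    _ ≤ (Real.log p / (n * s)) ^ m * (s * Real.log p / n * (Real.log p / (n * s))) := by gcongr
    _ = rate n p (m + 1) ^ 2 * (√(Real.log p / (n * s)) ^ 2) ^ (m + 1) := by rw [hR, hQ]; ring
    _ = _ := by ring

lemma natCast_mul_rate_sq {n p s : ℕ} (hn : 0 < n) : n * rate n p s ^ 2 = s * Real.log p := by
  have hn0 : (n : ℝ) ≠ 0 := by exact_mod_cast hn.ne'
  have : 0 ≤ Real.log p := Real.log_natCast_nonneg p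
  rw [rate, Real.sq_sqrt (by positivity)]
  field_simp

lemma exists_le_densityLaw_Icc {g : ℝ → ℝ} (hg : VariancePrior g) {σ₀ : ℝ} (hσ₀ : 0 < σ₀) :
    ∃ c > 0, ∃ a₀ > 0, ∀ a, 0 ≤ a → a ≤ a₀ → ENNReal.ofReal (c * a) ≤
      densityLaw g (Set.Ioi 0) (Set.Icc (σ₀ ^ 2) (σ₀ ^ 2 * (1 + a))) := by
  have hv : 0 < σ₀ ^ 2 := by positivity
  have hc : ContinuousAt g (σ₀ ^ 2) := hg.continuous.continuousAt (Ioi_mem_nhds hv)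
  have hpos := hg.pos _ hv
  have hev : ∀ᶠ v in 𝓝 (σ₀ ^ 2), g (σ₀ ^ 2) / 2 < g v :=
    hc.eventually (lt_mem_nhds (by linarith))
  obtain ⟨r, hr, hball⟩ := Metric.eventually_nhds_iff.1 hev
  refine ⟨g (σ₀ ^ 2) / 2 * σ₀ ^ 2, by positivity, r / (2 * σ₀ ^ 2), by positivity,
    fun a ha ha0 => ?_⟩
  rw [le_div_iff₀ (by positivity)] at ha0
  have h := ofReal_mul_le_densityLaw_Icc (f := g) (S := Set.Ioi 0) (l := σ₀ ^ 2)
    (u := σ₀ ^ 2 * (1 + a)) (q := g (σ₀ ^ 2) / 2) (by positivity)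
    (fun v hv' => hv.trans_le hv'.1) fun v hv' => (hball (by
      rw [Real.dist_eq, abs_of_nonneg (by linarith [hv'.1])]
      linarith [hv'.2])).le
  refine le_trans (le_of_eq ?_) h
  congr 1
  ring

/-- The prior mass near the truth is at least `p ^ (-(A₁ + A₃ + 1 + d) s)`. -/
lemma exp_neg_le_prior_nearTruth {n p : ℕ} {X : Matrix (Fin n) (Fin p) ℝ} {β₀ : Fin p → ℝ}
    {g : ℝ → ℝ} {w : Finset (Fin p) → ℝ} {h₀ : Measure ℝ} {h₁ : ℝ → ℝ} [IsProbabilityMeasure h₀]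
    {σ₀ z₀ η A₁ A₃ d cg c : ℝ} {s : ℕ} (hcard : (support β₀).card = s) (hs : 1 ≤ s) (hsn : s ≤ n)
    (hnp : n < p) (hlog : 1 ≤ Real.log p) (hg : IsDensityOn g (Set.Ioi 0))
    (hh : IsDensityOn h₁ Set.univ) (hw : ∀ ξ, 0 ≤ w ξ) (h1 : ∑ ξ, w ξ = 1) (h0 : 0 < w ∅)
    (hfull : FullRank X (support β₀)) (hσ₀ : 0 < σ₀) (hη0 : 0 ≤ η) (hη1 : η ≤ 1)
    (hε1 : rate n p s ≤ 1) (hcg : 0 ≤ cg) (hc : 0 ≤ c)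
    (hgm : ENNReal.ofReal (cg * (η * rate n p s)) ≤ densityLaw g (Set.Ioi 0)
      (Set.Icc (σ₀ ^ 2) (σ₀ ^ 2 * (1 + η * rate n p s))))
    (htrue : (p : ℝ) ^ (-(A₁ * s)) ≤ w (support β₀))
    (hslab : ∀ z, |z| ≤ slabRadius n σ₀ β₀ → c * (p : ℝ) ^ (-A₃) ≤ h₁ z)
    (htail : h₀ {z | z₀ < |z|} ≤ ENNReal.ofReal (Real.exp (-(n : ℝ))))
    (hpn : p * Real.exp (-(n : ℝ)) ≤ 1 / 2)
    (hconst : Real.exp (-(d * (s * Real.log p))) ≤ cg * η / 2 * (c * η) ^ (s : ℝ)) :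
    ENNReal.ofReal (Real.exp (-((A₁ + A₃ + 1 + d) * (s * Real.log p)))) ≤
      prior X g w h₀ h₁ (nearTruth σ₀ (support β₀) β₀ (η * rate n p s)
        (η * σ₀ * √(Real.log p / (n * s))) z₀) := by
  have hs0 : (0 : ℝ) < s := by exact_mod_cast hs
  have hs1 : (1 : ℝ) ≤ s := by exact_mod_cast hs
  have hn0 : (0 : ℝ) < n := by exact_mod_cast (by omega : 0 < n)
  have hp0 : (0 : ℝ) < p := by exact_mod_cast (by omega : 0 < p)
  have hr0 : 0 ≤ rate n p s := Real.sqrt_nonneg _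
  set ε := rate n p s with hε
  set q₁ := √(Real.log p / (n * s)) with hq₁
  set q := c * (p : ℝ) ^ (-A₃) with hq
  have hq1ε : q₁ ≤ ε := by
    rw [hq₁, hε, rate]
    refine Real.sqrt_le_sqrt ?_
    rw [div_le_div_iff₀ (by positivity) hn0]
    have : Real.log p * n * 1 ≤ Real.log p * n * (s * s) := by
      gcongr
      nlinarith
    linarith
  have hrσ : η * σ₀ * q₁ / σ₀ = η * q₁ := by field_simp
  refine le_trans ?_ (le_prior_nearTruth (X := X) (w := w) (h₀ := h₀) (z₀ := z₀) (q := q) hg hh hw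
    h1 h0 hfull hσ₀ (a := η * ε) (by nlinarith) (r := η * σ₀ * q₁) (by positivity) (by positivity)
    fun z j hj hz => hslab z (hz.trans ?_))
  · -- the spike factor is at least `(1 - exp (-n)) ^ p ≥ 1 / 2`
    have hspike : ENNReal.ofReal (1 / 2) ≤ h₀ {z | |z| ≤ z₀} ^ p := by
      have he1 : Real.exp (-(n : ℝ)) ≤ 1 := Real.exp_le_one_iff.2 (by linarith)
      have h2 : ENNReal.ofReal (1 - Real.exp (-(n : ℝ))) ≤ h₀ {z | |z| ≤ z₀} := by
        have hcompl : {z : ℝ | |z| ≤ z₀} = {z | z₀ < |z|}ᶜ := by ext; simp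
        have hm : MeasurableSet {z : ℝ | z₀ < |z|} :=
          measurableSet_lt (by fun_prop) (by fun_prop)
        rw [hcompl, prob_compl_eq_one_sub hm, ENNReal.ofReal_sub _ (Real.exp_pos _).le,
          ENNReal.ofReal_one]
        exact tsub_le_tsub_left htail _
      refine le_trans ?_ (pow_le_pow_left' h2 p)
      rw [← ENNReal.ofReal_pow (by linarith)]
      refine ENNReal.ofReal_le_ofReal ?_
      have h3 := one_add_mul_le_pow (a := -Real.exp (-(n : ℝ))) (by linarith) p
      rw [← sub_eq_add_neg] at h3
      linarith
    rw [hrσ, hcard]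
    calc ENNReal.ofReal (Real.exp (-((A₁ + A₃ + 1 + d) * (s * Real.log p))))
        ≤ ENNReal.ofReal (w (support β₀) * (cg * (η * ε) * ((q * (η * q₁)) ^ s * (1 / 2)))) := by
          refine ENNReal.ofReal_le_ofReal ?_
          have e1 : ∀ A : ℝ, Real.exp (-(A * (s * Real.log p))) =
              (p : ℝ) ^ (-(A * s)) := fun A => by
            rw [Real.rpow_def_of_pos hp0]
            congr 1
            ring
          have e2 : (p : ℝ)⁻¹ ^ s = Real.exp (-(1 * (s * Real.log p))) := by
            rw [e1, one_mul, inv_pow, Real.rpow_neg hp0.le, Real.rpow_natCast]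
          have e3 : ((p : ℝ) ^ (-A₃)) ^ s = Real.exp (-(A₃ * (s * Real.log p))) := by
            rw [e1, ← Real.rpow_natCast, ← Real.rpow_mul hp0.le]
            congr 1
            ring
          have hrate := inv_pow_le_rate_mul hs hsn hnp hlog
          rw [e2, ← hε, ← hq₁] at hrate
          rw [← e1] at htrue
          rw [Real.rpow_natCast] at hconst
          have e4 : w (support β₀) * (cg * (η * ε) * ((q * (η * q₁)) ^ s * (1 / 2))) =
              w (support β₀) * ((p : ℝ) ^ (-A₃)) ^ s * (ε * q₁ ^ s) *
                (cg * η / 2 * (c * η) ^ s) := by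
            rw [hq]; simp only [mul_pow]; ring
          rw [e4, e3]
          calc Real.exp (-((A₁ + A₃ + 1 + d) * (s * Real.log p)))
              = Real.exp (-(A₁ * (s * Real.log p))) * Real.exp (-(A₃ * (s * Real.log p))) *
                Real.exp (-(1 * (s * Real.log p))) * Real.exp (-(d * (s * Real.log p))) := by
                rw [← Real.exp_add, ← Real.exp_add, ← Real.exp_add]
                congr 1
                ring
            _ ≤ _ := by
                have := hw (support β₀)
                gcongr
      _ = ENNReal.ofReal (w (support β₀)) * (ENNReal.ofReal (cg * (η * ε)) *
          (ENNReal.ofReal (q * (η * q₁)) ^ s * ENNReal.ofReal (1 / 2))) := by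
          rw [ENNReal.ofReal_mul (hw _), ENNReal.ofReal_mul (p := cg * (η * ε)) (by positivity),
            ENNReal.ofReal_mul (p := (q * (η * q₁)) ^ s) (by positivity),
            ENNReal.ofReal_pow (by positivity)]
      _ ≤ _ := by gcongr
  · rw [hrσ, slabRadius, hcard]
    refine add_le_add (le_ciSup (f := fun j : support β₀ => |β₀ j / σ₀|)
      (Set.finite_range _).bddAbove ⟨j, hj⟩) ?_
    calc η * q₁ ≤ 1 * ε := by gcongr
      _ = _ := one_mul _

/-- The level of the test in terms of `L = s log p`: the exponent `v = t T²` of the chi-square tail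
exceeds the exponent `K` of the number of models. -/
lemma level_le {L M₁ K R μ v c C : ℝ} (hL : 0 ≤ L) (hK : K ≤ R) (hv : v = R + μ)
    (hc1 : c ≤ M₁ ^ 2 / 16) (hc2 : c ≤ μ / 2) (hC : C ≤ Real.exp (μ / 2 * L)) :
    Real.exp (-(M₁ ^ 2 * L / 16)) + Real.exp (-(M₁ ^ 2 * L / 8)) +
      Real.exp 1 * Real.exp (K * L) * (C * Real.exp (-(v * L))) ≤ 5 * Real.exp (-(c * L)) := by
  have hM := sq_nonneg M₁
  have hcL := mul_le_mul_of_nonneg_right hc1 hL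
  have h1 : Real.exp (-(M₁ ^ 2 * L / 16)) ≤ Real.exp (-(c * L)) :=
    Real.exp_le_exp.2 (by linarith)
  have h2 : Real.exp (-(M₁ ^ 2 * L / 8)) ≤ Real.exp (-(c * L)) :=
    Real.exp_le_exp.2 (by nlinarith)
  have h3 : Real.exp (K * L) * (C * Real.exp (-(v * L))) ≤ Real.exp (-(c * L)) := by
    calc _ ≤ Real.exp (K * L) * (Real.exp (μ / 2 * L) * Real.exp (-(v * L))) := by gcongr
      _ = Real.exp (K * L + μ / 2 * L - v * L) := by
          rw [← Real.exp_add, ← Real.exp_add]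
          congr 1
          ring
      _ ≤ _ := Real.exp_le_exp.2 (by subst hv; nlinarith)
  have h4 : Real.exp 1 * (Real.exp (K * L) * (C * Real.exp (-(v * L)))) ≤
      3 * Real.exp (-(c * L)) := by
    have := Real.exp_one_lt_d9
    exact (mul_le_mul_of_nonneg_left h3 (Real.exp_pos 1).le).trans (by gcongr; linarith)
  rw [mul_assoc (Real.exp 1)]
  linarith

/-- The prior mass of large models and of large inactive coefficients, and the error of the test, in
terms of `L = s log p`: all are of order `exp (-A L)`, and constants cost `d`. -/
lemma power_le {L M₁ A R μ μ' v d C w pn C₀ ρ : ℝ} (hL : 0 ≤ L) (hA : A ≤ R) (hμ : 0 ≤ μ)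
    (hv : v = R + μ) (hM : M₁ ^ 2 / 8 = R + μ') (hC : C ≤ Real.exp (μ / 2 * L))
    (hw : 1 ≤ C₀ * w) (hw0 : 0 < w) (hpn : pn ≤ Real.exp (-(A * L))) (hρ : ρ ^ 2 ≤ μ' * L)
    (hC₀ : C₀ + 3 ≤ Real.exp (d * L)) :
    Real.exp (-(A * L)) / w + pn + (Real.exp (-(M₁ ^ 2 * L / 8) + ρ ^ 2) +
      C * Real.exp (-(v * L))) ≤ Real.exp (-((A - d) * L)) := by
  have h1 : Real.exp (-(A * L)) / w ≤ C₀ * Real.exp (-(A * L)) := by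
    rw [div_le_iff₀ hw0]
    calc _ = 1 * Real.exp (-(A * L)) := (one_mul _).symm
      _ ≤ C₀ * w * Real.exp (-(A * L)) := by gcongr
      _ = _ := by ring
  have hAL := mul_le_mul_of_nonneg_right hA hL
  have h2 : Real.exp (-(M₁ ^ 2 * L / 8) + ρ ^ 2) ≤ Real.exp (-(A * L)) := by
    refine Real.exp_le_exp.2 ?_
    have : M₁ ^ 2 * L / 8 = (R + μ') * L := by rw [← hM]; ring
    rw [this]
    linarith
  have h3 : C * Real.exp (-(v * L)) ≤ Real.exp (-(A * L)) := by
    calc _ ≤ Real.exp (μ / 2 * L) * Real.exp (-(v * L)) := by gcongr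
      _ = Real.exp (μ / 2 * L - v * L) := by
          rw [← Real.exp_add]
          congr 1
      _ ≤ _ := Real.exp_le_exp.2 (by
          have := mul_nonneg hμ hL
          subst hv; nlinarith)
  calc _ ≤ (C₀ + 3) * Real.exp (-(A * L)) := by linarith
    _ ≤ Real.exp (d * L) * Real.exp (-(A * L)) := by gcongr
    _ = _ := by
        rw [← Real.exp_add]
        congr 1
        ring

/-- The choice of the threshold `T` and of the exponential moment `t` of the tests: a chi-square
tail bound at level `T²` with moment `t` beats the exponent `R`, and `2 T` stays below the
constant `M` of the estimation error and of the beta-min condition. -/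
lemma exists_threshold {R M : ℝ} (hR : 0 < R) (hM : √(8 * R) < M) :
    ∃ T t : ℝ, 0 < T ∧ 2 * T < M ∧ 0 ≤ t ∧ t < 1 / 2 ∧ R < t * T ^ 2 := by
  have hQ2 : √(8 * R) ^ 2 = 8 * R := Real.sq_sqrt (by positivity)
  have hQ0 : 0 < √(8 * R) := Real.sqrt_pos.2 (by positivity)
  set Q := √(8 * R)
  obtain ⟨T, hT⟩ : ∃ T, T = (Q + M) / 4 := ⟨_, rfl⟩
  have hT0 : 0 < T := by linarith
  have hTR : 2 * R < T ^ 2 := by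
    have : Q / 2 < T := by linarith
    nlinarith
  have hRT : R / T ^ 2 < 1 / 2 := by rw [div_lt_iff₀ (by positivity)]; linarith
  obtain ⟨t, ht1, ht2⟩ := exists_between hRT
  refine ⟨T, t, hT0, by linarith, (div_nonneg hR.le (sq_nonneg T)).trans ht1.le, ht2, ?_⟩
  rwa [div_lt_iff₀ (by positivity)] at ht1

/-- The choice of the lower bound `κ` for `σ₀ / σ`: after scaling by `κ`, the separation `M - T`
still exceeds `T`. -/
lemma exists_shrinkage {T M : ℝ} (hT : 0 < T) (hTM : 2 * T < M) :
    ∃ κ : ℝ, 0 < κ ∧ κ < 1 ∧ κ * (M - T) = M / 2 := by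
  have hMT : 0 < M - T := by linarith
  refine ⟨M / (2 * (M - T)), div_pos (by linarith) (by linarith), ?_, by field_simp⟩
  rw [div_lt_one (by linarith)]
  linarith

/-- `n` exceeds every multiple of `L = n ε²`, so that `p exp (-n)` is negligible. -/
lemma mul_exp_neg_le_exp_neg {n q ε L A : ℝ} (hn : 0 < n) (hq : 0 < q) (hL : n * ε ^ 2 = L)
    (hε0 : 0 ≤ ε) (hε1 : ε ≤ 1) (hA : 0 < A) (hεA : ε ≤ 1 / (1 + A)) (hlog : Real.log q ≤ L) :
    q * Real.exp (-n) ≤ Real.exp (-(A * L)) := by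
  nth_rw 1 [← Real.exp_log hq]
  rw [← Real.exp_add]
  refine Real.exp_le_exp.2 ?_
  have h1 : (1 + A) * L ≤ n := by
    rw [le_div_iff₀ (by positivity)] at hεA
    have : (1 + A) * ε ^ 2 ≤ 1 := by nlinarith
    rw [← hL]
    nlinarith
  linarith

/-- On the neighbourhood of the truth with relative radius `η ε` for the standard deviation and
`η √(log p / (n s))` for the active coefficients, the exponent of the divergence of the
likelihoods is a small multiple of `s log p`. -/
lemma nearTruth_exponent_le {n s ℓ ε L l ρ σ η d : ℝ} (hn : 0 < n) (hs : 0 < s) (hσ : 0 < σ)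
    (hℓ : 0 ≤ ℓ) (hη : 0 ≤ η) (hL : L = s * ℓ) (hε : n * ε ^ 2 = L) (hl : 0 ≤ l) (hl2 : l ^ 2 = L)
    (hρ0 : 0 ≤ ρ) (hρ : 2 * ρ ≤ η * l) (hd : 5 * η ^ 2 ≤ d) :
    n * (η * ε) ^ 2 + (√n * (s * (η * σ * √(ℓ / (n * s)) / σ)) + 2 * ρ) ^ 2 ≤ d * L := by
  have e1 : √n * (s * √(ℓ / (n * s))) = l := by
    refine (sq_eq_sq₀ (by positivity) hl).1 ?_
    rw [mul_pow, mul_pow, Real.sq_sqrt hn.le, Real.sq_sqrt (by positivity), hl2, hL]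
    field_simp
  have e2 : √n * (s * (η * σ * √(ℓ / (n * s)) / σ)) = η * l := by
    rw [← e1]
    field_simp
  have h2 : (η * l + 2 * ρ) ^ 2 ≤ (2 * (η * l)) ^ 2 := by
    have := mul_nonneg hη hl
    gcongr
    linarith
  have e3 : n * (η * ε) ^ 2 = η ^ 2 * L := by rw [← hε]; ring
  have e4 : (2 * (η * l)) ^ 2 = 4 * η ^ 2 * L := by rw [← hl2]; ring
  rw [e2, e3]
  rw [e4] at h2
  have hL0 : 0 ≤ L := by rw [← hl2]; positivity
  have := mul_le_mul_of_nonneg_right hd hL0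
  linarith

/-- The probability that the posterior does not concentrate: the level of the test, the
failure of the evidence lower bound, and Markov's inequality for the numerator. -/
lemma failure_le {L A B δ c₄ c₅ k : ℝ} (hL : 0 ≤ L) (hδ0 : 0 ≤ δ) (hδ : A = δ + B)
    (hk : k ≤ δ / 8 * L) (h₄ : c₅ ≤ c₄) (h₅ : c₅ ≤ δ / 8) (h7 : Real.exp (-(c₅ / 2 * L)) ≤ 7⁻¹) :
    5 * Real.exp (-(c₄ * L)) + Real.exp (-(δ / 8 * L)) +
      Real.exp (-((A - δ / 8) * L)) * Real.exp k / (Real.exp (-(δ / 4 * L)) *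
        Real.exp (-((B + δ / 8) * L)) * Real.exp (-(δ / 8 * L))) ≤ Real.exp (-(c₅ / 2 * L)) := by
  have hratio : Real.exp (-((A - δ / 8) * L)) * Real.exp k / (Real.exp (-(δ / 4 * L)) *
      Real.exp (-((B + δ / 8) * L)) * Real.exp (-(δ / 8 * L))) ≤ Real.exp (-(c₅ * L)) := by
    rw [← Real.exp_add, ← Real.exp_add, ← Real.exp_add, ← Real.exp_sub]
    refine Real.exp_le_exp.2 ?_
    have h1 : c₅ * L ≤ δ / 8 * L := by gcongr
    have := mul_nonneg hδ0 hL
    subst hδ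
    linarith
  have h1 : Real.exp (-(c₄ * L)) ≤ Real.exp (-(c₅ * L)) := by gcongr
  have h2 : Real.exp (-(δ / 8 * L)) ≤ Real.exp (-(c₅ * L)) := by gcongr
  have h4 : Real.exp (-(c₅ * L)) = Real.exp (-(c₅ / 2 * L)) * Real.exp (-(c₅ / 2 * L)) := by
    rw [← Real.exp_add]
    congr 1
    ring
  have h5 : Real.exp (-(c₅ * L)) ≤ 7⁻¹ * Real.exp (-(c₅ / 2 * L)) := by
    rw [h4]
    gcongr
  linarith

section Eventually

variable {p : ℕ → ℕ} {X : ∀ n, Matrix (Fin n) (Fin (p n)) ℝ} {σ₀ : ℝ} {β₀ : ∀ n, Fin (p n) → ℝ}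

lemma Regime.eventually_le_log (h : Regime p X σ₀ β₀) (B : ℝ) :
    ∀ᶠ n in atTop, B ≤ Real.log (p n) := by
  have h1 : Tendsto (fun n : ℕ => Real.log n) atTop atTop :=
    Real.tendsto_log_atTop.comp tendsto_natCast_atTop_atTop
  filter_upwards [h1.eventually_ge_atTop B, h.high_dim, eventually_gt_atTop 0] with n hn hp hn0
  refine hn.trans (Real.log_le_log (by exact_mod_cast hn0) (by exact_mod_cast hp.le))

lemma Regime.eventually_rate_le (h : Regime p X σ₀ β₀) {η : ℝ} (hη : 0 < η) :
    ∀ᶠ n in atTop, rate n (p n) (support (β₀ n)).card ≤ η :=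
  (h.rate_tendsto.eventually (gt_mem_nhds hη)).mono fun _ hn => hn.le

lemma SpikePrior.eventually_le {h₀ : ℕ → Measure ℝ} {z₀ : ℕ → ℝ} (hs : SpikePrior p h₀ z₀)
    (h : Regime p X σ₀ β₀) {η : ℝ} (hη : 0 < η) :
    ∀ᶠ n : ℕ in atTop, √(n : ℝ) * p n * z₀ n ≤ η * √(Real.log (p n)) := by
  filter_upwards [hs.small.eventually (gt_mem_nhds hη), h.high_dim, eventually_gt_atTop 0,
    h.eventually_le_log 1] with n hn hp hn0 hlog
  have hn' : (0 : ℝ) < n := by exact_mod_cast hn0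
  have hp' : (0 : ℝ) < p n := by exact_mod_cast (by omega : 0 < p n)
  rw [div_lt_iff₀ (by positivity)] at hn
  calc √(n : ℝ) * p n * z₀ n ≤ √(n : ℝ) * p n * (η * (1 / p n * √(Real.log (p n) / n))) := by
        gcongr
    _ = η * (√(n : ℝ) * √(Real.log (p n) / n)) := by field_simp
    _ = _ := by
        rw [← Real.sqrt_mul hn'.le]
        congr 2
        field_simp

lemma SlabPrior.exists_eventually_le {A₃ : ℝ} {h₁ : ℕ → ℝ → ℝ} (h : SlabPrior A₃ p σ₀ β₀ h₁) :
    ∃ c > 0, ∀ᶠ n in atTop, ∀ z, |z| ≤ slabRadius n σ₀ (β₀ n) →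
      c * (p n : ℝ) ^ (-A₃) ≤ h₁ n z := by
  obtain ⟨C, hC, hb⟩ := h.thick.exists_pos
  refine ⟨C⁻¹, inv_pos.2 hC, ?_⟩
  filter_upwards [hb.bound] with n hn z hz
  have hnn : ∀ y ∈ h₁ n '' {z | |z| ≤ slabRadius n σ₀ (β₀ n)}, 0 ≤ y := by
    rintro _ ⟨z, -, rfl⟩
    exact (h.density n).nonneg z (Set.mem_univ z)
  have h1 : sInf (h₁ n '' {z | |z| ≤ slabRadius n σ₀ (β₀ n)}) ≤ h₁ n z :=
    csInf_le ⟨0, hnn⟩ ⟨z, hz, rfl⟩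
  rw [Real.norm_of_nonneg (by positivity), Real.norm_of_nonneg (Real.sInf_nonneg hnn)] at hn
  rw [inv_mul_le_iff₀ hC]
  exact hn.trans (by gcongr)

lemma ModelPrior.exists_eventually_le {A₁ A₂ : ℝ} {w : ∀ n, Finset (Fin (p n)) → ℝ}
    (h : ModelPrior A₁ A₂ p β₀ w) :
    ∃ C > 0, ∀ᶠ n in atTop, 1 ≤ C * w n ∅ := by
  obtain ⟨C, hC, hb⟩ := h.empty.2.exists_pos
  refine ⟨C, hC, ?_⟩
  filter_upwards [hb.bound] with n hn
  simpa [abs_of_nonneg (h.nonneg n ∅)] using hn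

end Eventually

end SpikeSlab

theorem theorem2
    (A₁ A₂ A₃ K M₁ M₂ M₃ : ℝ)
    (hA₁ : 0 < A₁) (hA₂ : 0 < A₂) (hA₃ : 0 < A₃) (hK : 0 < K)
    (hA : A₁ + A₃ + 1 < A₂ * K)
    (hM₁ : √(8 * max A₂ 1 * K) < M₁)
    (hM₂ : √(8 * max A₂ 1 * K) < M₂)
    (hM₃ : √(8 * max A₂ 1 * K) < M₃) :
    ∃ C₃ > (0 : ℝ), ∃ C₄ > (0 : ℝ),
      ∀ (p : ℕ → ℕ) (X : ∀ n, Matrix (Fin n) (Fin (p n)) ℝ) (σ₀ : ℝ)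
        (β₀ : ∀ n, Fin (p n) → ℝ) (g : ℝ → ℝ) (w : ∀ n, Finset (Fin (p n)) → ℝ)
        (h₀ : ℕ → Measure ℝ) (h₁ : ℕ → ℝ → ℝ) (z₀ : ℕ → ℝ),
        Regime p X σ₀ β₀ →
        VariancePrior g →
        ModelPrior A₁ A₂ p β₀ w →
        SpikePrior p h₀ z₀ →
        SlabPrior A₃ p σ₀ β₀ h₁ →
        (∀ᶠ n in atTop, 1 ≤ K * (support (β₀ n)).card) →
        (∀ᶠ n in atTop, 0 < lam K (X n) (β₀ n)) →
        (∀ᶠ n in atTop, BetaMin K M₃ (X n) σ₀ (β₀ n)) →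
        ∀ᶠ n in atTop,
          ENNReal.ofReal
              (1 - Real.exp (-(C₄ * (support (β₀ n)).card * Real.log (p n)))) ≤
            responseLaw (X n) σ₀ (β₀ n)
              {Y | ENNReal.ofReal
                    (1 - Real.exp (-(C₃ * (support (β₀ n)).card * Real.log (p n)))) ≤
                  posteriorProb (X n) (prior (X n) g (w n) (h₀ n) (h₁ n)) Y
                    (concentrationSet K M₁ M₂ (X n) σ₀ (β₀ n) (z₀ n))} := by
  obtain ⟨δ, hδ⟩ : ∃ δ, δ = A₂ * K - (A₁ + A₃ + 1) := ⟨_, rfl⟩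
  have hδ0 : 0 < δ := by linarith
  obtain ⟨R, hR⟩ : ∃ R, R = max A₂ 1 * K := ⟨_, rfl⟩
  have hA₂R : A₂ * K ≤ R := hR ▸ mul_le_mul_of_nonneg_right (le_max_left _ _) hK.le
  have hKR : K ≤ R := hR ▸ le_mul_of_one_le_left hK.le (le_max_right _ _)
  have hR0 : 0 < R := hK.trans_le hKR
  have h8 : 8 * max A₂ 1 * K = 8 * R := by rw [hR]; ring
  rw [h8] at hM₁ hM₂ hM₃
  obtain ⟨M, hMdef⟩ : ∃ M, M = min M₂ M₃ := ⟨_, rfl⟩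
  have hMM₂ : M ≤ M₂ := hMdef ▸ min_le_left _ _
  have hMM₃ : M ≤ M₃ := hMdef ▸ min_le_right _ _
  obtain ⟨T, t, hT0, hTM, ht0, ht1, htT⟩ := exists_threshold hR0 (hMdef ▸ lt_min hM₂ hM₃)
  obtain ⟨κ, hκ0, hκ1, hκM⟩ := exists_shrinkage hT0 hTM
  obtain ⟨μ, hμ⟩ : ∃ μ, μ = t * T ^ 2 - R := ⟨_, rfl⟩
  have hμ0 : 0 < μ := by linarith
  have hM₁0 : 0 < M₁ := (Real.sqrt_nonneg _).trans_lt hM₁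
  obtain ⟨μ', hμ'⟩ : ∃ μ', μ' = M₁ ^ 2 / 8 - R := ⟨_, rfl⟩
  have hμ'0 : 0 < μ' := by
    have := (Real.sqrt_lt' hM₁0).1 hM₁
    linarith
  -- `5 η² ≤ δ / 8`, so that the divergence near the truth costs at most `δ / 8`
  obtain ⟨η, hη0, hη1, hηδ⟩ : ∃ η : ℝ, 0 < η ∧ η ≤ 1 ∧ 5 * η ^ 2 ≤ δ / 8 := by
    refine ⟨min 1 (δ / 40), lt_min one_pos (by positivity), min_le_left _ _, ?_⟩
    have h1 : min 1 (δ / 40) ≤ δ / 40 := min_le_right _ _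
    have h2 : min 1 (δ / 40) ≤ 1 := min_le_left _ _
    have h3 : 0 < min 1 (δ / 40) := lt_min one_pos (by positivity)
    nlinarith
  -- `c₄` is the exponent of the level of the test, `c₅` that of the whole failure probability
  obtain ⟨c₄, hc₄0, hc₄M, hc₄μ⟩ : ∃ c₄ : ℝ, 0 < c₄ ∧ c₄ ≤ M₁ ^ 2 / 16 ∧ c₄ ≤ μ / 2 :=
    ⟨min (M₁ ^ 2 / 16) (μ / 2), lt_min (by positivity) (by positivity), min_le_left _ _,
      min_le_right _ _⟩
  obtain ⟨c₅, hc₅0, hc₅₄, hc₅δ⟩ : ∃ c₅ : ℝ, 0 < c₅ ∧ c₅ ≤ c₄ ∧ c₅ ≤ δ / 8 :=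
    ⟨min c₄ (δ / 8), lt_min hc₄0 (by positivity), min_le_left _ _, min_le_right _ _⟩
  -- Of the surplus `δ = A₂ K - (A₁ + A₃ + 1)` of the exponents, `δ / 4` is spent on the posterior
  -- mass outside the concentration set, and `δ / 8` each on the constants in the bounds for the
  -- test and for the prior mass near the truth, on the divergence and on the failure of the
  -- evidence bound; the remaining `δ / 4` bounds the probability in Markov's inequality.
  refine ⟨δ / 4, by positivity, c₅ / 2, by positivity, ?_⟩
  intro p X σ₀ β₀ g w h₀ h₁ z₀ hreg hg hw hspike hslab hKs hlam hmin
  have hσ₀ := hreg.sigma_pos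
  obtain ⟨cg, hcg, a₀, ha₀, hgm⟩ := exists_le_densityLaw_Icc hg hσ₀
  obtain ⟨c, hc, hslab'⟩ := hslab.exists_eventually_le
  obtain ⟨C₀, hC₀, hw0⟩ := hw.exists_eventually_le
  obtain ⟨C, hC⟩ : ∃ C, C = (√(1 - 2 * t))⁻¹ := ⟨_, rfl⟩
  have hC1 : 1 ≤ C := hC ▸ one_le_inv_sqrt ht1 ht0
  obtain ⟨B₁, hB₁⟩ := exists_forall_exp_neg_le (b := cg * η / 2) (c := c * η) (d := δ / 8)
    (by positivity) (by positivity) (by positivity)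
  obtain ⟨B₂, hB₂⟩ := exists_forall_exp_neg_le (b := 1) (c := (C ^ (K + 1))⁻¹) (d := μ / 2)
    (by positivity) (by positivity) (by positivity)
  obtain ⟨B₃, hB₃⟩ := exists_forall_exp_neg_le (b := (C₀ + 3)⁻¹) (c := 1) (d := δ / 8)
    (by positivity) (by positivity) (by positivity)
  obtain ⟨B₄, hB₄⟩ := exists_forall_exp_neg_le (b := 7⁻¹) (c := 1) (d := c₅ / 2)
    (by positivity) (by positivity) (by positivity)
  -- `log p` is large: it absorbs the constants
  have hlogs : ∀ᶠ n in atTop, B₁ ≤ Real.log (p n) ∧ B₂ ≤ Real.log (p n) ∧ B₃ ≤ Real.log (p n) ∧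
      B₄ ≤ Real.log (p n) ∧ 1 ≤ Real.log (p n) ∧ 1 / (A₂ * K) ≤ Real.log (p n) := by
    simp only [eventually_and]
    exact ⟨hreg.eventually_le_log _, hreg.eventually_le_log _, hreg.eventually_le_log _,
      hreg.eventually_le_log _, hreg.eventually_le_log _, hreg.eventually_le_log _⟩
  have hκpos : 0 < (1 - κ ^ 2) / (2 * M₁) :=
    div_pos (sub_pos.2 (pow_lt_one₀ hκ0.le hκ1 two_ne_zero)) (by positivity)
  have hrates : ∀ᶠ n in atTop, ∀ ε, ε = rate n (p n) (support (β₀ n)).card →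
      ε ≤ 1 ∧ ε ≤ a₀ ∧ ε ≤ 1 / (1 + A₂ * K) ∧
        ε ≤ M₁ / (2 * T ^ 2) ∧ ε ≤ (1 - κ ^ 2) / (2 * M₁) ∧ ε ≤ 1 / (2 * M₁) ∧ ε ≤ 1 / 2 := by
    simp only [forall_eq, eventually_and]
    exact ⟨hreg.eventually_rate_le one_pos, hreg.eventually_rate_le ha₀,
      hreg.eventually_rate_le (by positivity), hreg.eventually_rate_le (by positivity),
      hreg.eventually_rate_le hκpos, hreg.eventually_rate_le (by positivity),
      hreg.eventually_rate_le (by positivity)⟩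
  -- `√n p z₀` bounds the contribution of the inactive coefficients to the mean of `Y / σ`
  have hspikes : ∀ᶠ n : ℕ in atTop, ∀ ρ, ρ = √(n : ℝ) * p n * z₀ n →
      ρ ≤ (M / 2 - T) / 4 * √(Real.log (p n)) ∧ ρ ≤ η / 2 * √(Real.log (p n)) ∧
        ρ ≤ √μ' * √(Real.log (p n)) := by
    simp only [forall_eq, eventually_and]
    exact ⟨hspike.eventually_le hreg (by linarith), hspike.eventually_le hreg (by positivity),
      hspike.eventually_le hreg (by positivity)⟩
  filter_upwards [hreg.fullRank, hreg.high_dim, eventually_gt_atTop 0, hKs, hlam, hmin, hslab', hw0,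
    hw.true_model, hw.large_models, hlogs, hrates, hspikes] with n hfull hnp hn hKs hlam hmin hslab'
    hw0 htrue hlarge hlogs hrates hspikes
  obtain ⟨hlog₁, hlog₂, hlog₃, hlog₄, hlog, hlogA⟩ := hlogs
  have := hspike.prob n
  obtain ⟨s, hs⟩ : ∃ s, s = (support (β₀ n)).card := ⟨_, rfl⟩
  obtain ⟨ε, hε⟩ : ∃ ε, ε = rate n (p n) s := ⟨_, rfl⟩
  obtain ⟨ρ, hρ⟩ : ∃ ρ, ρ = √(n : ℝ) * p n * z₀ n := ⟨_, rfl⟩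
  obtain ⟨L, hL⟩ : ∃ L, L = s * Real.log (p n) := ⟨_, rfl⟩
  obtain ⟨hε1, hεa, hεA, hεT, hεκ, hεM, hε2⟩ := hrates ε (hs ▸ hε)
  obtain ⟨hρ₁, hρ₂, hρ₃⟩ := hspikes ρ hρ
  rw [← hs] at hKs htrue ⊢
  have hn' : (0 : ℝ) < n := by exact_mod_cast hn
  have hp : 0 < p n := by omega
  have hp' : (0 : ℝ) < p n := by exact_mod_cast hp
  have hs1 : 1 ≤ s := by
    rw [Nat.one_le_iff_ne_zero]
    rintro rfl
    norm_num at hKs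
  have hs1' : (1 : ℝ) ≤ s := by exact_mod_cast hs1
  have hnε : n * ε ^ 2 = L := by rw [hε, hL]; exact natCast_mul_rate_sq hn
  have hlogL : Real.log (p n) ≤ L := hL ▸ le_mul_of_one_le_left (by linarith only [hlog]) hs1'
  have hL1 : 1 ≤ L := hlog.trans hlogL
  have hL0 : 0 ≤ L := zero_le_one.trans hL1
  have hε0 : 0 ≤ ε := hε ▸ Real.sqrt_nonneg _
  obtain ⟨l, hl⟩ : ∃ l, l = √(n : ℝ) * ε := ⟨_, rfl⟩
  have hl2 : l ^ 2 = L := by rw [hl, mul_pow, Real.sq_sqrt hn'.le, hnε]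
  have hlpos : 0 < l := by
    refine lt_of_le_of_ne (hl ▸ by positivity) fun h => ?_
    rw [← h] at hl2
    linarith only [hl2, hL1]
  have hsl : √(Real.log (p n)) ≤ l := by
    rw [← Real.sqrt_sq hlpos.le, hl2]
    exact Real.sqrt_le_sqrt hlogL
  have hρ0 : 0 ≤ ρ := hρ ▸ mul_nonneg (by positivity) (hspike.nonneg n)
  have hpn : p n * Real.exp (-(n : ℝ)) ≤ Real.exp (-(A₂ * K * L)) :=
    mul_exp_neg_le_exp_neg hn' hp' hnε hε0 hε1 (by positivity) hεA hlogL
  have hsn : s ≤ n := by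
    have h2 : (s : ℝ) ≤ L := hL ▸ le_mul_of_one_le_right (by positivity) hlog
    have h3 : L ≤ n := hnε ▸ mul_le_of_le_one_right hn'.le (pow_le_one₀ hε0 hε1)
    exact_mod_cast h2.trans h3
  have hw0' : 0 < w n ∅ := pos_of_mul_pos_right (one_pos.trans_le hw0) hC₀.le
  have hx1 : M₁ * ε ≤ 1 / 2 := by
    rw [le_div_iff₀ (by positivity)] at hεM
    linarith only [hεM]
  have hCs : C ^ (K * s + s) ≤ Real.exp (μ / 2 * L) := by
    have h := hB₂ _ hlog₂ s hs1'
    rw [one_mul, Real.inv_rpow (by positivity), ← Real.rpow_mul (by positivity), Real.exp_neg,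
      inv_le_inv₀ (by positivity) (by positivity), ← hL] at h
    rwa [← add_one_mul]
  have hpn2 : p n * Real.exp (-(n : ℝ)) ≤ 1 / 2 := by
    have h1 : 1 ≤ A₂ * K * L := by
      rw [div_le_iff₀' (by positivity)] at hlogA
      exact hlogA.trans (by gcongr)
    calc p n * Real.exp (-(n : ℝ)) ≤ Real.exp (-1) :=
          hpn.trans (Real.exp_le_exp.2 (by linarith only [h1]))
      _ ≤ 1 / 2 := by
        rw [Real.exp_neg, inv_le_comm₀ (by positivity) (by positivity)]
        have := Real.exp_one_gt_d9
        norm_num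
        linarith only [this]
  have hpriormass := exp_neg_le_prior_nearTruth (X := X n) (z₀ := z₀ n) (h₀ := h₀ n) hs.symm hs1 hsn
    hnp hlog hg.density (hslab.density n) (hw.nonneg n) (hw.sum_eq_one n) hw0' hfull hσ₀ hη0.le hη1
    (hε ▸ hε1) hcg.le hc.le (hgm _ (mul_nonneg hη0.le (hε ▸ hε0))
      ((mul_le_of_le_one_left (hε ▸ hε0) hη1).trans (hε ▸ hεa))) htrue hslab' (hspike.tail n)
    hpn2 (hB₁ _ hlog₁ s hs1')
  rw [← hε, ← hL] at hpriormass
  have e : n * (M₁ * ε) ^ 2 = M₁ ^ 2 * L := by rw [← hnε]; ring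
  have hmain := posteriorProb_concentrationSet (X := X n) (β₀ := β₀ n) (g := g) (w := w n)
    (h₀ := h₀ n) (h₁ := h₁ n) (K := K) (M := M) (M₁ := M₁) (M₂ := M₂) (M₃ := M₃) (T := T) (κ := κ)
    (t := t) (ε := ε) (a := η * ε) (r := η * σ₀ * √(Real.log (p n) / (n * s)))
    (α := 5 * Real.exp (-(c₄ * L))) (τ := Real.exp (-((A₂ * K - δ / 8) * L)))
    (γ := Real.exp (-((A₁ + A₃ + 1 + δ / 8) * L))) (x := Real.exp (-(δ / 4 * L)))
    (y := Real.exp (-(δ / 8 * L))) (W := Real.exp (-(A₂ * K * L)))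
    hn hp (hreg.standardized n) hσ₀ (hspike.nonneg n) (Finset.card_pos.1 (hs ▸ hs1)) hlam hmin
    hMM₂ hMM₃ (hs ▸ hε) (by positivity) hx1 hT0.le ?_ ht1 ht0 hκ0 ?_ ?_ hg.density
    (hslab.density n) (hw.nonneg n) hw0' (hspike.tail n) ?_ (by positivity) ?_ (Real.exp_pos _)
    (Real.exp_pos _) (Real.exp_pos _) hpriormass ?_ ?_
  · have hk := nearTruth_exponent_le (σ := σ₀) (ρ := ρ) hn' (by positivity) hσ₀
      (zero_le_one.trans hlog) hη0.le hL hnε hlpos.le hl2 hρ0 ?_ hηδ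
    · rw [← hs, ← hρ] at hmain
      rw [mul_assoc, ← hL]
      simp_rw [mul_assoc (δ / 4), ← hL]
      refine (ENNReal.ofReal_le_ofReal (sub_le_sub_left ?_ 1)).trans hmain
      have h := hB₄ _ hlog₄ s hs1'
      rw [Real.one_rpow, mul_one, ← hL] at h
      exact failure_le hL0 hδ0.le (by rw [hδ]; ring) hk hc₅₄ hc₅δ h
    · have : ρ ≤ η / 2 * l := hρ₂.trans (by gcongr)
      linarith only [this]
  · rw [le_div_iff₀ (by positivity)] at hεT
    have := mul_le_mul_of_nonneg_left hεT hε0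
    linarith only [this]
  · rw [le_div_iff₀ (by positivity)] at hεκ
    have h1 : κ ^ 2 ≤ 1 := pow_le_one₀ hκ0.le hκ1.le
    have h2 := mul_le_mul_of_nonneg_right h1 (mul_nonneg hM₁0.le hε0)
    linarith only [h2, hεκ]
  · rw [← mul_assoc κ, hκM, ← hρ, ← hl]
    have : ρ ≤ (M / 2 - T) / 4 * l := hρ₁.trans (by gcongr; linarith only [hTM])
    have h2 : 0 < (M / 2 - T) * l := mul_pos (by linarith only [hTM]) hlpos
    linarith only [this, h2]
  · rw [← hs]
    refine (hlarge _ hKs).trans (le_of_eq ?_)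
    rw [Real.rpow_def_of_pos hp', hL]
    congr 1
    ring
  · calc η * ε ≤ 1 * ε := by gcongr
      _ ≤ 1 / 2 := by rwa [one_mul]
  · rw [e, hnε, ← hs, ← hC, Real.rpow_def_of_pos hp',
      show Real.log (p n) * (K * s) = K * L by rw [hL]; ring]
    refine level_le hL0 hKR ?_ hc₄M hc₄μ hCs
    rw [hμ]
    ring
  · rw [e, hnε, ← hs, ← hρ, ← hC]
    refine power_le (μ' := μ') hL0 hA₂R hμ0.le ?_ ?_ hCs hw0 hw0' hpn ?_ ?_
    · rw [hμ]
      ring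
    · rw [hμ']
      ring
    · calc ρ ^ 2 ≤ (√μ' * l) ^ 2 := by
            gcongr
            exact hρ₃.trans (by gcongr)
        _ = μ' * L := by rw [mul_pow, Real.sq_sqrt hμ'0.le, hl2]
    · have h := hB₃ _ hlog₃ s hs1'
      rwa [Real.one_rpow, mul_one, ← hL, Real.exp_neg,
        inv_le_inv₀ (by positivity) (by positivity)] at h
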